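/- Conventions. Latin indices range over $1,2,3$, repeated indices are summed, $f_{,i}=\partial f/\partial x_i$, a dot is $\partial/\partial t$, $I=[0,\infty)$, and $[f_1*f_2](t)=\int_0^t f_1(s)f_2(t-s)\,ds$. A function is of class $C^{M,N}(\bar B\times I)$ if its space derivatives of order $m\le M$ of its time derivatives of order $n\le N$, $m+n\le\max(M,N)$, exist and are continuous on $\bar B\times I$. **Setting.** Let $B\subset\mathbb R^3$ be a bounded open set whose boundary $\partial B$ is a $C^\infty$ surface with $B$ locally on one side, $n$ the outward unit normal, $da$ the area measure on $\partial B$, $\mathcal D f=n_if_{,i}$, $\mathcal D_jf=(\delta_{ij}-n_in_j)f_{,i}$. Let $S_i,\Sigma_i\subseteq\partial B$ with $\bar S_i\cup\Sigma_i=\partial B$, $S_i\cap\Sigma_i=\varnothing$ $(i=1,\dots,5)$. Let $\rho>0$, $T_0>0$, $\beta\ne0$, $c\neq0$, $\gamma$, and $a^{(11)}_{ijkl},a^{(17)}_{ijkl},a^{(77)}_{ijkl},a^{(23)}_{ijkl},a^{(22)}_{ijklhm},a^{(14)}_{ij},a^{(47)}_{ij},a^{(33)}_{ij},k_{ij}$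 be real constants with $\beta'=\beta+\gamma/(c\beta)\ne0$, with $a^{(11)}_{ijkl}=a^{(11)}_{jikl}=a^{(11)}_{klij}$, $a^{(77)}_{ijkl}=a^{(77)}_{jikl}=a^{(77)}_{klij}$, $a^{(22)}_{ijklhm}=a^{(22)}_{jiklhm}=a^{(22)}_{lhmijk}$, $a^{(23)}_{ijkl}=a^{(23)}_{jikl}$, $a^{(17)}_{ijkl}=a^{(17)}_{jikl}$, with $a^{(14)},a^{(47)},a^{(33)},k$ symmetric, and with $\frac{\gamma}{\beta}x^2+k_{ij}y_iy_j\ge0$ for all $x\in\mathbb R$, $y\in\mathbb R^3$. **The problem $\Pi$.** Data: functions $f_i,g,h$ continuous on $\bar B\times I$, $u_i^0,v_i^0,\theta^0,\eta^0$ continuous on $\bar B$, and $\hat u_i,\hat d_i,\hat\theta,\hat\varphi,\hat\omega$ and $\hat P_i,\hat R_i,\hat q,\hat\Lambda,\hat H$, continuous on $S_1\times I,\dots,S_5\times I$ and on $\Sigma_1\times I,\dots,\Sigma_5\times I$ respectively. A solution is an array $\pi=(u_i,\theta,\varphi,e_{ij},\kappa_{ijk},\beta_i,E_i,V_{ij},\tau_{ij},\mu_{ijk},\sigma_i,Q_{ij},\eta,q_i)$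 of functions on $\bar B\times I$ such that: 1. $u_i\in C^{4,2}$, $\varphi\in C^{4,0}$, $\theta\in C^{2,2}$, $e_{ij},V_{ij}\in C^{2,1}$, $\eta\in C^{0,1}$, $\kappa_{ijk},E_i,\mu_{ijk},Q_{ij}\in C^{2,0}$, $\beta_i,\tau_{ij},q_i\in C^{1,0}$ on $\bar B\times I$, and $e_{ij},V_{ij},\tau_{ij},Q_{ij}$ are symmetric, $\kappa_{ijk}=\kappa_{jik}$, $\mu_{ijk}=\mu_{jik}$; 2. on $B\times I$: $\tau_{ji,j}-\mu_{kji,kj}+\rho f_i=\rho\ddot u_i$, $\sigma_{i,i}-Q_{ji,ji}=g$, $\rho T_0\dot\eta+q_{j,j}-\rho h=0$, $e_{ij}=\frac12(u_{i,j}+u_{j,i})$, $\kappa_{ijk}=u_{k,ij}$, $\beta_i=\theta_{,i}$, $E_i=-\varphi_{,i}$, $V_{ij}=-\varphi_{,ij}$; 3. on $\bar B\times I$: $$\begin{aligned}\tau_{ij}&=a^{(11)}_{ijkl}e_{kl}+a^{(17)}_{ijkl}V_{kl}+a^{(14)}_{ij}(\theta+\beta\dot\theta),&\mu_{ijk}&=a^{(22)}_{ijklhm}\kappa_{lhm}+a^{(23)}_{ijkl}E_l,\\-\sigma_i&=a^{(23)}_{jkli}\kappa_{jkl}+a^{(33)}_{ij}E_j,&-Q_{ij}&=a^{(17)}_{klij}e_{kl}+a^{(77)}_{ijkl}V_{kl}+a^{(47)}_{ij}(\theta+\beta\dot\theta),\\-\rho\eta&=a^{(14)}_{ij}e_{ij}+a^{(47)}_{ij}V_{ij}+c(\theta+\beta'\dot\theta),&-q_i/T_0&=k_{ij}\beta_j;\end{aligned}$$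 4. $u_i=u_i^0$, $\dot u_i=v_i^0$, $\theta=\theta^0$, $\eta=\eta^0$ at $t=0$ on $\bar B$; 5. $u_i=\hat u_i$, $\mathcal Du_i=\hat d_i$, $\theta=\hat\theta$, $\varphi=\hat\varphi$, $\mathcal D\varphi=\hat\omega$ on $S_1\times I,\dots,S_5\times I$ respectively, and $P_i=\hat P_i$, $R_i=\hat R_i$, $q=\hat q$, $\Lambda=\hat\Lambda$, $H=\hat H$ on $\Sigma_1\times I,\dots,\Sigma_5\times I$ respectively, where $q=q_in_i$, $R_i=\mu_{kji}n_kn_j$, $H=Q_{kj}n_kn_j$ and $$\begin{aligned}P_i&=(\tau_{ji}-\mu_{kji,k})n_j-\mathcal D_j(\mu_{kji}n_k)+(\mathcal D_ln_l)\mu_{kji}n_kn_j,\\ \Lambda&=(\sigma_j-Q_{kj,k})n_j-\mathcal D_j(Q_{kj}n_k)+(\mathcal D_ln_l)Q_{kj}n_kn_j.\end{aligned}$$ **The functional.** Put $l(t)=1$, $\xi(t)=t$, $\zeta(t)=\frac1\beta e^{-t/\beta}$, $\chi(t)=\frac1{\beta'}e^{-t/\beta'}$ and $$\mathcal F_i=\rho\,\xi*f_i+\rho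 v_i^0t+\rho u_i^0,\quad \mathcal H=\rho T_0\eta^0+l*\rho h,\quad \mathcal L_{ij}=a^{(14)}_{ij}\theta^0e^{-t/\beta},\quad \mathcal M_{ij}=a^{(47)}_{ij}\theta^0e^{-t/\beta},\quad \mathcal R=c\,\theta^0e^{-t/\beta'}.$$ For $\alpha=1,2$ let $\pi^{(\alpha)}$ be a solution of $\Pi$ for data $\Gamma^{(\alpha)}$ (same body, material, $S_i$, $\Sigma_i$), mark all the associated quantities by $(\alpha)$, and define $$\begin{aligned}\mathcal I_{\alpha\beta}(t)=\;&\chi*\zeta*\int_B\bigl[\mathcal F_i^{(\alpha)}*u_i^{(\beta)}-\xi*g^{(\alpha)}*\varphi^{(\beta)}\bigr](t)\,dv\\&+\chi*\xi*\int_{\partial B}\Bigl\{\zeta*\bigl[P_i^{(\alpha)}*u_i^{(\beta)}+R_i^{(\alpha)}*\mathcal Du_i^{(\beta)}+\Lambda^{(\alpha)}*\varphi^{(\beta)}+H^{(\alpha)}*\mathcal D\varphi^{(\beta)}\bigr]+\tfrac1{T_0}\,l*q^{(\alpha)}*\theta^{(\beta)}\Bigr\}(t)\,da\\&+\xi*\int_B\Bigl\{\chi*\bigl(\mathcal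 L_{ij}^{(\alpha)}*e_{ij}^{(\beta)}+\mathcal M_{ij}^{(\alpha)}*V_{ij}^{(\beta)}\bigr)+\mathcal R^{(\alpha)}*\theta^{(\beta)}-\chi*\tfrac1{T_0}\mathcal H^{(\alpha)}*\theta^{(\beta)}\Bigr\}(t)\,dv.\end{aligned}$$ **Theorem.** $\mathcal I_{\alpha\beta}(t)=\mathcal I_{\beta\alpha}(t)$ for all $t\in I$ and all $\alpha,\beta\in\{1,2\}$. -/

import Mathlib

open MeasureTheory Set Topology
open scoped ContDiff

noncomputable section

namespace Thermopiezo

/-- Euclidean three-dimensional space. -/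
abbrev E3 : Type := EuclideanSpace ℝ (Fin 3)

/-- Scalar fields depending on position and time. -/
abbrev Field : Type := E3 → ℝ → ℝ

/-! ### The body -/

/-- `φ` describes the open set `B` near its boundary point `x` as `{φ < 0}`, with `φ` smooth and
`∇φ(x) ≠ 0`. -/
def IsLocalDefiningFunction (B : Set E3) (x : E3) (φ : E3 → ℝ) : Prop :=
  ContDiff ℝ ∞ φ ∧ gradient φ x ≠ 0 ∧ ∀ᶠ y in 𝓝 x, (y ∈ B ↔ φ y < 0)

/-- `∂B` is a smooth surface, with `B` on one side of it. -/
def HasSmoothBoundary (B : Set E3) : Prop :=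
  ∀ x ∈ frontier B, ∃ φ : E3 → ℝ, IsLocalDefiningFunction B x φ

/-- On `∂B` the field `n` is the outward unit normal. Off `∂B` it is an arbitrary smooth
extension, which is only there to be differentiated along `∂B`. -/
def IsOutwardUnitNormal (B : Set E3) (n : E3 → E3) : Prop :=
  ContDiff ℝ ∞ n ∧ ∀ x ∈ frontier B, ∀ φ : E3 → ℝ, IsLocalDefiningFunction B x φ →
    n x = ‖gradient φ x‖⁻¹ • gradient φ x

/-- The area measure on `∂B`. -/
def area (B : Set E3) : Measure E3 :=
  (Measure.euclideanHausdorffMeasure 2 : Measure E3).restrict (frontier B)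

/-- The sets `S i`, `Sg i` (written `S₁, …, S₅` and `Σ₁, …, Σ₅`) carry the two kinds of boundary
conditions. As `∂B` is closed, closures relative to `∂B` are closures. -/
def IsBoundaryPartition (B : Set E3) (S Sg : Fin 5 → Set E3) : Prop :=
  ∀ i, S i ⊆ frontier B ∧ Sg i ⊆ frontier B ∧
    closure (S i) ∪ Sg i = frontier B ∧ S i ∩ Sg i = ∅

/-! ### Derivatives and regularity -/

/-- The partial derivative `f_{,i}` on `closure B` (one-sided at `∂B`). -/
def pd (B : Set E3) (i : Fin 3) (f : Field) : Field := fun x t =>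
  fderivWithin ℝ (fun y => f y t) (closure B) x (EuclideanSpace.single i 1)

/-- The time derivative on `[0, ∞)` (one-sided at `0`). -/
def dt (f : Field) : Field := fun x t => derivWithin (f x) (Ici 0) t

/-- The class `C^{M,N}(closure B × [0, ∞))`: the space derivatives of order `m ≤ M` of the time
derivatives of order `k ≤ N`, with `m + k ≤ max M N`, exist and are continuous on
`closure B × [0, ∞)`. -/
def IsOfClass (B : Set E3) (M N : ℕ) (f : Field) : Prop :=
  (∀ x ∈ closure B, ContDiffOn ℝ N (f x) (Ici 0)) ∧
  ∀ k ≤ N,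
    (∀ t ∈ Ici (0 : ℝ), ContDiffOn ℝ (min M (max M N - k) : ℕ)
      (fun x => iteratedDerivWithin k (f x) (Ici 0) t) (closure B)) ∧
    ∀ m ≤ M, m + k ≤ max M N →
      ContinuousOn (fun p : E3 × ℝ =>
        iteratedFDerivWithin ℝ m (fun x => iteratedDerivWithin k (f x) (Ici 0) p.2)
          (closure B) p.1) (closure B ×ˢ Ici 0)

/-- Continuity of `f` on `A × [0, ∞)`. -/
def IsContOn (A : Set E3) (f : Field) : Prop :=
  ContinuousOn (fun p : E3 × ℝ => f p.1 p.2) (A ×ˢ Ici 0)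

/-- The normal derivative `𝒟 f = n_i f_{,i}`. -/
def normalDeriv (B : Set E3) (n : E3 → E3) (f : Field) : Field := fun x t =>
  ∑ i, n x i * pd B i f x t

/-- The surface gradient `𝒟_j f = (δ_{ij} - n_i n_j) f_{,i}`. -/
def surfGrad (B : Set E3) (n : E3 → E3) (j : Fin 3) (f : Field) : Field := fun x t =>
  ∑ i, ((if i = j then 1 else 0) - n x i * n x j) * pd B i f x t

/-- `𝒟_l n_l`. -/
def surfDivNormal (B : Set E3) (n : E3 → E3) : Field := fun x t =>
  ∑ l, surfGrad B n l (fun y _ => n y l) x t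

/-! ### The material -/

/-- The constants of a homogeneous, center-symmetric material: mass density `ρ`, reference
temperature `T₀`, thermal constants `β`, `γ`, `c`, constitutive tensors `a11 = a^{(11)}` etc.,
conductivity `k`. -/
structure Material where
  ρ : ℝ
  T₀ : ℝ
  β : ℝ
  γ : ℝ
  c : ℝ
  a11 : Fin 3 → Fin 3 → Fin 3 → Fin 3 → ℝ
  a17 : Fin 3 → Fin 3 → Fin 3 → Fin 3 → ℝ
  a77 : Fin 3 → Fin 3 → Fin 3 → Fin 3 → ℝ
  a23 : Fin 3 → Fin 3 → Fin 3 → Fin 3 → ℝ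
  a22 : Fin 3 → Fin 3 → Fin 3 → Fin 3 → Fin 3 → Fin 3 → ℝ
  a14 : Fin 3 → Fin 3 → ℝ
  a47 : Fin 3 → Fin 3 → ℝ
  a33 : Fin 3 → Fin 3 → ℝ
  k : Fin 3 → Fin 3 → ℝ

/-- `β' = β + γ / (c β)`. -/
def Material.β' (m : Material) : ℝ := m.β + m.γ / (m.c * m.β)

/-- The standing assumptions on the constants: signs, symmetries, and the dissipation
inequality. -/
structure Material.IsAdmissible (m : Material) : Prop where
  ρ_pos : 0 < m.ρ
  T₀_pos : 0 < m.T₀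
  β_ne : m.β ≠ 0
  c_ne : m.c ≠ 0
  β'_ne : m.β' ≠ 0
  a11_symm : ∀ i j k l, m.a11 i j k l = m.a11 j i k l ∧ m.a11 i j k l = m.a11 k l i j
  a14_symm : ∀ i j, m.a14 i j = m.a14 j i
  a22_symm : ∀ i j k l h p,
    m.a22 i j k l h p = m.a22 j i k l h p ∧ m.a22 i j k l h p = m.a22 l h p i j k
  a23_symm : ∀ i j k l, m.a23 i j k l = m.a23 j i k l
  a33_symm : ∀ i j, m.a33 i j = m.a33 j i
  k_symm : ∀ i j, m.k i j = m.k j i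
  a17_symm : ∀ i j k l, m.a17 i j k l = m.a17 j i k l
  a77_symm : ∀ i j k l, m.a77 i j k l = m.a77 j i k l ∧ m.a77 i j k l = m.a77 k l i j
  a47_symm : ∀ i j, m.a47 i j = m.a47 j i
  dissipation : ∀ (x : ℝ) (y : Fin 3 → ℝ),
    0 ≤ m.γ / m.β * x ^ 2 + ∑ i, ∑ j, m.k i j * y i * y j

/-! ### Data and states -/

/-- The data of the mixed initial-boundary value problem. -/
structure Data where
  f : Fin 3 → Field
  g : Field
  h : Field
  u₀ : Fin 3 → E3 → ℝ
  v₀ : Fin 3 → E3 → ℝ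
  θ₀ : E3 → ℝ
  η₀ : E3 → ℝ
  uHat : Fin 3 → Field
  dHat : Fin 3 → Field
  θHat : Field
  φHat : Field
  ωHat : Field
  PHat : Fin 3 → Field
  RHat : Fin 3 → Field
  qHat : Field
  ΛHat : Field
  HHat : Field

/-- The data are continuous functions on their respective domains. -/
structure Data.IsCont (Γ : Data) (B : Set E3) (S Sg : Fin 5 → Set E3) : Prop where
  f : ∀ i, IsContOn (closure B) (Γ.f i)
  g : IsContOn (closure B) Γ.g
  h : IsContOn (closure B) Γ.h
  u₀ : ∀ i, ContinuousOn (Γ.u₀ i) (closure B)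
  v₀ : ∀ i, ContinuousOn (Γ.v₀ i) (closure B)
  θ₀ : ContinuousOn Γ.θ₀ (closure B)
  η₀ : ContinuousOn Γ.η₀ (closure B)
  uHat : ∀ i, IsContOn (S 0) (Γ.uHat i)
  dHat : ∀ i, IsContOn (S 1) (Γ.dHat i)
  θHat : IsContOn (S 2) Γ.θHat
  φHat : IsContOn (S 3) Γ.φHat
  ωHat : IsContOn (S 4) Γ.ωHat
  PHat : ∀ i, IsContOn (Sg 0) (Γ.PHat i)
  RHat : ∀ i, IsContOn (Sg 1) (Γ.RHat i)
  qHat : IsContOn (Sg 2) Γ.qHat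
  ΛHat : IsContOn (Sg 3) Γ.ΛHat
  HHat : IsContOn (Sg 4) Γ.HHat

/-- An ordered array `(u, θ, φ, e, κ, β, E, V, τ, μ, σ, Q, η, q)` of fields; `b` is the
temperature gradient `β_i`, `el` is the electric field `E_i`. -/
structure State where
  u : Fin 3 → Field
  θ : Field
  φ : Field
  e : Fin 3 → Fin 3 → Field
  κ : Fin 3 → Fin 3 → Fin 3 → Field
  b : Fin 3 → Field
  el : Fin 3 → Field
  V : Fin 3 → Fin 3 → Field
  τ : Fin 3 → Fin 3 → Field
  μ : Fin 3 → Fin 3 → Fin 3 → Field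
  σ : Fin 3 → Field
  Q : Fin 3 → Fin 3 → Field
  η : Field
  q : Fin 3 → Field

/-- Admissible arrays on `closure B × [0, ∞)`: regularity and symmetries. -/
structure State.IsAdmissible (p : State) (B : Set E3) : Prop where
  u_class : ∀ i, IsOfClass B 4 2 (p.u i)
  φ_class : IsOfClass B 4 0 p.φ
  θ_class : IsOfClass B 2 2 p.θ
  e_class : ∀ i j, IsOfClass B 2 1 (p.e i j)
  V_class : ∀ i j, IsOfClass B 2 1 (p.V i j)
  η_class : IsOfClass B 0 1 p.η
  κ_class : ∀ i j k, IsOfClass B 2 0 (p.κ i j k)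
  el_class : ∀ i, IsOfClass B 2 0 (p.el i)
  μ_class : ∀ i j k, IsOfClass B 2 0 (p.μ i j k)
  Q_class : ∀ i j, IsOfClass B 2 0 (p.Q i j)
  b_class : ∀ i, IsOfClass B 1 0 (p.b i)
  τ_class : ∀ i j, IsOfClass B 1 0 (p.τ i j)
  q_class : ∀ i, IsOfClass B 1 0 (p.q i)
  e_symm : ∀ i j, ∀ x ∈ closure B, ∀ t ≥ 0, p.e i j x t = p.e j i x t
  κ_symm : ∀ i j k, ∀ x ∈ closure B, ∀ t ≥ 0, p.κ i j k x t = p.κ j i k x t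
  V_symm : ∀ i j, ∀ x ∈ closure B, ∀ t ≥ 0, p.V i j x t = p.V j i x t
  τ_symm : ∀ i j, ∀ x ∈ closure B, ∀ t ≥ 0, p.τ i j x t = p.τ j i x t
  μ_symm : ∀ i j k, ∀ x ∈ closure B, ∀ t ≥ 0, p.μ i j k x t = p.μ j i k x t
  Q_symm : ∀ i j, ∀ x ∈ closure B, ∀ t ≥ 0, p.Q i j x t = p.Q j i x t

/-- The field equations with supplies `f, g, h`: balance equations, geometric equations, and
constitutive equations. -/
structure State.SolvesFieldEquations (p : State) (B : Set E3) (m : Material) (Γ : Data) :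
    Prop where
  motion : ∀ i, ∀ x ∈ B, ∀ t ≥ 0,
    ∑ j, pd B j (p.τ j i) x t - ∑ j, ∑ k, pd B j (pd B k (p.μ k j i)) x t + m.ρ * Γ.f i x t
      = m.ρ * dt (dt (p.u i)) x t
  electric : ∀ x ∈ B, ∀ t ≥ 0,
    ∑ i, pd B i (p.σ i) x t - ∑ i, ∑ j, pd B i (pd B j (p.Q j i)) x t = Γ.g x t
  energy : ∀ x ∈ B, ∀ t ≥ 0,
    m.ρ * m.T₀ * dt p.η x t + ∑ j, pd B j (p.q j) x t - m.ρ * Γ.h x t = 0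
  e_eq : ∀ i j, ∀ x ∈ B, ∀ t ≥ 0,
    p.e i j x t = (1 / 2) * (pd B j (p.u i) x t + pd B i (p.u j) x t)
  κ_eq : ∀ i j k, ∀ x ∈ B, ∀ t ≥ 0, p.κ i j k x t = pd B j (pd B i (p.u k)) x t
  b_eq : ∀ i, ∀ x ∈ B, ∀ t ≥ 0, p.b i x t = pd B i p.θ x t
  el_eq : ∀ i, ∀ x ∈ B, ∀ t ≥ 0, p.el i x t = - pd B i p.φ x t
  V_eq : ∀ i j, ∀ x ∈ B, ∀ t ≥ 0, p.V i j x t = - pd B j (pd B i p.φ) x t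
  τ_eq : ∀ i j, ∀ x ∈ closure B, ∀ t ≥ 0,
    p.τ i j x t = ∑ k, ∑ l, m.a11 i j k l * p.e k l x t + ∑ k, ∑ l, m.a17 i j k l * p.V k l x t
      + m.a14 i j * (p.θ x t + m.β * dt p.θ x t)
  μ_eq : ∀ i j k, ∀ x ∈ closure B, ∀ t ≥ 0,
    p.μ i j k x t = ∑ l, ∑ h, ∑ r, m.a22 i j k l h r * p.κ l h r x t
      + ∑ l, m.a23 i j k l * p.el l x t
  σ_eq : ∀ i, ∀ x ∈ closure B, ∀ t ≥ 0,
    - p.σ i x t = ∑ j, ∑ k, ∑ l, m.a23 j k l i * p.κ j k l x t + ∑ j, m.a33 i j * p.el j x t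
  Q_eq : ∀ i j, ∀ x ∈ closure B, ∀ t ≥ 0,
    - p.Q i j x t = ∑ k, ∑ l, m.a17 k l i j * p.e k l x t + ∑ k, ∑ l, m.a77 i j k l * p.V k l x t
      + m.a47 i j * (p.θ x t + m.β * dt p.θ x t)
  η_eq : ∀ x ∈ closure B, ∀ t ≥ 0,
    - (m.ρ * p.η x t) = ∑ i, ∑ j, m.a14 i j * p.e i j x t + ∑ i, ∑ j, m.a47 i j * p.V i j x t
      + m.c * (p.θ x t + m.β' * dt p.θ x t)
  q_eq : ∀ i, ∀ x ∈ closure B, ∀ t ≥ 0,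
    - (p.q i x t / m.T₀) = ∑ j, m.k i j * p.b j x t

/-- `P_i = (τ_{ji} - μ_{kji,k}) n_j - 𝒟_j(μ_{kji} n_k) + (𝒟_l n_l) μ_{kji} n_k n_j`. -/
def State.P (p : State) (B : Set E3) (n : E3 → E3) (i : Fin 3) : Field := fun x t =>
  ∑ j, (p.τ j i x t - ∑ k, pd B k (p.μ k j i) x t) * n x j
    - ∑ j, ∑ k, surfGrad B n j (fun y s => p.μ k j i y s * n y k) x t
    + surfDivNormal B n x t * ∑ j, ∑ k, p.μ k j i x t * n x k * n x j

/-- `R_i = μ_{kji} n_k n_j`. -/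
def State.R (p : State) (n : E3 → E3) (i : Fin 3) : Field := fun x t =>
  ∑ j, ∑ k, p.μ k j i x t * n x k * n x j

/-- `Λ = (σ_j - Q_{kj,k}) n_j - 𝒟_j(Q_{kj} n_k) + (𝒟_l n_l) Q_{kj} n_k n_j`. -/
def State.Λ (p : State) (B : Set E3) (n : E3 → E3) : Field := fun x t =>
  ∑ j, (p.σ j x t - ∑ k, pd B k (p.Q k j) x t) * n x j
    - ∑ j, ∑ k, surfGrad B n j (fun y s => p.Q k j y s * n y k) x t
    + surfDivNormal B n x t * ∑ j, ∑ k, p.Q k j x t * n x k * n x j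

/-- `H = Q_{kj} n_k n_j`. -/
def State.H (p : State) (n : E3 → E3) : Field := fun x t =>
  ∑ j, ∑ k, p.Q k j x t * n x k * n x j

/-- The normal heat flux `q = q_i n_i`. -/
def State.heatFlux (p : State) (n : E3 → E3) : Field := fun x t => ∑ i, p.q i x t * n x i

/-- The initial conditions on `closure B`. -/
structure State.SatisfiesInitial (p : State) (B : Set E3) (Γ : Data) : Prop where
  u : ∀ i, ∀ x ∈ closure B, p.u i x 0 = Γ.u₀ i x
  v : ∀ i, ∀ x ∈ closure B, dt (p.u i) x 0 = Γ.v₀ i x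
  θ : ∀ x ∈ closure B, p.θ x 0 = Γ.θ₀ x
  η : ∀ x ∈ closure B, p.η x 0 = Γ.η₀ x

/-- The boundary conditions. -/
structure State.SatisfiesBoundary (p : State) (B : Set E3) (n : E3 → E3)
    (S Sg : Fin 5 → Set E3) (Γ : Data) : Prop where
  u : ∀ i, ∀ x ∈ S 0, ∀ t ≥ 0, p.u i x t = Γ.uHat i x t
  Du : ∀ i, ∀ x ∈ S 1, ∀ t ≥ 0, normalDeriv B n (p.u i) x t = Γ.dHat i x t
  θ : ∀ x ∈ S 2, ∀ t ≥ 0, p.θ x t = Γ.θHat x t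
  φ : ∀ x ∈ S 3, ∀ t ≥ 0, p.φ x t = Γ.φHat x t
  Dφ : ∀ x ∈ S 4, ∀ t ≥ 0, normalDeriv B n p.φ x t = Γ.ωHat x t
  P : ∀ i, ∀ x ∈ Sg 0, ∀ t ≥ 0, p.P B n i x t = Γ.PHat i x t
  R : ∀ i, ∀ x ∈ Sg 1, ∀ t ≥ 0, p.R n i x t = Γ.RHat i x t
  q : ∀ x ∈ Sg 2, ∀ t ≥ 0, p.heatFlux n x t = Γ.qHat x t
  Λ : ∀ x ∈ Sg 3, ∀ t ≥ 0, p.Λ B n x t = Γ.ΛHat x t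
  H : ∀ x ∈ Sg 4, ∀ t ≥ 0, p.H n x t = Γ.HHat x t

/-- `p` solves the mixed initial-boundary value problem with data `Γ`. -/
structure State.IsSolution (p : State) (B : Set E3) (n : E3 → E3) (S Sg : Fin 5 → Set E3)
    (m : Material) (Γ : Data) : Prop where
  admissible : p.IsAdmissible B
  field : p.SolvesFieldEquations B m Γ
  initial : p.SatisfiesInitial B Γ
  boundary : p.SatisfiesBoundary B n S Sg Γ

/-! ### Convolution and the functional -/

/-- `[f * g](t) = ∫₀ᵗ f(s) g(t - s) ds`. -/
def conv (f g : ℝ → ℝ) : ℝ → ℝ := fun t => ∫ s in (0 : ℝ)..t, f s * g (t - s)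

infixr:70 " ⊛ " => conv

/-- `l(t) = 1`. -/
def l : ℝ → ℝ := fun _ => 1

/-- `ξ(t) = [l * l](t) = t`. -/
def ξ : ℝ → ℝ := fun t => t

/-- `ζ(t) = β⁻¹ exp (-t/β)`. -/
def ζ (m : Material) : ℝ → ℝ := fun t => 1 / m.β * Real.exp (-t / m.β)

/-- `χ(t) = β'⁻¹ exp (-t/β')`. -/
def χ (m : Material) : ℝ → ℝ := fun t => 1 / m.β' * Real.exp (-t / m.β')

/-- `𝓕_i = ρ ξ * f_i + ρ v_i⁰ t + ρ u_i⁰`. -/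
def calF (m : Material) (Γ : Data) (i : Fin 3) : Field := fun x t =>
  m.ρ * (ξ ⊛ Γ.f i x) t + m.ρ * Γ.v₀ i x * t + m.ρ * Γ.u₀ i x

/-- `𝓗 = ρ T₀ η⁰ + l * ρ h`. -/
def calH (m : Material) (Γ : Data) : Field := fun x t =>
  m.ρ * m.T₀ * Γ.η₀ x + (l ⊛ fun s => m.ρ * Γ.h x s) t

/-- `𝓛_{ij} = a^{(14)}_{ij} θ⁰ exp (-t/β)`. -/
def calL (m : Material) (Γ : Data) (i j : Fin 3) : Field := fun x t =>
  m.a14 i j * Γ.θ₀ x * Real.exp (-t / m.β)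

/-- `𝓜_{ij} = a^{(47)}_{ij} θ⁰ exp (-t/β)`. -/
def calM (m : Material) (Γ : Data) (i j : Fin 3) : Field := fun x t =>
  m.a47 i j * Γ.θ₀ x * Real.exp (-t / m.β)

/-- `𝓡 = c θ⁰ exp (-t/β')`. -/
def calR (m : Material) (Γ : Data) : Field := fun x t =>
  m.c * Γ.θ₀ x * Real.exp (-t / m.β')

/-- The functional `𝓘_{αβ}(t)`; `Γ`, `p` are the data and the solution with index `α`, and `p'` is
the solution with index `β`. -/
def calI (B : Set E3) (n : E3 → E3) (m : Material) (Γ : Data) (p p' : State) (t : ℝ) : ℝ :=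
  (χ m ⊛ ζ m ⊛ fun s => ∫ x in B,
      (∑ i, (calF m Γ i x ⊛ p'.u i x) s - (ξ ⊛ Γ.g x ⊛ p'.φ x) s)) t
  + (χ m ⊛ ξ ⊛ fun s => ∫ x,
      ((ζ m ⊛ fun r =>
          ∑ i, ((p.P B n i x ⊛ p'.u i x) r + (p.R n i x ⊛ normalDeriv B n (p'.u i) x) r)
          + (p.Λ B n x ⊛ p'.φ x) r + (p.H n x ⊛ normalDeriv B n p'.φ x) r) s
        + 1 / m.T₀ * (l ⊛ p.heatFlux n x ⊛ p'.θ x) s) ∂(area B)) t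
  + (ξ ⊛ fun s => ∫ x in B,
      ((χ m ⊛ fun r => ∑ i, ∑ j,
          ((calL m Γ i j x ⊛ p'.e i j x) r + (calM m Γ i j x ⊛ p'.V i j x) r)) s
        + (calR m Γ x ⊛ p'.θ x) s
        - (χ m ⊛ (fun r => 1 / m.T₀ * calH m Γ x r) ⊛ p'.θ x) s)) t

end Thermopiezo

end

/-! In time, every equation of the problem is linear with constant coefficients, so convolution with
a suitable kernel makes it algebraic and absorbs the initial data. Convolving ü with ξ and η̇ with l
returns u and η up to initial terms. The kernels ζ and χ invert 1 + β d/dt and 1 + β' d/dt: ζ * (θ +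
βθ̇) = θ - θ⁰ e^{-t/β}, and likewise for χ and β' (`toR_relaxation`). The continuous functions on
[0, ∞) form a commutative ring under convolution; with a unit adjoined it is `ConvRing`, and at each
point of B a solution satisfies a system of linear relations over that ring (`abstract_solves`).

In space, P, R, Λ, H are exactly the boundary quantities for which the second-gradient Green
identity holds. The boundary integral of P * u' + R * 𝒟u' + Λ * φ' + H * 𝒟φ' becomes a volume
integral of stress against strain, double stress against κ', divergences against u' and φ', and the
corresponding electric terms (`IsBody.integral_green`, `IsBody.integral_conv_green`). The heat flux
is treated by the ordinary divergence theorem. Hence the functional is the volume integral of a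
density (`calI_eq_integral`), and the image of that density in `ConvRing` is `AbstractState.form`
(`toR_functionalDensity`).

The rest is algebra. The balance equations and the convolved constitutive equations eliminate all
loads, fluxes and initial terms from the form. What remains is a bilinear expression in u, e, V, κ,
E, θ and the temperature gradient (`AbstractState.form_eq`). It is symmetric because convolution
commutes, the diagonal tensors are symmetric, and the coupling tensors a17 and a23 occur together
with their transposes (`AbstractState.form_symm`). So the densities for (α, β) and (β, α) agree
pointwise in B.

The analytic foundation is the divergence theorem on a bounded smooth domain with Hausdorff area on
the boundary (`integral_fderivWithin_eq_integral_area`). Near a boundary point it is first proved up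
to an error ε ∫ |g|, which avoids an exact area formula for graphs. The errors add up through a
partition of unity to ε ∫ |g| again, whatever the number of patches, and ε tends to 0. Applied to an
antisymmetric field, the theorem yields the surface divergence theorem on ∂B that the Green identity
needs. -/

noncomputable section

namespace Thermopiezo

/-! ### Divergence theorem below the graph of a function. -/

section Subgraph

set_option linter.unusedSectionVars false

variable {E : Type*} [NormedAddCommGroup E] [NormedSpace ℝ E] [FiniteDimensional ℝ E]
  [MeasureSpace E] [BorelSpace E] [(volume : Measure E).IsAddHaarMeasure]

lemma isOpen_halfSpace {E : Type*} [TopologicalSpace E] : IsOpen {p : E × ℝ | p.2 < 0} := isOpen_lt continuous_snd continuous_const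

lemma integrableOn_halfSpace_of_bounded {K : E × ℝ → ℝ} (hK : HasCompactSupport K)
    {f : E × ℝ → ℝ} {C : ℝ} (hfc : ContinuousOn f {p | p.2 < 0}) (hfb : ∀ p, p.2 < 0 → ‖f p‖ ≤ C)
    (hf0 : ∀ p, p ∉ tsupport K → f p = 0) :
    IntegrableOn f {p : E × ℝ | p.2 < 0} := by
  have hm : MeasurableSet {p : E × ℝ | p.2 < 0} := isOpen_halfSpace.measurableSet
  have h1 : IntegrableOn f (tsupport K ∩ {p : E × ℝ | p.2 < 0}) := by
    have : IsFiniteMeasure ((volume : Measure (E × ℝ)).restrict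
        (tsupport K ∩ {p : E × ℝ | p.2 < 0})) := isFiniteMeasure_restrict.2
      ((measure_mono inter_subset_left).trans_lt hK.isCompact.measure_lt_top).ne
    refine Integrable.of_bound ?_ C ?_
    · exact (hfc.mono inter_subset_right).aestronglyMeasurable
        ((isClosed_tsupport K).measurableSet.inter hm)
    · exact (ae_restrict_iff' ((isClosed_tsupport K).measurableSet.inter hm)).2
        (Filter.Eventually.of_forall fun p hp => hfb p hp.2)
  refine h1.of_forall_sdiff_eq_zero hm fun p hp => hf0 p fun h => hp.2 ⟨h, hp.1⟩

lemma setIntegral_halfSpace_eq (f : E × ℝ → ℝ) (hf : IntegrableOn f {p : E × ℝ | p.2 < 0}) :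
    ∫ p in {p : E × ℝ | p.2 < 0}, f p = ∫ y, ∫ s in Iio (0 : ℝ), f (y, s) := by
  have h : {p : E × ℝ | p.2 < 0} = univ ×ˢ Iio 0 := by ext p; simp
  rw [h] at hf ⊢
  rw [Measure.volume_eq_prod, setIntegral_prod _ hf, Measure.restrict_univ]

lemma setIntegral_halfSpace_eq_swap (f : E × ℝ → ℝ) (hf : IntegrableOn f {p : E × ℝ | p.2 < 0}) :
    ∫ p in {p : E × ℝ | p.2 < 0}, f p = ∫ s in Iio (0 : ℝ), ∫ y, f (y, s) := by
  have h : {p : E × ℝ | p.2 < 0} = univ ×ˢ Iio 0 := by ext p; simp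
  rw [setIntegral_halfSpace_eq f hf]
  rw [h, IntegrableOn, Measure.volume_eq_prod, ← Measure.prod_restrict, Measure.restrict_univ] at hf
  exact integral_integral_swap hf

/-- The weight depends on the horizontal variable only, so on each vertical half-line it is a
constant and the fundamental theorem of calculus applies; compact support removes the end at -∞. -/
lemma integral_halfSpace_fderiv_vertical {K : E × ℝ → ℝ} (hK : HasCompactSupport K)
    (hc : ContinuousOn K {p | p.2 ≤ 0}) (hd : ∀ p, p.2 < 0 → DifferentiableAt ℝ K p)
    (hcd : ContinuousOn (fderiv ℝ K) {p | p.2 < 0}) {C : ℝ}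
    (hb : ∀ p, p.2 < 0 → ‖fderiv ℝ K p‖ ≤ C) {a : E → ℝ} (ha : Continuous a) {A : ℝ}
    (hA : ∀ y, |a y| ≤ A) :
    IntegrableOn (fun p : E × ℝ => a p.1 * fderiv ℝ K p (0, 1)) {p | p.2 < 0} ∧
    ∫ p in {p : E × ℝ | p.2 < 0}, a p.1 * fderiv ℝ K p (0, 1) = ∫ y, a y * K (y, 0) := by
  have hint : IntegrableOn (fun p : E × ℝ => a p.1 * fderiv ℝ K p (0, 1)) {p | p.2 < 0} := by
    refine integrableOn_halfSpace_of_bounded (C := A * (C * ‖((0 : E), (1 : ℝ))‖)) hK ?_ ?_ ?_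
    · exact (ha.comp continuous_fst).continuousOn.mul (hcd.clm_apply continuousOn_const)
    · intro p hp
      rw [norm_mul]
      have := hA p.1
      exact mul_le_mul this (((fderiv ℝ K p).le_opNorm _).trans
        (mul_le_mul_of_nonneg_right (hb p hp) (norm_nonneg _))) (norm_nonneg _)
        ((abs_nonneg _).trans this)
    · intro p hp
      have := fderiv_of_notMem_tsupport (𝕜 := ℝ) hp
      simp [this]
  refine ⟨hint, ?_⟩
  rw [setIntegral_halfSpace_eq _ hint]
  have h : {p : E × ℝ | p.2 < 0} = univ ×ˢ Iio 0 := by ext p; simp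
  have hi2 := hint
  rw [h, IntegrableOn, Measure.volume_eq_prod, ← Measure.prod_restrict, Measure.restrict_univ] at hi2
  refine integral_congr_ae ?_
  filter_upwards [hi2.prod_right_ae] with y hy
  rw [← integral_Iic_eq_integral_Iio]
  have := integral_Iic_of_hasDerivAt_of_tendsto (f := fun s => a y * K (y, s))
    (f' := fun s => a y * fderiv ℝ K (y, s) (0, 1)) (a := 0) (m := 0) ?_ ?_ ?_ ?_
  · simpa using this
  · refine continuousWithinAt_const.mul ?_
    refine (hc (y, 0) (by simp)).comp (f := fun s : ℝ => (y, s)) (by fun_prop) ?_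
    intro s hs; simpa using hs
  · intro s hs
    refine HasDerivAt.const_mul _ ?_
    have h1 : HasDerivAt (fun s : ℝ => (y, s)) ((0 : E), (1 : ℝ)) s :=
      (hasDerivAt_const s y).prodMk (hasDerivAt_id s)
    exact (hd (y, s) hs).hasFDerivAt.comp_hasDerivAt s h1
  · rw [integrableOn_Iic_iff_integrableOn_Iio]; exact hy
  · obtain ⟨R, hR⟩ := hK.isCompact.isBounded.subset_closedBall 0
    refine tendsto_const_nhds.congr' ?_
    filter_upwards [Filter.eventually_lt_atBot (-R)] with s hs
    have : (y, s) ∉ tsupport K := fun hm => by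
      have := hR hm
      simp only [Metric.mem_closedBall, dist_zero_right, Prod.norm_def, sup_le_iff,
        Real.norm_eq_abs, abs_le] at this
      linarith [this.2.1]
    simp [image_eq_zero_of_notMem_tsupport this]

/-- Each slice strictly below the boundary is a compactly supported C¹ function on E, and
integration by parts against the constant 1 kills its directional derivative. -/
lemma integral_halfSpace_fderiv_horizontal {K : E × ℝ → ℝ} (hK : HasCompactSupport K)
    (hd : ∀ p, p.2 < 0 → DifferentiableAt ℝ K p)
    (hcd : ContinuousOn (fderiv ℝ K) {p | p.2 < 0}) {C : ℝ}
    (hb : ∀ p, p.2 < 0 → ‖fderiv ℝ K p‖ ≤ C) (u : E) :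
    IntegrableOn (fun p : E × ℝ => fderiv ℝ K p (u, 0)) {p | p.2 < 0} ∧
    ∫ p in {p : E × ℝ | p.2 < 0}, fderiv ℝ K p (u, 0) = 0 := by
  have hint : IntegrableOn (fun p : E × ℝ => fderiv ℝ K p (u, 0)) {p | p.2 < 0} := by
    refine integrableOn_halfSpace_of_bounded (C := (C * ‖(u, (0 : ℝ))‖)) hK ?_ ?_ ?_
    · exact (hcd.clm_apply continuousOn_const)
    · intro p hp
      exact (((fderiv ℝ K p).le_opNorm _).trans
        (mul_le_mul_of_nonneg_right (hb p hp) (norm_nonneg _)))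
    · intro p hp
      have := fderiv_of_notMem_tsupport (𝕜 := ℝ) hp
      simp [this]
  refine ⟨hint, ?_⟩
  rw [setIntegral_halfSpace_eq_swap _ hint]
  refine setIntegral_eq_zero_of_forall_eq_zero fun s hs => ?_
  have hs : s < 0 := hs
  have hcs : HasCompactSupport fun y => K (y, s) := by
    refine HasCompactSupport.intro (hK.isCompact.image continuous_fst) fun y hy => ?_
    exact image_eq_zero_of_notMem_tsupport fun h => hy ⟨_, h, rfl⟩
  have hder : ∀ y, HasFDerivAt (fun y => K (y, s))
      ((fderiv ℝ K (y, s)).comp (ContinuousLinearMap.inl ℝ E ℝ)) y := fun y =>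
    (hd (y, s) hs).hasFDerivAt.comp y (hasFDerivAt_prodMk_left y s)
  have hcont : Continuous fun y => K (y, s) :=
    continuous_iff_continuousAt.2 fun y => (hder y).continuousAt
  have hcont' : Continuous fun y => fderiv ℝ K (y, s) (u, 0) := by
    rw [continuous_iff_continuousAt]
    intro y
    have h1 : ContinuousAt (fderiv ℝ K) (y, s) := hcd.continuousAt (isOpen_halfSpace.mem_nhds hs)
    exact (h1.comp (f := fun y => (y, s)) (by fun_prop)).clm_apply continuousAt_const
  have hcs' : HasCompactSupport fun y => fderiv ℝ K (y, s) (u, 0) := by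
    refine HasCompactSupport.intro (hK.isCompact.image continuous_fst) fun y hy => ?_
    have : (y, s) ∉ tsupport K := fun h => hy ⟨_, h, rfl⟩
    simp [fderiv_of_notMem_tsupport (𝕜 := ℝ) this]
  have := integral_bilinear_hasLineDerivAt_right_eq_neg_left_of_integrable (μ := (volume : Measure E))
    (f := fun _ : E => (1 : ℝ)) (f' := fun _ => (0 : ℝ)) (g := fun y => K (y, s))
    (g' := fun y => fderiv ℝ K (y, s) (u, 0)) (v := u) (B := ContinuousLinearMap.mul ℝ ℝ)
    (by simp) (by simpa using hcont'.integrable_of_hasCompactSupport hcs')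
    (by simpa using hcont.integrable_of_hasCompactSupport hcs)
    (fun x _ => (hasFDerivAt_const (1 : ℝ) x).hasLineDerivAt u)
    (fun x _ => by simpa using (hder x).hasLineDerivAt u)
  simpa using this

/-- The divergence theorem in the region below a graph, for a constant direction `w`. -/
theorem integral_subgraph_fderiv {ψ : E → ℝ} (hψ : ContDiff ℝ 1 ψ) {M : ℝ}
    (hM : ∀ y, ‖fderiv ℝ ψ y‖ ≤ M) {k : E × ℝ → ℝ} (hk : HasCompactSupport k)
    (hc : ContinuousOn k {p | p.2 ≤ ψ p.1}) (hd : ∀ p, p.2 < ψ p.1 → DifferentiableAt ℝ k p)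
    (hcd : ContinuousOn (fderiv ℝ k) {p | p.2 < ψ p.1}) {C : ℝ}
    (hb : ∀ p, p.2 < ψ p.1 → ‖fderiv ℝ k p‖ ≤ C) (w : E × ℝ) :
    ∫ p in {p : E × ℝ | p.2 < ψ p.1}, fderiv ℝ k p w
      = ∫ y, (w.2 - fderiv ℝ ψ y w.1) * k (y, ψ y) := by
  -- The shear straightens the graph. It translates every vertical line, so it preserves volume
  -- although ψ is only C¹.
  set Sh : E × ℝ ≃ₜ E × ℝ :=
    { toFun := fun p => (p.1, p.2 + ψ p.1)
      invFun := fun p => (p.1, p.2 - ψ p.1)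
      left_inv := fun p => by simp
      right_inv := fun p => by simp
      continuous_toFun := by have := hψ.continuous; fun_prop
      continuous_invFun := by have := hψ.continuous; fun_prop } with hSh
  have hSh_apply : ∀ p, Sh p = (p.1, p.2 + ψ p.1) := fun p => rfl
  have hmp : MeasurePreserving Sh := by
    have := (MeasurePreserving.id (volume : Measure E)).skew_product
      (μc := (volume : Measure ℝ)) (μd := (volume : Measure ℝ))
      (g := fun y s => s + ψ y) (by have := hψ.continuous; exact Continuous.measurable (by fun_prop))
      (Filter.Eventually.of_forall fun y => (measurePreserving_add_right volume (ψ y)).map_eq)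
    exact this
  set K : E × ℝ → ℝ := k ∘ Sh with hKdef
  have hdSh : ∀ p : E × ℝ, HasFDerivAt Sh
      ((ContinuousLinearMap.fst ℝ E ℝ).prod (ContinuousLinearMap.snd ℝ E ℝ +
        (fderiv ℝ ψ p.1).comp (ContinuousLinearMap.fst ℝ E ℝ))) p := by
    intro p
    have h1 : HasFDerivAt (fun p : E × ℝ => ψ p.1)
        ((fderiv ℝ ψ p.1).comp (ContinuousLinearMap.fst ℝ E ℝ)) p :=
      ((hψ.differentiable one_ne_zero p.1).hasFDerivAt).comp p hasFDerivAt_fst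
    exact hasFDerivAt_fst.prodMk (hasFDerivAt_snd.add h1)
  have hmem : ∀ p : E × ℝ, p.2 < 0 → (Sh p).2 < ψ (Sh p).1 := fun p hp => by
    simp [hSh_apply, hp]
  have hdK : ∀ p : E × ℝ, p.2 < 0 → HasFDerivAt K ((fderiv ℝ k (Sh p)).comp
      ((ContinuousLinearMap.fst ℝ E ℝ).prod (ContinuousLinearMap.snd ℝ E ℝ +
        (fderiv ℝ ψ p.1).comp (ContinuousLinearMap.fst ℝ E ℝ)))) p := fun p hp =>
    (hd _ (hmem p hp)).hasFDerivAt.comp p (hdSh p)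
  have hKs : HasCompactSupport K := hk.comp_homeomorph Sh
  have hψ' : Continuous (fderiv ℝ ψ) := hψ.continuous_fderiv one_ne_zero
  have hKc : ContinuousOn K {p | p.2 ≤ 0} := by
    refine hc.comp Sh.continuous.continuousOn fun p hp => ?_
    have hp : p.2 ≤ 0 := hp
    simp [hSh_apply, hp]
  have hKd : ∀ p : E × ℝ, p.2 < 0 → DifferentiableAt ℝ K p := fun p hp =>
    (hdK p hp).differentiableAt
  have hKcd : ContinuousOn (fderiv ℝ K) {p | p.2 < 0} := by
    have h1 : ContinuousOn (fun p : E × ℝ => (fderiv ℝ k (Sh p)).comp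
      ((ContinuousLinearMap.fst ℝ E ℝ).prod (ContinuousLinearMap.snd ℝ E ℝ +
        (fderiv ℝ ψ p.1).comp (ContinuousLinearMap.fst ℝ E ℝ)))) {p | p.2 < 0} := by
      refine (hcd.comp Sh.continuous.continuousOn hmem).clm_comp ?_
      refine Continuous.continuousOn ?_
      have h2 : Continuous fun p : E × ℝ => ContinuousLinearMap.snd ℝ E ℝ +
        (fderiv ℝ ψ p.1).comp (ContinuousLinearMap.fst ℝ E ℝ) := by fun_prop
      exact (ContinuousLinearMap.prodₗᵢ ℝ : ((E × ℝ →L[ℝ] E) × (E × ℝ →L[ℝ] ℝ)) ≃ₗᵢ[ℝ] _).continuous.comp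
        ((continuous_const (y := ContinuousLinearMap.fst ℝ E ℝ)).prodMk h2)
    exact h1.congr fun p hp => (hdK p hp).fderiv
  have hM0 : 0 ≤ M := (norm_nonneg _).trans (hM 0)
  have hKb : ∀ p : E × ℝ, p.2 < 0 → ‖fderiv ℝ K p‖ ≤ C * (1 + M) := by
    intro p hp
    have hC := hb _ (hmem p hp)
    have hC0 := (norm_nonneg _).trans hC
    rw [(hdK p hp).fderiv]
    refine (ContinuousLinearMap.opNorm_comp_le _ _).trans ?_
    refine mul_le_mul hC ?_ (norm_nonneg _) hC0
    refine ContinuousLinearMap.opNorm_le_bound _ (by linarith) fun q => ?_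
    have h3 : ‖q.1‖ ≤ ‖q‖ := norm_fst_le q
    have h4 : ‖q.2‖ ≤ ‖q‖ := norm_snd_le q
    have h5 := (fderiv ℝ ψ p.1).le_opNorm q.1
    have h6 : ‖fderiv ℝ ψ p.1‖ * ‖q.1‖ ≤ M * ‖q‖ := mul_le_mul (hM _) h3 (norm_nonneg _) hM0
    refine max_le (α := ℝ) ?_ ?_
    · change ‖q.1‖ ≤ _
      nlinarith [norm_nonneg q]
    · change ‖q.2 + fderiv ℝ ψ p.1 q.1‖ ≤ _
      exact (norm_add_le _ _).trans (by linarith)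
  have hpre : Sh ⁻¹' {p : E × ℝ | p.2 < ψ p.1} = {p : E × ℝ | p.2 < 0} := by
    ext p; simp [hSh_apply]
  rw [← hmp.setIntegral_preimage_emb Sh.measurableEmbedding, hpre]
  have hv := integral_halfSpace_fderiv_vertical hKs hKc hKd hKcd hKb
    (a := fun y => w.2 - fderiv ℝ ψ y w.1) (by fun_prop) (A := |w.2| + M * ‖w.1‖) (by
      intro y
      have h5 := ((fderiv ℝ ψ y).le_opNorm w.1).trans
        (mul_le_mul_of_nonneg_right (hM y) (norm_nonneg _))
      exact (abs_sub _ _).trans (by simpa using h5))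
  have hh := integral_halfSpace_fderiv_horizontal hKs hKd hKcd hKb w.1
  -- In sheared coordinates the direction w becomes (w.1, w.2 - ψ'(y) w.1). Its horizontal part is
  -- constant and its vertical part depends on y alone, which is what the two half-space lemmas
  -- require.
  calc ∫ p in {p : E × ℝ | p.2 < 0}, fderiv ℝ k (Sh p) w
      = ∫ p in {p : E × ℝ | p.2 < 0}, (fderiv ℝ K p (w.1, 0)
          + (w.2 - fderiv ℝ ψ p.1 w.1) * fderiv ℝ K p (0, 1)) := by
        refine setIntegral_congr_fun isOpen_halfSpace.measurableSet fun p hp => ?_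
        have e : (w.2 - fderiv ℝ ψ p.1 w.1) * fderiv ℝ K p (0, 1)
            = fderiv ℝ K p (0, w.2 - fderiv ℝ ψ p.1 w.1) := by
          rw [← smul_eq_mul, ← map_smul]; simp
        rw [e, ← map_add, (hdK p hp).fderiv]
        simp
    _ = _ := by
        rw [integral_add hh.1 hv.1, hh.2, hv.2, zero_add]
        simp [hKdef, hSh_apply]

end Subgraph

/-! ### Local description of the boundary as a graph, and its area. -/

/-- The Euclidean plane, which parametrizes the boundary locally. -/
abbrev E2 : Type := EuclideanSpace ℝ (Fin 2)

/-- Orthonormal coordinates in which a given unit vector is vertical. -/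
lemma exists_frame (ν : E3) (hν : ‖ν‖ = 1) :
    ∃ T : (E2 × ℝ) ≃L[ℝ] E3, T (0, 1) = ν ∧ (∀ p, ‖T p‖ ^ 2 = ‖p.1‖ ^ 2 + p.2 ^ 2) ∧
      (∀ p, inner ℝ (T p) ν = p.2) ∧ MeasurePreserving T := by
  have hν0 : ν ≠ 0 := fun h => by simp [h] at hν
  have : Fact (Module.finrank ℝ E3 = 2 + 1) := ⟨by simp⟩
  set e : E2 ≃ₗᵢ[ℝ] (ℝ ∙ ν)ᗮ := (OrthonormalBasis.fromOrthogonalSpanSingleton 2 hν0).repr.symm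
  have he : ∀ y, inner ℝ (e y : E3) ν = 0 := fun y =>
    Submodule.mem_orthogonal_singleton_iff_inner_left.1 (e y).2
  have hνν : inner ℝ ν ν = (1 : ℝ) := by rw [real_inner_self_eq_norm_sq, hν, one_pow]
  let f : (E2 × ℝ) →ₗ[ℝ] E3 :=
    ((Submodule.subtype _ ∘ₗ e.toLinearEquiv.toLinearMap) ∘ₗ LinearMap.fst ℝ E2 ℝ) +
      (LinearMap.toSpanSingleton ℝ E3 ν) ∘ₗ LinearMap.snd ℝ E2 ℝ
  have hf : ∀ p, f p = (e p.1 : E3) + p.2 • ν := fun p => rfl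
  have hfn : ∀ p, ‖f p‖ ^ 2 = ‖p.1‖ ^ 2 + p.2 ^ 2 := by
    intro p
    rw [hf, norm_add_sq_real, inner_smul_right, he, norm_smul, hν,
      show ‖(e p.1 : E3)‖ = ‖p.1‖ from e.norm_map p.1]
    simp
  -- The norm of `E2 × ℝ` is the maximum norm, so the frame is an isometry only from the L² product;
  -- passing between the two products preserves volume.
  let g : WithLp 2 (E2 × ℝ) →ₗᵢ[ℝ] E3 :=
    { toLinearMap := f ∘ₗ (WithLp.linearEquiv 2 ℝ (E2 × ℝ)).toLinearMap
      norm_map' := fun p => by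
        rw [← sq_eq_sq₀ (norm_nonneg _) (norm_nonneg _), WithLp.prod_norm_sq_eq_of_L2]
        refine (hfn _).trans ?_
        simp }
  have hg : Module.finrank ℝ (WithLp 2 (E2 × ℝ)) = Module.finrank ℝ E3 := by
    rw [(WithLp.linearEquiv 2 ℝ (E2 × ℝ)).finrank_eq]; simp
  let g' := g.toLinearIsometryEquiv hg
  let T : (E2 × ℝ) ≃L[ℝ] E3 := (WithLp.prodContinuousLinearEquiv 2 ℝ E2 ℝ).symm.trans
    g'.toContinuousLinearEquiv
  have hT : ∀ p, T p = f p := fun p => rfl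
  refine ⟨T, by simp [hT, hf], fun p => by rw [hT, hfn], fun p => ?_, ?_⟩
  · rw [hT, hf, inner_add_left, he, inner_smul_left, hνν]; simp
  · exact g'.measurePreserving.comp (WithLp.volume_preserving_toLp E2 ℝ)

/-- The error is an integral against μ - ν, and μ ≤ c ν bounds the integral of |h| against μ - ν by
(c - 1) ∫ |h| dν. It is used with c close to 1, for the area of a nearly flat graph and of its
projection. -/
lemma integral_sub_le_of_measure_le {α : Type*} [MeasurableSpace α] {μ ν : Measure α}
    [IsFiniteMeasure μ] {c : ℝ} (hc : 1 ≤ c) (h1 : ν ≤ μ) (h2 : μ ≤ ENNReal.ofReal c • ν)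
    {h : α → ℝ} (hh : Integrable h μ) :
    |∫ x, h x ∂μ - ∫ x, h x ∂ν| ≤ (c - 1) * ∫ x, |h x| ∂μ := by
  have : IsFiniteMeasure ν := ⟨(h1 univ).trans_lt (measure_lt_top μ univ)⟩
  have hs : μ - ν + ν = μ := Measure.sub_add_cancel_of_le h1
  have hν : Integrable h ν := hh.mono_measure h1
  have hsub : Integrable h (μ - ν) := hh.mono_measure Measure.sub_le
  have e1 : ∫ x, h x ∂μ = ∫ x, h x ∂(μ - ν) + ∫ x, h x ∂ν := by
    rw [← integral_add_measure hsub hν, hs]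
  have e2 : ∫ x, |h x| ∂μ = ∫ x, |h x| ∂(μ - ν) + ∫ x, |h x| ∂ν := by
    rw [← integral_add_measure hsub.abs hν.abs, hs]
  have e3 : ∫ x, |h x| ∂μ ≤ c * ∫ x, |h x| ∂ν := by
    have hi : Integrable (fun x => |h x|) (ENNReal.ofReal c • ν) :=
      hν.abs.smul_measure ENNReal.ofReal_ne_top
    have := integral_mono_measure h2 (Filter.Eventually.of_forall fun x => abs_nonneg (h x)) hi
    rwa [integral_smul_measure, ENNReal.toReal_ofReal (by linarith), smul_eq_mul] at this
  have e4 : |∫ x, h x ∂(μ - ν)| ≤ ∫ x, |h x| ∂(μ - ν) := abs_integral_le_integral_abs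
  have e5 : ∫ x, |h x| ∂ν ≤ ∫ x, |h x| ∂μ :=
    integral_mono_measure h1 (Filter.Eventually.of_forall fun x => abs_nonneg (h x)) hh.abs
  have e6 : 0 ≤ ∫ x, |h x| ∂ν := integral_nonneg fun x => abs_nonneg _
  rw [e1, add_sub_cancel_right]
  nlinarith

/-- The area of a graph compared with the area of its projection. -/
lemma hausdorff_graph_le {G : E2 → E3} (hG : AntilipschitzWith 1 G) {D : Set E2}
    {K : NNReal} (hK : LipschitzOnWith K G D) (hGc : Continuous G) :
    (volume.restrict D).map G ≤ (μHE[2] : Measure E3).restrict (G '' D) ∧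
    (μHE[2] : Measure E3).restrict (G '' D) ≤
      ENNReal.ofReal ((K : ℝ) ^ 2) • (volume.restrict D).map G := by
  have hset : ∀ s : Set E3, s ∩ G '' D = G '' (G ⁻¹' s ∩ D) := fun s =>
    (image_preimage_inter G D s).symm
  rw [← EuclideanSpace.euclideanHausdorffMeasure_eq_volume]
  -- Since G is antilipschitz with constant 1, it cannot decrease two-dimensional area; being
  -- K-Lipschitz on D, it increases it by a factor of at most K².
  constructor
  · refine Measure.le_iff.2 fun s hs => ?_
    rw [Measure.map_apply hGc.measurable hs, Measure.restrict_apply hs,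
      Measure.restrict_apply (hGc.measurable hs), hset]
    have := hG.le_hausdorffMeasure_image (d := 2) (by norm_num) (G ⁻¹' s ∩ D)
    simp only [ENNReal.coe_one, ENNReal.one_rpow, one_mul] at this
    rw [Measure.euclideanHausdorffMeasure_def, Measure.euclideanHausdorffMeasure_def]
    simp only [Measure.smul_apply]
    gcongr
    exact_mod_cast this
  · refine Measure.le_iff.2 fun s hs => ?_
    rw [Measure.smul_apply, Measure.map_apply hGc.measurable hs, Measure.restrict_apply hs,
      Measure.restrict_apply (hGc.measurable hs), hset]
    have := (hK.mono (inter_subset_right : G ⁻¹' s ∩ D ⊆ D)).hausdorffMeasure_image_le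
      (d := 2) (by norm_num)
    rw [Measure.euclideanHausdorffMeasure_def, Measure.euclideanHausdorffMeasure_def]
    simp only [Measure.smul_apply, smul_eq_mul]
    rw [mul_smul_comm]
    gcongr
    have e : ENNReal.ofReal ((K : ℝ) ^ 2) = (K : ENNReal) ^ (2 : ℝ) := by
      rw [ENNReal.ofReal_pow K.coe_nonneg, ENNReal.ofReal_coe_nnreal]; norm_cast
    rw [e]
    exact_mod_cast this

/-- A positive value would persist nearby and keep B away from x₀; a negative value would put x₀
into the open set B. -/
lemma IsLocalDefiningFunction.eq_zero {B : Set E3} (hB : IsOpen B) {x₀ : E3} (hx : x₀ ∈ frontier B)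
    {φ : E3 → ℝ} (hφ : IsLocalDefiningFunction B x₀ φ) : φ x₀ = 0 := by
  have h1 := hφ.2.2
  rw [hB.frontier_eq] at hx
  refine le_antisymm ?_ ?_
  · by_contra! h
    have h2 : ∀ᶠ y in 𝓝 x₀, 0 < φ y := hφ.1.continuous.continuousAt.eventually (lt_mem_nhds h)
    have h3 : ∃ᶠ y in 𝓝 x₀, y ∈ B := mem_closure_iff_frequently.1 hx.1
    obtain ⟨y, hy3, hy1, hy2⟩ := (h3.and_eventually (h1.and h2)).exists
    exact absurd (hy1.1 hy3) hy2.not_gt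
  · by_contra! h
    exact hx.2 (h1.self_of_nhds.2 h)

/-- Extension of a germ of a `C¹` function. -/
lemma exists_contDiff_extension {ψ : E2 → ℝ} (hψ : ContDiffAt ℝ 1 ψ 0) :
    ∃ ψ' : E2 → ℝ, ContDiff ℝ 1 ψ' ∧ (∃ M, ∀ y, ‖fderiv ℝ ψ' y‖ ≤ M) ∧ ψ' =ᶠ[𝓝 0] ψ := by
  obtain ⟨r, hr, hball⟩ := Metric.eventually_nhds_iff_ball.1 (hψ.eventually (by simp))
  let b : ContDiffBump (0 : E2) := ⟨r / 4, r / 2, by linarith, by linarith⟩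
  have hcs : HasCompactSupport fun y => b y * ψ y := b.hasCompactSupport.mul_right
  have hcd : ContDiff ℝ 1 fun y => b y * ψ y := by
    rw [contDiff_iff_contDiffAt]
    intro y
    by_cases hy : y ∈ Metric.ball (0 : E2) r
    · exact b.contDiffAt.mul (hball y hy)
    · have : y ∉ tsupport b := by
        rw [b.tsupport_eq]
        intro h
        refine hy (Metric.closedBall_subset_ball ?_ h)
        change r / 2 < r
        linarith
      refine (contDiffAt_const (c := (0 : ℝ))).congr_of_eventuallyEq ?_
      filter_upwards [(isClosed_tsupport b).isOpen_compl.mem_nhds this] with z hz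
      simp [image_eq_zero_of_notMem_tsupport hz]
  refine ⟨_, hcd, ?_, ?_⟩
  · obtain ⟨M, hM⟩ := (hcs.fderiv (𝕜 := ℝ)).exists_bound_of_continuous
      (hcd.continuous_fderiv one_ne_zero)
    exact ⟨M, hM⟩
  · filter_upwards [b.eventuallyEq_one] with y hy
    simp [hy]

/-- Near a boundary point the body is the region below a graph over its tangent plane. -/
lemma exists_graph {B : Set E3} (hB : IsOpen B) {x₀ : E3} (hx : x₀ ∈ frontier B)
    {φ : E3 → ℝ} (hφ : IsLocalDefiningFunction B x₀ φ) {T : (E2 × ℝ) ≃L[ℝ] E3}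
    (hT : ∀ p, inner ℝ (T p) (‖gradient φ x₀‖⁻¹ • gradient φ x₀) = p.2) :
    ∃ ψ : E2 → ℝ, ContDiff ℝ 1 ψ ∧ (∃ M, ∀ y, ‖fderiv ℝ ψ y‖ ≤ M) ∧ ψ 0 = 0 ∧ fderiv ℝ ψ 0 = 0 ∧
      ∀ᶠ p : E2 × ℝ in 𝓝 0, (x₀ + T p ∈ B ↔ p.2 < ψ p.1) := by
  have hg0 : 0 < ‖gradient φ x₀‖ := norm_pos_iff.2 hφ.2.1
  set f : E2 × ℝ → ℝ := fun p => φ (x₀ + T p) with hf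
  have hfc : ContDiff ℝ 1 f := (hφ.1.of_le (by simp)).comp (contDiff_const.add T.contDiff)
  have hf0 : f 0 = 0 := by simp [hf, hφ.eq_zero hB hx]
  -- In the adapted frame the differential is |∇φ| dz. Its vertical part is invertible, as the
  -- implicit function theorem requires, and its horizontal part vanishes, so the graph has zero
  -- slope at the origin.
  have hfd : ∀ p, fderiv ℝ f 0 p = ‖gradient φ x₀‖ * p.2 := by
    intro p
    have h1 : HasFDerivAt φ (fderiv ℝ φ (x₀ + T 0)) (x₀ + T 0) :=
      (hφ.1.differentiable (by simp) _).hasFDerivAt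
    have h2 := h1.comp (0 : E2 × ℝ) (T.hasFDerivAt.const_add x₀)
    have h3 := h2.fderiv
    change fderiv ℝ f 0 = _ at h3
    rw [h3]
    have h4 : fderiv ℝ φ x₀ (T p) = inner ℝ (gradient φ x₀) (T p) := by
      simp [gradient, InnerProductSpace.toDual_symm_apply]
    have h5 := hT p
    rw [inner_smul_right, real_inner_comm] at h5
    simp only [map_zero, add_zero, ContinuousLinearMap.comp_apply,
      ContinuousLinearEquiv.coe_coe, h4]
    rw [← h5]
    field_simp
  have hinv : (fderiv ℝ f 0 ∘L .inr ℝ E2 ℝ).IsInvertible := by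
    refine ⟨ContinuousLinearEquiv.unitsEquivAut ℝ (Units.mk0 _ hg0.ne'), ?_⟩
    ext
    simp [hfd]
  have hfc0 : ContDiffAt ℝ 1 f 0 := hfc.contDiffAt
  set ψ₀ := hfc0.implicitFunction one_ne_zero hinv with hψ₀
  have hψc : ContDiffAt ℝ 1 ψ₀ 0 := hfc0.contDiffAt_implicitFunction one_ne_zero hinv
  have hψ0 : ψ₀ 0 = 0 := hfc0.implicitFunction_apply_self one_ne_zero hinv
  have hψf : ∀ᶠ y in 𝓝 (0 : E2), f (y, ψ₀ y) = 0 := by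
    have := hfc0.eventually_apply_implicitFunction one_ne_zero hinv
    rwa [hf0] at this
  have hψd : HasFDerivAt ψ₀ (0 : E2 →L[ℝ] ℝ) 0 := by
    have := (hfc0.hasStrictFDerivAt_implicitFunction one_ne_zero hinv).hasFDerivAt
    convert! this using 1
    ext y
    simp [hfd]
  obtain ⟨ψ, hψ1, hψ2, hψ3⟩ := exists_contDiff_extension hψc
  refine ⟨ψ, hψ1, hψ2, hψ3.self_of_nhds.trans hψ0, hψ3.fderiv_eq.trans hψd.fderiv, ?_⟩
  have hdz : ∀ᶠ p : E2 × ℝ in 𝓝 0, 0 < fderiv ℝ f p (0, 1) := by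
    have : ContinuousAt (fun p => fderiv ℝ f p (0, 1)) 0 :=
      ((hfc.continuous_fderiv one_ne_zero).clm_apply continuous_const).continuousAt
    refine this.eventually (lt_mem_nhds ?_)
    simpa [hfd] using hg0
  have hB' : ∀ᶠ p : E2 × ℝ in 𝓝 0, (x₀ + T p ∈ B ↔ f p < 0) := by
    have : Filter.Tendsto (fun p : E2 × ℝ => x₀ + T p) (𝓝 0) (𝓝 x₀) := by
      have : Continuous fun p : E2 × ℝ => x₀ + T p := by fun_prop
      simpa using this.tendsto 0
    exact this.eventually hφ.2.2
  obtain ⟨δ, hδ, hball⟩ := Metric.eventually_nhds_iff_ball.1 hdz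
  have hsmall : ∀ᶠ y in 𝓝 (0 : E2), |ψ y| < δ ∧ ‖y‖ < δ := by
    have h1 : ContinuousAt (fun y => |ψ y|) 0 := hψ1.continuous.abs.continuousAt
    refine (h1.eventually (gt_mem_nhds ?_)).and
      (continuous_norm.continuousAt.eventually (gt_mem_nhds (by simpa using hδ)))
    simpa [hψ3.self_of_nhds.trans hψ0] using hδ
  have hz : ∀ᶠ z in 𝓝 (0 : ℝ), |z| < δ :=
    continuous_abs.continuousAt.eventually (gt_mem_nhds (by simpa using hδ))
  have hy := (hsmall.and (hψ3.and hψf))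
  have hyz := hy.prod_mk hz
  rw [← nhds_prod_eq] at hyz
  filter_upwards [hB', hyz] with p hp1 hp2
  obtain ⟨⟨⟨ha, hb⟩, hc, hd⟩, he⟩ := hp2
  rw [hp1]
  -- Along vertical segments in the box f increases strictly and vanishes at height ψ, so its sign
  -- tells which side of the graph a point is on.
  have hmono : StrictMonoOn (fun z => f (p.1, z)) (Ioo (-δ) δ) := by
    refine strictMonoOn_of_deriv_pos (convex_Ioo _ _) ?_ ?_
    · exact (hfc.continuous.comp (by fun_prop)).continuousOn
    · intro z hz
      rw [interior_Ioo] at hz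
      have h1 : HasDerivAt (fun z : ℝ => (p.1, z)) ((0 : E2), (1 : ℝ)) z :=
        (hasDerivAt_const z p.1).prodMk (hasDerivAt_id z)
      have h2 := (hfc.differentiable one_ne_zero (p.1, z)).hasFDerivAt.comp_hasDerivAt z h1
      have h3 : deriv (fun z => f (p.1, z)) z = _ := h2.deriv
      rw [h3]
      refine hball _ ?_
      rw [mem_ball_zero_iff, Prod.norm_def]
      exact max_lt hb (abs_lt.2 hz)
  have h0 : f (p.1, ψ p.1) = 0 := by rw [hc]; exact hd
  rw [← hmono.lt_iff_lt (abs_lt.1 he) (abs_lt.1 ha)]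
  simp only [h0]

/-- In a graph chart, the boundary is the graph. -/
lemma eventually_mem_frontier_iff {B : Set E3} {x₀ : E3} {T : (E2 × ℝ) ≃L[ℝ] E3}
    {ψ : E2 → ℝ} (hψ : Continuous ψ)
    (h : ∀ᶠ p : E2 × ℝ in 𝓝 0, (x₀ + T p ∈ B ↔ p.2 < ψ p.1)) :
    ∀ᶠ p : E2 × ℝ in 𝓝 0, (x₀ + T p ∈ frontier B ↔ p.2 = ψ p.1) := by
  let A : E2 × ℝ ≃ₜ E3 := T.toHomeomorph.trans (Homeomorph.addLeft x₀)
  have hA : ∀ p, A p = x₀ + T p := fun p => rfl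
  have hfr : ∀ p, x₀ + T p ∈ frontier B ↔ p ∈ frontier (A ⁻¹' B) := fun p => by
    rw [← A.preimage_frontier, mem_preimage, hA]
  have hΩ : frontier {p : E2 × ℝ | p.2 < ψ p.1} = {p : E2 × ℝ | p.2 = ψ p.1} := by
    have hψ' : Continuous fun p : E2 × ℝ => ψ p.1 := by fun_prop
    have ho : IsOpen {p : E2 × ℝ | p.2 < ψ p.1} := isOpen_lt continuous_snd hψ'
    rw [ho.frontier_eq]
    ext p
    constructor
    · rintro ⟨h1, h2⟩
      exact le_antisymm (closure_lt_subset_le continuous_snd hψ' h1) (not_lt.1 h2)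
    · intro hp
      have hp : p.2 = ψ p.1 := hp
      refine ⟨?_, fun h => (ne_of_lt h) hp⟩
      have hc : Continuous fun s : ℝ => (p.1, s) := by fun_prop
      have h1 : p.2 ∈ closure (Iio p.2) := by rw [closure_Iio]; simp
      have h2 := hc.continuousAt.continuousWithinAt.mem_closure h1
        (t := {p : E2 × ℝ | p.2 < ψ p.1}) (fun s hs => by
          change s < ψ p.1
          rw [← hp]; exact hs)
      exact h2
  filter_upwards [h.eventually_nhds] with p hp
  rw [hfr]
  have h3 : (A ⁻¹' B) =ᶠ[𝓝 p] {p : E2 × ℝ | p.2 < ψ p.1} := by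
    filter_upwards [hp] with q hq
    exact propext hq
  -- Membership in a frontier depends only on the germ of the set at the point.
  have h4 : p ∈ frontier (A ⁻¹' B) ↔ p ∈ frontier {p : E2 × ℝ | p.2 < ψ p.1} := by
    rw [frontier_eq_closure_inter_closure, frontier_eq_closure_inter_closure]
    simp only [mem_inter_iff, mem_closure_iff_frequently]
    have h5 : ∀ᶠ q in 𝓝 p, (q ∈ A ⁻¹' B ↔ q ∈ {p : E2 × ℝ | p.2 < ψ p.1}) := hp
    rw [Filter.frequently_congr h5]
    rw [Filter.frequently_congr (h5.mono fun q hq => not_congr hq :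
      ∀ᶠ q in 𝓝 p, (q ∈ (A ⁻¹' B)ᶜ ↔ q ∈ ({p : E2 × ℝ | p.2 < ψ p.1})ᶜ))]
  rw [h4, hΩ]
  rfl

lemma norm_normal_eq_one {B : Set E3} (hs : HasSmoothBoundary B) {n : E3 → E3}
    (hn : IsOutwardUnitNormal B n) {x : E3} (hx : x ∈ frontier B) : ‖n x‖ = 1 := by
  obtain ⟨φ, hφ⟩ := hs x hx
  rw [hn.2 x hx φ hφ, norm_smul, norm_inv, norm_norm, inv_mul_cancel₀ (norm_ne_zero_iff.2 hφ.2.1)]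

/-! ### The divergence theorem at a boundary point, up to a small error. -/

/-- `g` is continuous up to the boundary of `B` and has a bounded continuous gradient in `B`. -/
structure IsRegular (B : Set E3) (g : E3 → ℝ) : Prop where
  cont : ContinuousOn g (closure B)
  diff : ∀ x ∈ B, DifferentiableAt ℝ g x
  fderiv_cont : ContinuousOn (fderiv ℝ g) B
  fderiv_bdd : ∃ C, ∀ x ∈ B, ‖fderiv ℝ g x‖ ≤ C

/-- The divergence theorem near a boundary point, up to a small relative error. -/
lemma exists_nhds_boundary_estimate {B : Set E3} (hB : IsOpen B)
    (hs : HasSmoothBoundary B) {n : E3 → E3} (hn : IsOutwardUnitNormal B n)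
    {x₀ : E3} (hx : x₀ ∈ frontier B) (v : E3) {ε : ℝ} (hε : 0 < ε) :
    ∃ U : Set E3, IsOpen U ∧ x₀ ∈ U ∧ area B U < ⊤ ∧
      ∀ g : E3 → ℝ, IsRegular B g → HasCompactSupport g → tsupport g ⊆ U →
        |(∫ x in B, fderiv ℝ g x v) - ∫ x, g x * inner ℝ v (n x) ∂(area B)|
          ≤ ε * ∫ x, |g x| ∂(area B) := by
  obtain ⟨φ, hφ⟩ := hs x₀ hx
  have hnx := hn.2 x₀ hx φ hφ
  obtain ⟨T, hT1, hTn, hTi, hTm⟩ := exists_frame (n x₀) (norm_normal_eq_one hs hn hx)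
  obtain ⟨ψ, hψc, ⟨M, hM⟩, hψ0, hψd, hψB⟩ := exists_graph hB hx hφ (T := T) (by rw [← hnx]; exact hTi)
  have hψF := eventually_mem_frontier_iff hψc.continuous hψB
  set G : E2 → E3 := fun y => x₀ + T (y, ψ y) with hG
  have hGc : Continuous G := by have := hψc.continuous; fun_prop
  set w : E2 × ℝ := T.symm v with hw
  have hTw : T w = v := T.apply_symm_apply v
  -- The total error below is (e + e² ‖v‖) ∫ |g|, which e ≤ 1 reduces to e (1 + ‖v‖) ∫ |g|.
  obtain ⟨e, he0, he1, he⟩ : ∃ e : ℝ, 0 < e ∧ e ≤ 1 ∧ e * (1 + ‖v‖) ≤ ε := by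
    refine ⟨min 1 (ε / (1 + ‖v‖)), by positivity, min_le_left _ _, ?_⟩
    have : 0 < 1 + ‖v‖ := by positivity
    exact (mul_le_mul_of_nonneg_right (min_le_right _ _) this.le).trans_eq (by field_simp)
  -- a box in which everything is controlled
  obtain ⟨δ, hδ, hbox⟩ := Metric.eventually_nhds_iff_ball.1 (hψB.and hψF)
  -- At the origin the slope is 0 and the flux coefficient w.2 is exactly the inner product of v
  -- with the normal, so all four conditions hold nearby by continuity.
  have hsm : ∀ᶠ y in 𝓝 (0 : E2), |ψ y| < δ ∧ ‖y‖ < δ ∧ ‖fderiv ℝ ψ y‖ < e ∧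
      |(w.2 - fderiv ℝ ψ y w.1) - inner ℝ v (n (G y))| < e := by
    have hψ' := hψc.continuous_fderiv one_ne_zero
    have hn' := hn.1.continuous
    have h1 : Continuous fun y => |ψ y| := hψc.continuous.abs
    have h2 : Continuous fun y => ‖fderiv ℝ ψ y‖ := hψ'.norm
    have h3 : Continuous fun y => |(w.2 - fderiv ℝ ψ y w.1) - inner ℝ v (n (G y))| := by fun_prop
    have hv : inner ℝ v (n x₀) = w.2 := by rw [← hTw, hTi]
    have hG0 : G 0 = x₀ := by
      have : ((0 : E2), ψ 0) = 0 := by rw [hψ0]; rfl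
      simp [hG, this]
    refine (h1.continuousAt.eventually (gt_mem_nhds (by simpa [hψ0] using hδ))).and <|
      (continuous_norm.continuousAt.eventually (gt_mem_nhds (by simpa using hδ))).and <|
      (h2.continuousAt.eventually (gt_mem_nhds (by simpa [hψd] using he0))).and <|
      (h3.continuousAt.eventually (gt_mem_nhds (by simpa [hψd, hG0, hv] using he0)))
  obtain ⟨r, hr, hball⟩ := Metric.eventually_nhds_iff_ball.1 hsm
  set D : Set E2 := Metric.ball 0 r with hD
  set V : Set (E2 × ℝ) := {p | p.1 ∈ D ∧ |p.2| < δ} with hV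
  have hVo : IsOpen V := (Metric.isOpen_ball.preimage continuous_fst).inter
    (isOpen_lt (continuous_snd.abs) continuous_const)
  have hVbox : ∀ p ∈ V, p ∈ Metric.ball (0 : E2 × ℝ) δ := fun p hp => by
    rw [mem_ball_zero_iff, Prod.norm_def]
    exact max_lt (hball _ hp.1).2.1 hp.2
  let A : E2 × ℝ ≃ₜ E3 := T.toHomeomorph.trans (Homeomorph.addLeft x₀)
  have hA : ∀ p, A p = x₀ + T p := fun p => rfl
  have hAm : MeasurePreserving A := (measurePreserving_add_left volume x₀).comp hTm
  set U : Set E3 := A '' V with hU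
  have hUo : IsOpen U := A.isOpenMap V hVo
  have hx₀U : x₀ ∈ U := ⟨0, ⟨by simp [hD, hr], by simpa using hδ⟩, by simp [hA]⟩
  have hGV : ∀ y ∈ D, (y, ψ y) ∈ V := fun y hy => ⟨hy, (hball y hy).1⟩
  have hfrU : frontier B ∩ U = G '' D := by
    ext x
    constructor
    · rintro ⟨h1, p, hp, rfl⟩
      have h2 := (hbox p (hVbox p hp)).2.1 h1
      exact ⟨p.1, hp.1, by rw [hA, hG]; simp [← h2]⟩
    · rintro ⟨y, hy, rfl⟩
      exact ⟨(hbox (y, ψ y) (hVbox _ (hGV y hy))).2.2 rfl, (y, ψ y), hGV y hy, rfl⟩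
  have hGdist : ∀ y z, dist (G y) (G z) ^ 2 = dist y z ^ 2 + (ψ y - ψ z) ^ 2 := by
    intro y z
    have : G y - G z = T (y - z, ψ y - ψ z) := by
      have h : ((y - z, ψ y - ψ z) : E2 × ℝ) = (y, ψ y) - (z, ψ z) := rfl
      rw [h, map_sub]
      simp [hG]
    rw [dist_eq_norm, this, hTn, dist_eq_norm]
  have hGanti : AntilipschitzWith 1 G := AntilipschitzWith.of_le_mul_dist fun y z => by
    rw [NNReal.coe_one, one_mul, ← sq_le_sq₀ dist_nonneg dist_nonneg, hGdist]
    nlinarith [sq_nonneg (ψ y - ψ z)]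
  have hψlip : ∀ y ∈ D, ∀ z ∈ D, |ψ y - ψ z| ≤ e * dist y z := by
    intro y hy z hz
    have := (convex_ball (0 : E2) r).norm_image_sub_le_of_norm_fderiv_le (𝕜 := ℝ) (f := ψ)
      (C := e) (fun x _ => hψc.differentiable one_ne_zero x) (fun x hx => (hball x hx).2.2.1.le)
      hz hy
    rwa [← dist_eq_norm y z] at this
  -- Pythagoras with slope at most e: lengths on the graph grow by at most √(1 + e²), hence areas by
  -- at most 1 + e².
  set K : NNReal := Real.toNNReal (Real.sqrt (1 + e ^ 2)) with hKdef
  have hK0 : (K : ℝ) = Real.sqrt (1 + e ^ 2) := Real.coe_toNNReal _ (Real.sqrt_nonneg _)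
  have hK2 : (K : ℝ) ^ 2 = 1 + e ^ 2 := by rw [hK0, Real.sq_sqrt (by positivity)]
  have hGlip : LipschitzOnWith K G D := LipschitzOnWith.of_dist_le_mul fun y hy z hz => by
    rw [← sq_le_sq₀ dist_nonneg (by positivity), hGdist, mul_pow, hK2]
    have h1 := hψlip y hy z hz
    have h2 : (ψ y - ψ z) ^ 2 ≤ (e * dist y z) ^ 2 := by
      rw [← sq_abs]; gcongr
    nlinarith
  obtain ⟨hle1, hle2⟩ := hausdorff_graph_le hGanti hGlip hGc
  rw [hK2] at hle2
  set ν : Measure E3 := (volume.restrict D).map G with hν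
  set μ : Measure E3 := (μHE[2] : Measure E3).restrict (G '' D) with hμ
  have hνfin : IsFiniteMeasure ν := by
    have : IsFiniteMeasure (volume.restrict D) := isFiniteMeasure_restrict.2
      Metric.isBounded_ball.measure_lt_top.ne
    exact Measure.isFiniteMeasure_map _ _
  have hμfin : IsFiniteMeasure μ := ⟨(hle2 univ).trans_lt (by
    rw [Measure.smul_apply, smul_eq_mul]
    exact ENNReal.mul_lt_top ENNReal.ofReal_lt_top (measure_lt_top ν univ))⟩
  have hareaU : (area B).restrict U = μ := by
    rw [area, Measure.restrict_restrict hUo.measurableSet, inter_comm, hfrU]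
  refine ⟨U, hUo, hx₀U, ?_, fun g hg hgs hgU => ?_⟩
  · rw [← Measure.restrict_apply_univ, hareaU]; exact measure_lt_top μ univ
  have hg0 : ∀ x, x ∉ U → g x = 0 := fun x hx =>
    image_eq_zero_of_notMem_tsupport fun h => hx (hgU h)
  have hI1 : ∫ x, g x * inner ℝ v (n x) ∂(area B) = ∫ x, g x * inner ℝ v (n x) ∂μ := by
    rw [← hareaU, setIntegral_eq_integral_of_forall_compl_eq_zero]
    intro x hx; rw [hg0 x hx, zero_mul]
  have hI2 : ∫ x, |g x| ∂(area B) = ∫ x, |g x| ∂μ := by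
    rw [← hareaU, setIntegral_eq_integral_of_forall_compl_eq_zero]
    intro x hx; rw [hg0 x hx, abs_zero]
  -- the volume integral in the chart
  set k : E2 × ℝ → ℝ := fun p => g (A p) with hk
  have hks : HasCompactSupport k := hgs.comp_homeomorph A
  have hktU : ∀ p, p ∈ tsupport k → p ∈ V := by
    intro p hp
    have h1 : tsupport k = A ⁻¹' tsupport g := tsupport_comp_eq_preimage g A
    rw [h1] at hp
    obtain ⟨q, hq, hqp⟩ := hgU hp
    rwa [← A.injective hqp]
  have hAd : ∀ p, HasFDerivAt A (T : E2 × ℝ →L[ℝ] E3) p := fun p => T.hasFDerivAt.const_add x₀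
  have hkd : ∀ p, A p ∈ B → HasFDerivAt k ((fderiv ℝ g (A p)).comp (T : E2 × ℝ →L[ℝ] E3)) p :=
    fun p hp => (hg.diff _ hp).hasFDerivAt.comp p (hAd p)
  have hΩo : IsOpen {p : E2 × ℝ | p.2 < ψ p.1} :=
    isOpen_lt continuous_snd (hψc.continuous.comp continuous_fst)
  have hkd0 : ∀ p, p ∉ V → fderiv ℝ k p = 0 := fun p hp =>
    fderiv_of_notMem_tsupport (𝕜 := ℝ) fun h => hp (hktU p h)
  -- Outside the box the subgraph need not correspond to B, but there k vanishes identically near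
  -- the point.
  have hdich : ∀ p, p.2 < ψ p.1 → A p ∈ B ∨ p ∉ tsupport k := by
    intro p hp
    by_cases h : p ∈ tsupport k
    · exact Or.inl ((hbox p (hVbox p (hktU p h))).1.2 hp)
    · exact Or.inr h
  have hint : ∫ x in B, fderiv ℝ g x v = ∫ p in {p : E2 × ℝ | p.2 < ψ p.1}, fderiv ℝ k p w := by
    rw [← hAm.setIntegral_preimage_emb A.measurableEmbedding]
    have h1 : ∫ p in A ⁻¹' B, fderiv ℝ g (A p) v = ∫ p in A ⁻¹' B, fderiv ℝ k p w := by
      refine setIntegral_congr_fun (hB.preimage A.continuous).measurableSet fun p hp => ?_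
      rw [(hkd p hp).fderiv]
      simp [hTw]
    have h2 : ∀ s : Set (E2 × ℝ), MeasurableSet s →
        ∫ p in s, fderiv ℝ k p w = ∫ p in s ∩ V, fderiv ℝ k p w := fun s hs =>
      setIntegral_eq_of_subset_of_forall_sdiff_eq_zero hs inter_subset_left
        fun p hp => by rw [hkd0 p fun h => hp.2 ⟨hp.1, h⟩]; rfl
    rw [h1, h2 _ (hB.preimage A.continuous).measurableSet, h2 _ hΩo.measurableSet]
    congr 2
    ext p
    simp only [mem_inter_iff, mem_preimage, mem_ofPred_eq]
    exact and_congr_left fun hp => (hbox p (hVbox p hp)).1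
  have hflux : ∫ x in B, fderiv ℝ g x v = ∫ y, (w.2 - fderiv ℝ ψ y w.1) * k (y, ψ y) := by
    rw [hint]
    obtain ⟨C, hC⟩ := hg.fderiv_bdd
    refine integral_subgraph_fderiv hψc hM hks (C := max 0 (C * ‖(T : E2 × ℝ →L[ℝ] E3)‖))
      ?_ ?_ ?_ ?_ w
    · intro p hp
      have hp : p.2 ≤ ψ p.1 := hp
      by_cases h : p ∈ tsupport k
      · have hpV := hVbox p (hktU p h)
        have h1 : A p ∈ closure B := by
          rcases hp.lt_or_eq with h2 | h2
          · exact subset_closure ((hbox p hpV).1.2 h2)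
          · exact frontier_subset_closure ((hbox p hpV).2.2 h2)
        have h3 : ContinuousWithinAt k (A ⁻¹' closure B) p :=
          (hg.cont _ h1).comp A.continuous.continuousWithinAt (mapsTo_preimage _ _)
        refine h3.mono_of_mem_nhdsWithin ?_
        refine mem_nhdsWithin.2 ⟨Metric.ball 0 δ, Metric.isOpen_ball, hpV, ?_⟩
        rintro q ⟨hq1, hq2⟩
        have hq2 : q.2 ≤ ψ q.1 := hq2
        rcases hq2.lt_or_eq with h2 | h2
        · exact subset_closure ((hbox q hq1).1.2 h2)
        · exact frontier_subset_closure ((hbox q hq1).2.2 h2)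
      · have h0 : k =ᶠ[𝓝 p] fun _ => 0 := by
          filter_upwards [(isClosed_tsupport k).isOpen_compl.mem_nhds h] with q hq
          exact image_eq_zero_of_notMem_tsupport hq
        exact (continuousAt_const.congr h0.symm).continuousWithinAt
    · intro p hp
      rcases hdich p hp with h | h
      · exact (hkd p h).differentiableAt
      · have h0 : k =ᶠ[𝓝 p] fun _ => 0 := by
          filter_upwards [(isClosed_tsupport k).isOpen_compl.mem_nhds h] with q hq
          exact image_eq_zero_of_notMem_tsupport hq
        exact (differentiableAt_const (0 : ℝ)).congr_of_eventuallyEq h0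
    · intro p hp
      refine ContinuousAt.continuousWithinAt ?_
      rcases hdich p hp with h | h
      · have h1 : ContinuousAt (fun q => (fderiv ℝ g (A q)).comp (T : E2 × ℝ →L[ℝ] E3)) p :=
          ((hg.fderiv_cont.continuousAt (hB.mem_nhds h)).comp (f := A)
            A.continuous.continuousAt).clm_comp continuousAt_const
        refine h1.congr ?_
        filter_upwards [(hB.preimage A.continuous).mem_nhds h] with q hq
        exact (hkd q hq).fderiv.symm
      · have h0 : fderiv ℝ k =ᶠ[𝓝 p] fun _ => 0 := by
          filter_upwards [(isClosed_tsupport k).isOpen_compl.mem_nhds h] with q hq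
          exact fderiv_of_notMem_tsupport (𝕜 := ℝ) hq
        exact continuousAt_const.congr h0.symm
    · intro p hp
      rcases hdich p hp with h | h
      · rw [(hkd p h).fderiv]
        refine ((ContinuousLinearMap.opNorm_comp_le _ _).trans ?_).trans (le_max_right _ _)
        exact mul_le_mul_of_nonneg_right (hC _ h) (norm_nonneg _)
      · rw [fderiv_of_notMem_tsupport (𝕜 := ℝ) h, norm_zero]; exact le_max_left _ _
  have hkG : ∀ y, k (y, ψ y) = g (G y) := fun y => rfl
  have hgG0 : ∀ y, y ∉ D → g (G y) = 0 := fun y hy => by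
    rw [← hkG]
    exact image_eq_zero_of_notMem_tsupport fun h => hy (hktU _ h).1
  have hfluxD : ∫ x in B, fderiv ℝ g x v
      = ∫ y in D, (w.2 - fderiv ℝ ψ y w.1) * g (G y) := by
    rw [hflux, setIntegral_eq_integral_of_forall_compl_eq_zero]
    · rfl
    · intro y hy; rw [hgG0 y hy, mul_zero]
  -- integrability on the boundary
  have hGD : G '' D ⊆ frontier B := hfrU ▸ inter_subset_left
  have hGDm : MeasurableSet (G '' D) := hfrU ▸ isClosed_frontier.measurableSet.inter hUo.measurableSet
  obtain ⟨Cg, hCg⟩ : ∃ Cg, ∀ x ∈ frontier B, |g x| ≤ Cg := by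
    have h1 : IsCompact (tsupport g ∩ closure B) := hgs.isCompact.inter_right isClosed_closure
    obtain ⟨Cg, hCg⟩ := h1.exists_bound_of_continuousOn (hg.cont.mono inter_subset_right)
    refine ⟨max 0 Cg, fun x hx => ?_⟩
    by_cases h : x ∈ tsupport g
    · exact (hCg x ⟨h, frontier_subset_closure hx⟩).trans (le_max_right _ _)
    · rw [image_eq_zero_of_notMem_tsupport h, abs_zero]; exact le_max_left _ _
  have hgμ : Integrable g μ := by
    refine Integrable.of_bound (C := Cg) ?_ ?_
    · exact (hg.cont.mono (hGD.trans frontier_subset_closure)).aestronglyMeasurable hGDm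
    · exact (ae_restrict_iff' hGDm).2 (Filter.Eventually.of_forall fun x hx => hCg x (hGD hx))
  have hnb : ∀ x ∈ frontier B, |inner ℝ v (n x)| ≤ ‖v‖ := fun x hx =>
    (abs_real_inner_le_norm _ _).trans_eq (by rw [norm_normal_eq_one hs hn hx, mul_one])
  have hnc : Continuous fun x => inner ℝ v (n x) := by have := hn.1.continuous; fun_prop
  have hgnμ : Integrable (fun x => g x * inner ℝ v (n x)) μ := by
    refine hgμ.mul_bdd (c := ‖v‖) hnc.aestronglyMeasurable ?_
    exact (ae_restrict_iff' hGDm).2 (Filter.Eventually.of_forall fun x hx => hnb x (hGD hx))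
  have hgν := hgμ.mono_measure hle1
  have hgnν := hgnμ.mono_measure hle1
  have hGemb : MeasurableEmbedding G :=
    hGc.measurableEmbedding hGanti.injective
  have hν_int : ∀ f : E3 → ℝ, ∫ x, f x ∂ν = ∫ y in D, f (G y) := fun f => hGemb.integral_map f
  -- This error comes from replacing the flux coefficient of the graph by the inner product with the
  -- normal, while area is still measured in the projection; `est2` then passes from projected area
  -- to true area.
  have est1 : |(∫ y in D, (w.2 - fderiv ℝ ψ y w.1) * g (G y)) - ∫ x, g x * inner ℝ v (n x) ∂ν|
      ≤ e * ∫ x, |g x| ∂ν := by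
    have hi1 : IntegrableOn (fun y => g (G y)) D := (hGemb.integrable_map_iff).1 hgν
    have hi2 : IntegrableOn (fun y => g (G y) * inner ℝ v (n (G y))) D :=
      (hGemb.integrable_map_iff).1 hgnν
    have hi3 : IntegrableOn (fun y => (w.2 - fderiv ℝ ψ y w.1) * g (G y)) D := by
      refine hi1.bdd_mul (c := |w.2| + M * ‖w.1‖) ?_ ?_
      · have := hψc.continuous_fderiv one_ne_zero
        exact Continuous.aestronglyMeasurable (by fun_prop)
      · refine Filter.Eventually.of_forall fun y => ?_
        have h5 := ((fderiv ℝ ψ y).le_opNorm w.1).trans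
          (mul_le_mul_of_nonneg_right (hM y) (norm_nonneg _))
        exact (abs_sub _ _).trans (by simpa using h5)
    rw [hν_int, hν_int, ← integral_sub hi3 hi2, ← integral_const_mul]
    refine (abs_integral_le_integral_abs).trans ?_
    refine setIntegral_mono_on (hi3.sub hi2).abs (hi1.abs.const_mul e) measurableSet_ball ?_
    intro y hy
    have := (hball y hy).2.2.2.le
    have h6 : (w.2 - fderiv ℝ ψ y w.1) * g (G y) - g (G y) * inner ℝ v (n (G y))
        = ((w.2 - fderiv ℝ ψ y w.1) - inner ℝ v (n (G y))) * g (G y) := by ring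
    rw [h6, abs_mul]
    exact mul_le_mul_of_nonneg_right this (abs_nonneg _)
  have est2 := integral_sub_le_of_measure_le (c := 1 + e ^ 2) (by nlinarith) hle1 hle2 hgnμ
  have est3 : ∫ x, |g x * inner ℝ v (n x)| ∂μ ≤ ‖v‖ * ∫ x, |g x| ∂μ := by
    rw [← integral_const_mul]
    refine setIntegral_mono_on hgnμ.abs (hgμ.abs.const_mul _) hGDm fun x hx => ?_
    rw [abs_mul, mul_comm]
    exact mul_le_mul_of_nonneg_right (hnb x (hGD hx)) (abs_nonneg _)
  have est4 : ∫ x, |g x| ∂ν ≤ ∫ x, |g x| ∂μ :=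
    integral_mono_measure hle1 (Filter.Eventually.of_forall fun x => abs_nonneg (g x)) hgμ.abs
  rw [hI1, hI2, hfluxD]
  have hpos : 0 ≤ ∫ x, |g x| ∂μ := integral_nonneg fun x => abs_nonneg _
  calc _ ≤ _ + _ := abs_sub_le _ (∫ x, g x * inner ℝ v (n x) ∂ν) _
    _ ≤ e * ∫ x, |g x| ∂μ + e ^ 2 * (‖v‖ * ∫ x, |g x| ∂μ) := by
        refine add_le_add (est1.trans (mul_le_mul_of_nonneg_left est4 he0.le)) ?_
        rw [abs_sub_comm]
        refine est2.trans ?_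
        rw [add_sub_cancel_left]
        exact mul_le_mul_of_nonneg_left est3 (sq_nonneg e)
    _ ≤ (e * (1 + ‖v‖)) * ∫ x, |g x| ∂μ := by
        have : e ^ 2 ≤ e := by nlinarith
        have := mul_le_mul_of_nonneg_right this (mul_nonneg (norm_nonneg v) hpos)
        nlinarith
    _ ≤ ε * ∫ x, |g x| ∂μ := mul_le_mul_of_nonneg_right he hpos

/-! ### Regularity up to the boundary and the global divergence theorem. -/

/-- The closure of a body with smooth boundary has unique derivatives. -/
lemma uniqueDiffOn_closure {B : Set E3} (hB : IsOpen B) (hs : HasSmoothBoundary B) :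
    UniqueDiffOn ℝ (closure B) := by
  intro x hx
  by_cases hxB : x ∈ B
  · exact (hB.uniqueDiffWithinAt hxB).mono subset_closure
  have hxf : x ∈ frontier B := by rw [hB.frontier_eq]; exact ⟨hx, hxB⟩
  obtain ⟨φ, hφ⟩ := hs x hxf
  have h0 := hφ.eq_zero hB hxf
  have hd : HasFDerivAt φ (fderiv ℝ φ x) x := (hφ.1.differentiable (by simp) x).hasFDerivAt
  -- Along a direction in which φ decreases, a short open segment starting at x lies in B.
  have key : ∀ v, fderiv ℝ φ x v < 0 →
      v ∈ Submodule.span ℝ (tangentConeAt ℝ (closure B) x) := by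
    intro v hv
    have h1 : HasDerivAt (fun t : ℝ => φ (x + t • v)) (fderiv ℝ φ x v) 0 := hd.hasLineDerivAt v
    have h2 : ∀ᶠ t in 𝓝[>] (0 : ℝ), φ (x + t • v) < 0 := by
      have h3 := (hasDerivAt_iff_tendsto_slope.1 h1).eventually (gt_mem_nhds hv)
      have h4 : 𝓝[>] (0 : ℝ) ≤ 𝓝[≠] 0 := nhdsWithin_mono _ fun t ht => ne_of_gt ht
      filter_upwards [h4 h3, self_mem_nhdsWithin] with t ht1 ht2
      have ht2 : 0 < t := ht2
      have ht1 : slope (fun t : ℝ => φ (x + t • v)) 0 t < 0 := ht1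
      rw [slope_def_field] at ht1
      simp only [zero_smul, add_zero, h0, sub_zero] at ht1
      rwa [div_lt_iff₀ ht2, zero_mul] at ht1
    have h3 : ∀ᶠ t in 𝓝[>] (0 : ℝ), x + t • v ∈ B := by
      have hc : Filter.Tendsto (fun t : ℝ => x + t • v) (𝓝[>] 0) (𝓝 x) := by
        have : Continuous fun t : ℝ => x + t • v := by fun_prop
        simpa using (this.tendsto 0).mono_left nhdsWithin_le_nhds
      filter_upwards [h2, hc.eventually hφ.2.2] with t ht1 ht2
      exact ht2.2 ht1
    obtain ⟨t₀, ht₀, hsub⟩ := mem_nhdsGT_iff_exists_Ioo_subset.1 h3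
    have ht₀ : 0 < t₀ := ht₀
    have h4 : openSegment ℝ x (x + t₀ • v) ⊆ closure B := by
      intro y hy
      rw [openSegment_eq_image'] at hy
      obtain ⟨s, hs, rfl⟩ := hy
      refine subset_closure ?_
      have h5 : s * t₀ ∈ Ioo 0 t₀ := ⟨mul_pos hs.1 ht₀, by nlinarith [hs.2]⟩
      have := hsub h5
      simpa [smul_smul] using this
    have h5 := mem_tangentConeAt_of_openSegment_subset h4
    rw [add_sub_cancel_left] at h5
    have h6 := Submodule.smul_mem _ t₀⁻¹ (Submodule.subset_span (R := ℝ) h5)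
    rwa [smul_smul, inv_mul_cancel₀ ht₀.ne', one_smul] at h6
  refine ⟨?_, subset_closure hx⟩
  -- The inward directions form an open half-space: a small multiple of any u is the difference of
  -- the two inward vectors -∇φ + s u and -∇φ.
  have htop : Submodule.span ℝ (tangentConeAt ℝ (closure B) x) = ⊤ := by
    rw [eq_top_iff]
    intro u _
    have hv0 : fderiv ℝ φ x (-gradient φ x) < 0 := by
      have : fderiv ℝ φ x (gradient φ x) = inner ℝ (gradient φ x) (gradient φ x) := by
        conv_rhs => rw [gradient, InnerProductSpace.toDual_symm_apply]
        rfl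
      rw [map_neg, this, real_inner_self_eq_norm_sq, neg_lt_zero]
      exact pow_pos (norm_pos_iff.2 hφ.2.1) 2
    have hev : ∀ᶠ s in 𝓝[>] (0 : ℝ), fderiv ℝ φ x (-gradient φ x + s • u) < 0 := by
      have hc : Continuous fun s : ℝ => fderiv ℝ φ x (-gradient φ x + s • u) := by fun_prop
      exact (hc.continuousAt.eventually (gt_mem_nhds (by simpa using hv0))).filter_mono
        nhdsWithin_le_nhds
    obtain ⟨s, hs1, hs2⟩ := (hev.and self_mem_nhdsWithin).exists
    have hs2 : 0 < s := hs2
    have h7 := Submodule.smul_mem _ s⁻¹ (Submodule.sub_mem _ (key _ hs1) (key _ hv0))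
    rwa [add_sub_cancel_left, smul_smul, inv_mul_cancel₀ hs2.ne', one_smul] at h7
  rw [htop]
  exact dense_univ

/-- The frontier is compact and the graph patches have finite area. The direction 0 and the
tolerance 1 are arbitrary: only finiteness is taken from the local estimate. -/
lemma area_univ_lt_top {B : Set E3} (hB : IsOpen B) (hBb : Bornology.IsBounded B)
    (hs : HasSmoothBoundary B) {n : E3 → E3} (hn : IsOutwardUnitNormal B n) :
    area B univ < ⊤ := by
  have hc : IsCompact (frontier B) :=
    hBb.isCompact_closure.of_isClosed_subset isClosed_frontier frontier_subset_closure
  have h1 : area B univ = area B (frontier B) := by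
    rw [area, Measure.restrict_apply_univ, Measure.restrict_apply_self]
  rw [h1]
  refine hc.measure_lt_top_of_nhdsWithin fun x hx => ?_
  obtain ⟨U, hU, hxU, hfin, -⟩ := exists_nhds_boundary_estimate hB hs hn hx 0 one_pos
  exact ⟨U, mem_nhdsWithin_of_mem_nhds (hU.mem_nhds hxU), hfin⟩

/-- The derivative within the closure is continuous on a compact set, hence bounded, and equals the
ordinary derivative at points of B. -/
lemma ContDiffOn.isRegular {B : Set E3} (hB : IsOpen B) (hBb : Bornology.IsBounded B)
    (hs : HasSmoothBoundary B) {g : E3 → ℝ} (hg : ContDiffOn ℝ 1 g (closure B)) :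
    IsRegular B g where
  cont := hg.continuousOn
  diff x hx := ((hg.mono subset_closure).differentiableOn one_ne_zero).differentiableAt
    (hB.mem_nhds hx)
  fderiv_cont := (hg.mono subset_closure).continuousOn_fderiv_of_isOpen hB le_rfl
  fderiv_bdd := by
    have h1 := hg.continuousOn_fderivWithin (uniqueDiffOn_closure hB hs) le_rfl
    obtain ⟨C, hC⟩ := hBb.isCompact_closure.exists_bound_of_continuousOn h1
    refine ⟨C, fun x hx => ?_⟩
    have h2 : closure B ∈ 𝓝 x := Filter.mem_of_superset (hB.mem_nhds hx) subset_closure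
    rw [← fderivWithin_of_mem_nhds h2]
    exact hC x (subset_closure hx)

lemma IsRegular.integrableOn {B : Set E3} (hB : IsOpen B) (hBb : Bornology.IsBounded B)
    {g : E3 → ℝ} (hg : IsRegular B g) (v : E3) : IntegrableOn (fun x => fderiv ℝ g x v) B := by
  obtain ⟨C, hC⟩ := hg.fderiv_bdd
  have : IsFiniteMeasure ((volume : Measure E3).restrict B) :=
    isFiniteMeasure_restrict.2 hBb.measure_lt_top.ne
  refine Integrable.of_bound (C := C * ‖v‖) ?_ ?_
  · exact (hg.fderiv_cont.clm_apply continuousOn_const).aestronglyMeasurable hB.measurableSet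
  · refine (ae_restrict_iff' hB.measurableSet).2 (Filter.Eventually.of_forall fun x hx => ?_)
    exact ((fderiv ℝ g x).le_opNorm v).trans
      (mul_le_mul_of_nonneg_right (hC x hx) (norm_nonneg _))

lemma integrable_area_of_continuousOn {B : Set E3} (hB : IsOpen B) (hBb : Bornology.IsBounded B)
    (hs : HasSmoothBoundary B) {n : E3 → E3} (hn : IsOutwardUnitNormal B n)
    {g : E3 → ℝ} (hg : ContinuousOn g (closure B)) : Integrable g (area B) := by
  have : IsFiniteMeasure (area B) := ⟨area_univ_lt_top hB hBb hs hn⟩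
  obtain ⟨C, hC⟩ := hBb.isCompact_closure.exists_bound_of_continuousOn hg
  refine Integrable.of_bound (C := C) ?_ ?_
  · exact (hg.mono frontier_subset_closure).aestronglyMeasurable isClosed_frontier.measurableSet
  · exact (ae_restrict_iff' isClosed_frontier.measurableSet).2
      (Filter.Eventually.of_forall fun x hx => hC x (frontier_subset_closure hx))

lemma IsRegular.smooth_mul {B : Set E3} (hBb : Bornology.IsBounded B)
    {f g : E3 → ℝ} (hf : ContDiff ℝ 1 f) (hg : IsRegular B g) :
    IsRegular B (fun x => f x * g x) := by
  have hfd := hf.differentiable one_ne_zero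
  have hfc := hf.continuous_fderiv one_ne_zero
  have hd : ∀ x ∈ B, HasFDerivAt (fun x => f x * g x)
      (f x • fderiv ℝ g x + g x • fderiv ℝ f x) x := fun x hx =>
    (hfd x).hasFDerivAt.mul (hg.diff x hx).hasFDerivAt
  refine ⟨hf.continuous.continuousOn.mul hg.cont, fun x hx => (hd x hx).differentiableAt, ?_, ?_⟩
  · refine ContinuousOn.congr ?_ fun x hx => (hd x hx).fderiv
    exact (hf.continuous.continuousOn.smul hg.fderiv_cont).add
      ((hg.cont.mono subset_closure).smul hfc.continuousOn)
  · obtain ⟨C1, h1⟩ := hBb.isCompact_closure.exists_bound_of_continuousOn hf.continuous.continuousOn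
    obtain ⟨C2, h2⟩ := hBb.isCompact_closure.exists_bound_of_continuousOn hfc.continuousOn
    obtain ⟨C3, h3⟩ := hBb.isCompact_closure.exists_bound_of_continuousOn hg.cont
    obtain ⟨C4, h4⟩ := hg.fderiv_bdd
    refine ⟨C1 * C4 + C3 * C2, fun x hx => ?_⟩
    have hx' := subset_closure hx
    rw [(hd x hx).fderiv]
    refine (norm_add_le _ _).trans (add_le_add ?_ ?_)
    · rw [norm_smul]
      exact mul_le_mul (h1 x hx') (h4 x hx) (norm_nonneg _) ((norm_nonneg _).trans (h1 x hx'))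
    · rw [norm_smul]
      exact mul_le_mul (h3 x hx') (h2 x hx') (norm_nonneg _) ((norm_nonneg _).trans (h3 x hx'))

/-- With its support inside B, g is C¹ on the whole space, so no boundary contribution can arise. -/
lemma integral_fderiv_eq_zero_of_support {B : Set E3} (hB : IsOpen B) {g : E3 → ℝ}
    (hg : IsRegular B g) (hgs : HasCompactSupport g) (hgB : tsupport g ⊆ B) (v : E3) :
    ∫ x in B, fderiv ℝ g x v = 0 := by
  have h0 : ∀ x, x ∉ B → g =ᶠ[𝓝 x] fun _ => 0 := fun x hx => by
    filter_upwards [(isClosed_tsupport g).isOpen_compl.mem_nhds fun h => hx (hgB h)] with y hy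
    exact image_eq_zero_of_notMem_tsupport hy
  have hd : Differentiable ℝ g := fun x => by
    by_cases hx : x ∈ B
    · exact hg.diff x hx
    · exact (differentiableAt_const (0 : ℝ)).congr_of_eventuallyEq (h0 x hx)
  have hc : Continuous (fderiv ℝ g) := continuous_iff_continuousAt.2 fun x => by
    by_cases hx : x ∈ B
    · exact hg.fderiv_cont.continuousAt (hB.mem_nhds hx)
    · have h1 : fderiv ℝ g =ᶠ[𝓝 x] fun _ => 0 := by
        filter_upwards [(h0 x hx).eventuallyEq_nhds] with y hy
        rw [hy.fderiv_eq]; simp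
      exact continuousAt_const.congr h1.symm
  have hcs : HasCompactSupport fun x => fderiv ℝ g x v := hgs.fderiv_apply (𝕜 := ℝ) v
  rw [setIntegral_eq_integral_of_forall_compl_eq_zero]
  · have := integral_bilinear_hasLineDerivAt_right_eq_neg_left_of_integrable
      (μ := (volume : Measure E3)) (f := fun _ : E3 => (1 : ℝ)) (f' := fun _ => (0 : ℝ)) (g := g)
      (g' := fun x => fderiv ℝ g x v) (v := v) (B := ContinuousLinearMap.mul ℝ ℝ)
      (by simp) (by simpa using (hc.clm_apply continuous_const).integrable_of_hasCompactSupport hcs)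
      (by simpa using hd.continuous.integrable_of_hasCompactSupport hgs)
      (fun x _ => (hasFDerivAt_const (1 : ℝ) x).hasLineDerivAt v)
      (fun x _ => (hd x).hasFDerivAt.hasLineDerivAt v)
    simpa using this
  · intro x hx
    rw [(h0 x hx).fderiv_eq]; simp

/-- At an interior point B itself serves as the neighbourhood, both integrals being zero. Cutting
with a ball makes U bounded, which later gives the localized functions compact support. -/
lemma exists_nhds_estimate {B : Set E3} (hB : IsOpen B)
    (hs : HasSmoothBoundary B) {n : E3 → E3} (hn : IsOutwardUnitNormal B n)
    {x₀ : E3} (hx : x₀ ∈ closure B) (v : E3) {ε : ℝ} (hε : 0 < ε) :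
    ∃ U : Set E3, IsOpen U ∧ x₀ ∈ U ∧ Bornology.IsBounded U ∧
      ∀ g : E3 → ℝ, IsRegular B g → HasCompactSupport g → tsupport g ⊆ U →
        |(∫ x in B, fderiv ℝ g x v) - ∫ x, g x * inner ℝ v (n x) ∂(area B)|
          ≤ ε * ∫ x, |g x| ∂(area B) := by
  have hmain : ∃ U : Set E3, IsOpen U ∧ x₀ ∈ U ∧
      ∀ g : E3 → ℝ, IsRegular B g → HasCompactSupport g → tsupport g ⊆ U →
        |(∫ x in B, fderiv ℝ g x v) - ∫ x, g x * inner ℝ v (n x) ∂(area B)|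
          ≤ ε * ∫ x, |g x| ∂(area B) := by
    by_cases hxB : x₀ ∈ B
    · refine ⟨B, hB, hxB, fun g hg hgs hgB => ?_⟩
      have h0 : ∀ x ∈ frontier B, g x = 0 := fun x hx => by
        rw [hB.frontier_eq] at hx
        exact image_eq_zero_of_notMem_tsupport fun h => hx.2 (hgB h)
      have h1 : ∫ x, g x * inner ℝ v (n x) ∂(area B) = 0 :=
        setIntegral_eq_zero_of_forall_eq_zero fun x hx => by rw [h0 x hx, zero_mul]
      rw [integral_fderiv_eq_zero_of_support hB hg hgs hgB v, h1, sub_zero, abs_zero]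
      exact mul_nonneg hε.le (integral_nonneg fun x => abs_nonneg _)
    · have hxf : x₀ ∈ frontier B := by rw [hB.frontier_eq]; exact ⟨hx, hxB⟩
      obtain ⟨U, h1, h2, -, h3⟩ := exists_nhds_boundary_estimate hB hs hn hxf v hε
      exact ⟨U, h1, h2, h3⟩
  obtain ⟨U, h1, h2, h3⟩ := hmain
  exact ⟨U ∩ Metric.ball x₀ 1, h1.inter Metric.isOpen_ball, ⟨h2, by simp⟩,
    Metric.isBounded_ball.subset inter_subset_right,
    fun g hg hgs hgU => h3 g hg hgs (hgU.trans inter_subset_left)⟩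

open scoped Manifold in
/-- The divergence theorem on a bounded open set with smooth boundary. -/
theorem integral_fderivWithin_eq_integral_area {B : Set E3} (hB : IsOpen B)
    (hBb : Bornology.IsBounded B) (hs : HasSmoothBoundary B) {n : E3 → E3}
    (hn : IsOutwardUnitNormal B n) {g : E3 → ℝ} (hg : ContDiffOn ℝ 1 g (closure B)) (v : E3) :
    ∫ x in B, fderivWithin ℝ g (closure B) x v = ∫ x, g x * inner ℝ v (n x) ∂(area B) := by
  have hgr := ContDiffOn.isRegular hB hBb hs hg
  have h1 : ∫ x in B, fderivWithin ℝ g (closure B) x v = ∫ x in B, fderiv ℝ g x v := by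
    refine setIntegral_congr_fun hB.measurableSet fun x hx => ?_
    have h2 : closure B ∈ 𝓝 x := Filter.mem_of_superset (hB.mem_nhds hx) subset_closure
    change fderivWithin ℝ g (closure B) x v = fderiv ℝ g x v
    rw [fderivWithin_of_mem_nhds h2]
  rw [h1, ← sub_eq_zero]
  -- The local errors are relative to ∫ |f_i g| with nonnegative f_i of sum 1, so they add up to ε ∫
  -- |g| independently of the number of patches.
  have hest : ∀ ε > 0, |(∫ x in B, fderiv ℝ g x v) - ∫ x, g x * inner ℝ v (n x) ∂(area B)|
      ≤ ε * ∫ x, |g x| ∂(area B) := by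
    intro ε hε
    have hU : ∀ x : E3, ∃ U : Set E3, x ∈ closure B → (IsOpen U ∧ x ∈ U ∧ Bornology.IsBounded U ∧
      ∀ g : E3 → ℝ, IsRegular B g → HasCompactSupport g → tsupport g ⊆ U →
        |(∫ x in B, fderiv ℝ g x v) - ∫ x, g x * inner ℝ v (n x) ∂(area B)|
          ≤ ε * ∫ x, |g x| ∂(area B)) := fun x => by
      by_cases hx : x ∈ closure B
      · obtain ⟨U, hU⟩ := exists_nhds_estimate hB hs hn hx v hε
        exact ⟨U, fun _ => hU⟩
      · exact ⟨∅, fun h => absurd h hx⟩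
    choose U hU using hU
    obtain ⟨t, htB, hcov⟩ := hBb.isCompact_closure.elim_nhds_subcover U
      fun x hx => (hU x hx).1.mem_nhds (hU x hx).2.1
    obtain ⟨f, hf⟩ := SmoothPartitionOfUnity.exists_isSubordinate 𝓘(ℝ, E3)
      (isClosed_closure (s := B)) (fun i : t => U i) (fun i => (hU i (htB i i.2)).1)
      (fun x hx => by simpa using hcov hx)
    have hfc : ∀ i, ContDiff ℝ 1 (f i) := fun i =>
      ((contMDiff_iff_contDiff.1 (f i).contMDiff).of_le (by simp))
    have hsum : ∀ x ∈ closure B, ∑ i, f i x = 1 := fun x hx => by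
      rw [← finsum_eq_sum_of_fintype]; exact f.sum_eq_one hx
    have hfi : ∀ i, IsRegular B fun x => f i x * g x := fun i =>
      IsRegular.smooth_mul hBb (hfc i) hgr
    have htsub : ∀ i, tsupport (fun x => f i x * g x) ⊆ U i := fun i =>
      (tsupport_mul_subset_left).trans (hf i)
    have hcs : ∀ i, HasCompactSupport fun x => f i x * g x := fun i =>
      Metric.isCompact_of_isClosed_isBounded (isClosed_tsupport _)
        ((hU i (htB i i.2)).2.2.1.subset (htsub i))
    have hint : ∀ h : E3 → ℝ, ContinuousOn h (closure B) → Integrable h (area B) := fun h hh =>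
      integrable_area_of_continuousOn hB hBb hs hn hh
    have hnc : Continuous fun x => inner ℝ v (n x) := by have := hn.1.continuous; fun_prop
    have e1 : ∫ x in B, fderiv ℝ g x v = ∑ i, ∫ x in B, fderiv ℝ (fun x => f i x * g x) x v := by
      rw [← integral_finsetSum _ fun i _ => (hfi i).integrableOn hB hBb v]
      refine setIntegral_congr_fun hB.measurableSet fun x hx => ?_
      have h2 : g =ᶠ[𝓝 x] fun x => ∑ i, f i x * g x := by
        filter_upwards [hB.mem_nhds hx] with y hy
        rw [← Finset.sum_mul, hsum y (subset_closure hy), one_mul]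
      change fderiv ℝ g x v = _
      rw [h2.fderiv_eq, fderiv_fun_sum fun i _ => (hfi i).diff x hx]
      simp
    have e2 : ∫ x, g x * inner ℝ v (n x) ∂(area B)
        = ∑ i, ∫ x, f i x * g x * inner ℝ v (n x) ∂(area B) := by
      have hi : ∀ i, Integrable (fun x => f i x * g x * inner ℝ v (n x)) (area B) := fun i =>
        hint _ ((hfi i).cont.mul hnc.continuousOn)
      rw [← integral_finsetSum _ fun i _ => hi i]
      refine setIntegral_congr_fun isClosed_frontier.measurableSet fun x hx => ?_
      beta_reduce
      rw [← Finset.sum_mul, ← Finset.sum_mul, hsum x (frontier_subset_closure hx), one_mul]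
    have e3 : ∫ x, |g x| ∂(area B) = ∑ i, ∫ x, |f i x * g x| ∂(area B) := by
      rw [← integral_finsetSum _ fun i _ => hint _ (hfi i).cont.abs]
      refine setIntegral_congr_fun isClosed_frontier.measurableSet fun x hx => ?_
      simp only [abs_mul, abs_of_nonneg (f.nonneg _ x)]
      rw [← Finset.sum_mul, hsum x (frontier_subset_closure hx), one_mul]
    rw [e1, e2, e3, ← Finset.sum_sub_distrib, Finset.mul_sum]
    refine (Finset.abs_sum_le_sum_abs _ _).trans (Finset.sum_le_sum fun i _ => ?_)
    exact (hU i (htB i i.2)).2.2.2 _ (hfi i) (hcs i) (htsub i)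
  rw [← abs_nonpos_iff]
  refine le_of_forall_pos_le_add fun ε hε => ?_
  have hI : 0 ≤ ∫ x, |g x| ∂(area B) := integral_nonneg fun x => abs_nonneg _
  -- The summand 1 keeps the denominator positive when g vanishes on the boundary.
  refine (hest (ε / (1 + ∫ x, |g x| ∂(area B))) (by positivity)).trans ?_
  rw [zero_add, div_mul_eq_mul_div, div_le_iff₀ (by positivity)]
  nlinarith

/-! ### Partial derivatives on the body, the surface divergence theorem and the Green identity. -/

/-- `B` is a bounded open set with smooth boundary and outward unit normal `n`. -/
structure IsBody (B : Set E3) (n : E3 → E3) : Prop where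
  isOpen : IsOpen B
  isBounded : Bornology.IsBounded B
  smooth : HasSmoothBoundary B
  normal : IsOutwardUnitNormal B n

/-- The partial derivative of a function of position. -/
def spd (B : Set E3) (i : Fin 3) (f : E3 → ℝ) : E3 → ℝ := fun x =>
  fderivWithin ℝ f (closure B) x (EuclideanSpace.single i 1)

/-- The surface gradient of a function of position. -/
def ssg (B : Set E3) (n : E3 → E3) (j : Fin 3) (f : E3 → ℝ) : E3 → ℝ := fun x =>
  ∑ i, ((if i = j then 1 else 0) - n x i * n x j) * spd B i f x

lemma pd_apply (B : Set E3) (i : Fin 3) (f : Field) (x : E3) (t : ℝ) :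
    pd B i f x t = spd B i (fun y => f y t) x := rfl

namespace IsBody

variable {B : Set E3} {n : E3 → E3}

lemma uniqueDiffOn (h : IsBody B n) : UniqueDiffOn ℝ (closure B) :=
  uniqueDiffOn_closure h.isOpen h.smooth

lemma isCompact (h : IsBody B n) : IsCompact (closure B) := h.isBounded.isCompact_closure

lemma isFiniteMeasure_area (h : IsBody B n) : IsFiniteMeasure (area B) :=
  ⟨area_univ_lt_top h.isOpen h.isBounded h.smooth h.normal⟩

lemma isFiniteMeasure_volume (h : IsBody B n) :
    IsFiniteMeasure ((volume : Measure E3).restrict B) :=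
  isFiniteMeasure_restrict.2 h.isBounded.measure_lt_top.ne

lemma integrable_area (h : IsBody B n) {f : E3 → ℝ} (hf : ContinuousOn f (frontier B)) :
    Integrable f (area B) := by
  have := h.isFiniteMeasure_area
  have hc : IsCompact (frontier B) :=
    h.isCompact.of_isClosed_subset isClosed_frontier frontier_subset_closure
  obtain ⟨C, hC⟩ := hc.exists_bound_of_continuousOn hf
  refine Integrable.of_bound (C := C) ?_ ?_
  · exact hf.aestronglyMeasurable isClosed_frontier.measurableSet
  · exact (ae_restrict_iff' isClosed_frontier.measurableSet).2
      (Filter.Eventually.of_forall fun x hx => hC x hx)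

lemma integrableOn (h : IsBody B n) {f : E3 → ℝ} (hf : ContinuousOn f (closure B)) :
    IntegrableOn f B :=
  (hf.integrableOn_compact h.isCompact).mono_set subset_closure

lemma contDiffOn_spd (h : IsBody B n) {f : E3 → ℝ} {k l : ℕ} (hf : ContDiffOn ℝ l f (closure B))
    (hkl : k + 1 ≤ l) (i : Fin 3) : ContDiffOn ℝ k (spd B i f) (closure B) := by
  have h1 : ContDiffOn ℝ k (fderivWithin ℝ f (closure B)) (closure B) :=
    hf.fderivWithin h.uniqueDiffOn (by exact_mod_cast hkl)
  exact h1.clm_apply contDiffOn_const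

lemma spd_mul (h : IsBody B n) {f g : E3 → ℝ} (hf : ContDiffOn ℝ 1 f (closure B))
    (hg : ContDiffOn ℝ 1 g (closure B)) (i : Fin 3) {x : E3} (hx : x ∈ closure B) :
    spd B i (fun y => f y * g y) x = f x * spd B i g x + spd B i f x * g x := by
  have h1 := (hf.differentiableOn one_ne_zero x hx)
  have h2 := (hg.differentiableOn one_ne_zero x hx)
  rw [spd, fderivWithin_fun_mul (h.uniqueDiffOn x hx) h1 h2]
  simp [spd, mul_comm]

lemma spd_sub (h : IsBody B n) {f g : E3 → ℝ} (hf : ContDiffOn ℝ 1 f (closure B))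
    (hg : ContDiffOn ℝ 1 g (closure B)) (i : Fin 3) {x : E3} (hx : x ∈ closure B) :
    spd B i (fun y => f y - g y) x = spd B i f x - spd B i g x := by
  have h1 := (hf.differentiableOn one_ne_zero x hx)
  have h2 := (hg.differentiableOn one_ne_zero x hx)
  rw [spd, fderivWithin_fun_sub (h.uniqueDiffOn x hx) h1 h2]
  simp [spd]

lemma spd_sum (h : IsBody B n) {f : Fin 3 → E3 → ℝ} (hf : ∀ j, ContDiffOn ℝ 1 (f j) (closure B))
    (i : Fin 3) {x : E3} (hx : x ∈ closure B) :
    spd B i (fun y => ∑ j, f j y) x = ∑ j, spd B i (f j) x := by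
  rw [spd, fderivWithin_fun_sum (h.uniqueDiffOn x hx)
    fun j _ => (hf j).differentiableOn one_ne_zero x hx]
  simp [spd]

lemma spd_neg (h : IsBody B n) (f : E3 → ℝ) (i : Fin 3) {x : E3} (hx : x ∈ closure B) :
    spd B i (fun y => - f y) x = - spd B i f x := by
  rw [spd, fderivWithin_fun_neg (h.uniqueDiffOn x hx)]
  rfl

lemma spd_congr {f g : E3 → ℝ} (hfg : EqOn f g (closure B)) (i : Fin 3) {x : E3}
    (hx : x ∈ closure B) : spd B i f x = spd B i g x := by
  rw [spd, spd, fderivWithin_congr hfg (hfg hx)]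

/-- Symmetry of the second derivative extends to the boundary because every point of the closure is
a limit of interior points. -/
lemma spd_comm (h : IsBody B n) {f : E3 → ℝ} (hf : ContDiffOn ℝ 2 f (closure B)) (i j : Fin 3)
    {x : E3} (hx : x ∈ closure B) : spd B i (spd B j f) x = spd B j (spd B i f) x := by
  have hint : x ∈ closure (interior (closure B)) :=
    closure_mono (h.isOpen.subset_interior_iff.2 subset_closure) hx
  have h1 := (hf x hx).isSymmSndFDerivWithinAt (by simp) h.uniqueDiffOn hint hx
  have h2 : ContDiffOn ℝ 1 (fderivWithin ℝ f (closure B)) (closure B) :=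
    hf.fderivWithin h.uniqueDiffOn (by norm_num)
  have h3 : ∀ a b : Fin 3, spd B a (spd B b f) x = fderivWithin ℝ (fderivWithin ℝ f (closure B))
      (closure B) x (EuclideanSpace.single a 1) (EuclideanSpace.single b 1) := by
    intro a b
    have hd := (h2.differentiableOn one_ne_zero x hx)
    have e : spd B b f = fun y => fderivWithin ℝ f (closure B) y (EuclideanSpace.single b 1) := rfl
    rw [spd, e, fderivWithin_clm_apply (h.uniqueDiffOn x hx) hd (differentiableWithinAt_const _)]
    simp
  rw [h3, h3]
  exact h1 _ _

/-- The divergence theorem for partial derivatives. -/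
lemma integral_spd (h : IsBody B n) {g : E3 → ℝ} (hg : ContDiffOn ℝ 1 g (closure B)) (i : Fin 3) :
    ∫ x in B, spd B i g x = ∫ x, g x * n x i ∂(area B) := by
  have := integral_fderivWithin_eq_integral_area h.isOpen h.isBounded h.smooth h.normal hg
    (EuclideanSpace.single i 1)
  simpa [EuclideanSpace.inner_single_left, spd] using this

lemma contDiff_normal (h : IsBody B n) {k : ℕ} (i : Fin 3) : ContDiff ℝ k (fun x => n x i) := by
  have h1 : ContDiff ℝ k n := h.normal.1.of_le (by exact_mod_cast le_top)
  fun_prop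

lemma integral_mul_spd (h : IsBody B n) {f g : E3 → ℝ} (hf : ContDiffOn ℝ 1 f (closure B))
    (hg : ContDiffOn ℝ 1 g (closure B)) (i : Fin 3) :
    ∫ x in B, f x * spd B i g x
      = (∫ x, f x * g x * n x i ∂(area B)) - ∫ x in B, spd B i f x * g x := by
  rw [← h.integral_spd (hf.mul hg), eq_sub_iff_add_eq, ← integral_add]
  · exact setIntegral_congr_fun h.isOpen.measurableSet fun x hx =>
      (h.spd_mul hf hg i (subset_closure hx)).symm
  · exact h.integrableOn (hf.continuousOn.mul
      (h.contDiffOn_spd (k := 0) (l := 1) hg le_rfl i).continuousOn)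
  · exact h.integrableOn
      ((h.contDiffOn_spd (k := 0) (l := 1) hf le_rfl i).continuousOn.mul hg.continuousOn)

lemma sum_normal_sq (h : IsBody B n) {x : E3} (hx : x ∈ frontier B) : ∑ i, n x i * n x i = 1 := by
  have h1 := norm_normal_eq_one h.smooth h.normal hx
  have h2 := EuclideanSpace.real_norm_sq_eq (n x)
  rw [h1] at h2
  simpa [sq] using h2.symm

/-- A function that vanishes on the boundary has a normal gradient there. -/
lemma fderiv_eq_of_eq_zero_on_frontier (h : IsBody B n) {f : E3 → ℝ} (hf : Differentiable ℝ f)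
    (h0 : ∀ x ∈ frontier B, f x = 0) {x : E3} (hx : x ∈ frontier B) (v : E3) :
    fderiv ℝ f x v = fderiv ℝ f x (n x) * inner ℝ v (n x) := by
  obtain ⟨φ, hφ⟩ := h.smooth x hx
  have hnx := h.normal.2 x hx φ hφ
  obtain ⟨T, hT1, -, hTi, -⟩ := exists_frame (n x) (norm_normal_eq_one h.smooth h.normal hx)
  obtain ⟨ψ, hψc, -, hψ0, hψd, hψB⟩ := exists_graph h.isOpen hx hφ (T := T) (by rw [← hnx]; exact hTi)
  have hψF := eventually_mem_frontier_iff hψc.continuous hψB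
  have hc : ContinuousAt (fun y : E2 => (y, ψ y)) 0 := by
    have := hψc.continuous; exact Continuous.continuousAt (by fun_prop)
  have hc0 : ((0 : E2), ψ 0) = 0 := by rw [hψ0]; rfl
  -- Differentiating f along the graph, whose slope at the origin is zero, shows that all
  -- derivatives orthogonal to the normal vanish.
  have h1 : (fun y : E2 => f (x + T (y, ψ y))) =ᶠ[𝓝 0] fun _ => 0 := by
    rw [ContinuousAt, hc0] at hc
    filter_upwards [hc.eventually hψF] with y hy
    exact h0 _ (hy.2 rfl)
  have hψd' : HasFDerivAt ψ (0 : E2 →L[ℝ] ℝ) 0 := hψd ▸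
    (hψc.differentiable one_ne_zero 0).hasFDerivAt
  have h2 : HasFDerivAt (fun y : E2 => x + T (y, ψ y))
      ((T : E2 × ℝ →L[ℝ] E3).comp ((ContinuousLinearMap.id ℝ E2).prod 0)) 0 :=
    (T.hasFDerivAt.comp (0 : E2) ((hasFDerivAt_id (0 : E2)).prodMk hψd')).const_add x
  have hx0 : x + T (0, ψ 0) = x := by rw [hc0, map_zero, add_zero]
  have h3 : HasFDerivAt f (fderiv ℝ f x) (x + T (0, ψ 0)) := by
    rw [hx0]; exact (hf x).hasFDerivAt
  have h4 := (h3.comp (0 : E2) h2).fderiv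
  have h5 : fderiv ℝ (f ∘ fun y : E2 => x + T (y, ψ y)) 0 = 0 := by
    exact (Filter.EventuallyEq.fderiv_eq h1).trans (by simp)
  rw [h5] at h4
  have h6 : ∀ y : E2, fderiv ℝ f x (T (y, 0)) = 0 := fun y => by
    have := DFunLike.congr_fun h4 y
    simpa using this.symm
  have h7 : v = T ((T.symm v).1, 0) + (T.symm v).2 • n x := by
    rw [← hT1, ← map_smul, ← map_add]
    simp
  have h8 : (T.symm v).2 = inner ℝ v (n x) := by rw [← hTi, T.apply_symm_apply]
  conv_lhs => rw [h7]
  rw [map_add, map_smul, h6, h8, zero_add, smul_eq_mul, mul_comm]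

lemma spd_of_differentiable (h : IsBody B n) {f : E3 → ℝ} (hf : Differentiable ℝ f) (i : Fin 3)
    {x : E3} (hx : x ∈ closure B) : spd B i f x = fderiv ℝ f x (EuclideanSpace.single i 1) := by
  rw [spd, (hf x).fderivWithin (h.uniqueDiffOn x hx)]

/-- The extension of n has unit length only on ∂B, so |n|² - 1 vanishes there but its gradient may
not: the gradient is some multiple of n, depending on the extension. -/
lemma exists_sum_normal_mul_spd (h : IsBody B n) {x : E3} (hx : x ∈ frontier B) :
    ∃ c : ℝ, ∀ j, ∑ l, n x l * spd B j (fun y => n y l) x = c * n x j := by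
  have hnd : ∀ l, Differentiable ℝ fun y => n y l := fun l =>
    (h.contDiff_normal (k := 1) l).differentiable one_ne_zero
  have hfd : Differentiable ℝ fun y => (∑ l, n y l * n y l) - 1 :=
    (Differentiable.fun_sum fun l _ => (hnd l).mul (hnd l)).sub_const 1
  have h1 := h.fderiv_eq_of_eq_zero_on_frontier hfd
    (fun y hy => by rw [h.sum_normal_sq hy, sub_self]) hx
  have h2 : ∀ v, fderiv ℝ (fun y => (∑ l, n y l * n y l) - 1) x v
      = 2 * ∑ l, n x l * fderiv ℝ (fun y => n y l) x v := by
    intro v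
    have hnn : ∀ l, DifferentiableAt ℝ (fun y => n y l * n y l) x := fun l =>
      ((hnd l).mul (hnd l)) x
    rw [fderiv_sub_const, fderiv_fun_sum fun l _ => hnn l]
    simp only [sum_apply, Finset.mul_sum]
    refine Finset.sum_congr rfl fun l _ => ?_
    rw [fderiv_fun_mul (hnd l x) (hnd l x)]
    simp; ring
  refine ⟨fderiv ℝ (fun y => (∑ l, n y l * n y l) - 1) x (n x) / 2, fun j => ?_⟩
  have h3 := h1 (EuclideanSpace.single j 1)
  rw [h2] at h3
  simp only [h.spd_of_differentiable (hnd _) j (frontier_subset_closure hx)]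
  have h4 : inner ℝ (EuclideanSpace.single j (1 : ℝ)) (n x) = n x j := by
    simp [EuclideanSpace.inner_single_left]
  rw [h4] at h3
  linarith

/-- The divergence theorem on the closed surface `∂B`. -/
lemma integral_surface_divergence (h : IsBody B n) {W : Fin 3 → E3 → ℝ}
    (hW : ∀ j, ContDiffOn ℝ 2 (W j) (closure B)) :
    ∫ x, (∑ j, ssg B n j (W j) x - (∑ l, ssg B n l (fun y => n y l) x) * ∑ j, n x j * W j x)
      ∂(area B) = 0 := by
  have hn2 : ∀ l, ContDiffOn ℝ 2 (fun y => n y l) (closure B) := fun l =>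
    (h.contDiff_normal (k := 2) l).contDiffOn
  have hn1 : ∀ l, ContDiffOn ℝ 1 (fun y => n y l) (closure B) := fun l =>
    (h.contDiff_normal (k := 1) l).contDiffOn
  have hW1 : ∀ l, ContDiffOn ℝ 1 (W l) (closure B) := fun l => (hW l).of_le (by norm_num)
  -- On ∂B the integrand equals n_i A_{ij,j}. The divergence theorem turns its integral into the
  -- volume integral of A_{ij,ij}, which vanishes by antisymmetry.
  set A : Fin 3 → Fin 3 → E3 → ℝ := fun i j y => n y i * W j y - n y j * W i y with hA
  have hA2 : ∀ i j, ContDiffOn ℝ 2 (A i j) (closure B) := fun i j =>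
    ((hn2 i).mul (hW j)).sub ((hn2 j).mul (hW i))
  have hG1 : ∀ i j, ContDiffOn ℝ 1 (spd B j (A i j)) (closure B) := fun i j =>
    h.contDiffOn_spd (k := 1) (l := 2) (hA2 i j) le_rfl j
  have hA_anti : ∀ i j, A j i = fun y => - A i j y := fun i j => by funext y; simp [hA]
  have e1 : ∀ x ∈ frontier B, (∑ j, ssg B n j (W j) x
      - (∑ l, ssg B n l (fun y => n y l) x) * ∑ j, n x j * W j x)
      = ∑ i, ∑ j, spd B j (A i j) x * n x i := by
    intro x hx
    have hx' := frontier_subset_closure hx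
    obtain ⟨c, hc⟩ := h.exists_sum_normal_mul_spd hx
    have hs := h.sum_normal_sq hx
    have hAd : ∀ i j, spd B j (A i j) x = (n x i * spd B j (W j) x
        + spd B j (fun y => n y i) x * W j x) - (n x j * spd B j (W i) x
        + spd B j (fun y => n y j) x * W i x) := fun i j => by
      rw [hA, h.spd_sub ((hn1 i).mul (hW1 j)) ((hn1 j).mul (hW1 i)) j hx',
        h.spd_mul (hn1 i) (hW1 j) j hx', h.spd_mul (hn1 j) (hW1 i) j hx']
    simp only [hAd, ssg]
    have hc0 := hc 0
    have hc1 := hc 1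
    have hc2 := hc 2
    simp only [Fin.sum_univ_three] at hs hc0 hc1 hc2 ⊢
    simp only [Fin.isValue, Fin.reduceEq, if_true, if_false]
    -- The relations n_l n_{l,j} = c n_j are weighted by the tangential part of -W up to |n|² = 1,
    -- so the unknown c drops out.
    linear_combination (n x 0 * (n x 0 * W 0 x + n x 1 * W 1 x + n x 2 * W 2 x) - W 0 x) * hc0
      + (n x 1 * (n x 0 * W 0 x + n x 1 * W 1 x + n x 2 * W 2 x) - W 1 x) * hc1
      + (n x 2 * (n x 0 * W 0 x + n x 1 * W 1 x + n x 2 * W 2 x) - W 2 x) * hc2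
      + (c * (n x 0 * W 0 x + n x 1 * W 1 x + n x 2 * W 2 x)
        - (spd B 0 (W 0) x + spd B 1 (W 1) x + spd B 2 (W 2) x)) * hs
  have e2 : ∫ x, (∑ j, ssg B n j (W j) x
      - (∑ l, ssg B n l (fun y => n y l) x) * ∑ j, n x j * W j x) ∂(area B)
      = ∫ x, ∑ i, ∑ j, spd B j (A i j) x * n x i ∂(area B) :=
    setIntegral_congr_fun isClosed_frontier.measurableSet e1
  have hi : ∀ i j, Integrable (fun x => spd B j (A i j) x * n x i) (area B) := fun i j =>
    h.integrable_area (((hG1 i j).continuousOn.mul (hn1 i).continuousOn).mono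
      frontier_subset_closure)
  have e3 : ∫ x, ∑ i, ∑ j, spd B j (A i j) x * n x i ∂(area B)
      = ∑ i, ∑ j, ∫ x in B, spd B i (spd B j (A i j)) x := by
    rw [integral_finsetSum _ fun i _ => integrable_finsetSum _ fun j _ => hi i j]
    refine Finset.sum_congr rfl fun i _ => ?_
    rw [integral_finsetSum _ fun j _ => hi i j]
    exact Finset.sum_congr rfl fun j _ => (h.integral_spd (hG1 i j) i).symm
  have e4 : ∀ i j, ∫ x in B, spd B i (spd B j (A i j)) x
      = - ∫ x in B, spd B j (spd B i (A j i)) x := fun i j => by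
    rw [← integral_neg]
    refine setIntegral_congr_fun h.isOpen.measurableSet fun x hx => ?_
    have e : ∀ y ∈ closure B, spd B i (A j i) y = - spd B i (A i j) y := fun y hy => by
      rw [hA_anti i j, h.spd_neg _ _ hy]
    rw [spd_congr (g := fun y => - spd B i (A i j) y) e j (subset_closure hx),
      h.spd_neg _ _ (subset_closure hx), neg_neg, h.spd_comm (hA2 i j) i j (subset_closure hx)]
  -- Exchanging the two indices shows that the sum is its own negative.
  have e5 : ∑ i, ∑ j, ∫ x in B, spd B i (spd B j (A i j)) x
      = - ∑ i, ∑ j, ∫ x in B, spd B i (spd B j (A i j)) x := by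
    conv_lhs => rw [Finset.sum_comm]
    simp only [← Finset.sum_neg_distrib]
    exact Finset.sum_congr rfl fun i _ => Finset.sum_congr rfl fun j _ => e4 j i
  rw [e2, e3]
  linarith

/-- Green's identity of the second-gradient theory. -/
lemma integral_green (h : IsBody B n) {τ : Fin 3 → E3 → ℝ} {m : Fin 3 → Fin 3 → E3 → ℝ}
    {w : E3 → ℝ} (hτ : ∀ j, ContDiffOn ℝ 1 (τ j) (closure B))
    (hm : ∀ k j, ContDiffOn ℝ 2 (m k j) (closure B)) (hw : ContDiffOn ℝ 2 w (closure B)) :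
    ∫ x, ((∑ j, (τ j x - ∑ k, spd B k (m k j) x) * n x j
          - ∑ j, ∑ k, ssg B n j (fun y => m k j y * n y k) x
          + (∑ l, ssg B n l (fun y => n y l) x) * ∑ j, ∑ k, m k j x * n x k * n x j) * w x
        + (∑ j, ∑ k, m k j x * n x k * n x j) * ∑ i, n x i * spd B i w x) ∂(area B)
      = ∫ x in B, (∑ j, τ j x * spd B j w x + ∑ j, ∑ k, m k j x * spd B j (spd B k w) x
        + (∑ j, spd B j (τ j) x - ∑ j, ∑ k, spd B j (spd B k (m k j)) x) * w x) := by
  have hn2 : ∀ l, ContDiffOn ℝ 2 (fun y => n y l) (closure B) := fun l =>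
    (h.contDiff_normal (k := 2) l).contDiffOn
  have hn1 : ∀ l, ContDiffOn ℝ 1 (fun y => n y l) (closure B) := fun l =>
    (h.contDiff_normal (k := 1) l).contDiffOn
  have hm1 : ∀ k j, ContDiffOn ℝ 1 (m k j) (closure B) := fun k j => (hm k j).of_le (by norm_num)
  have hw1 : ContDiffOn ℝ 1 w (closure B) := hw.of_le (by norm_num)
  have hsw : ∀ j, ContDiffOn ℝ 1 (spd B j w) (closure B) := fun j =>
    h.contDiffOn_spd (k := 1) (l := 2) hw le_rfl j
  have hsm : ∀ i k j, ContDiffOn ℝ 1 (spd B i (m k j)) (closure B) := fun i k j =>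
    h.contDiffOn_spd (k := 1) (l := 2) (hm k j) le_rfl i
  have hc : ∀ {f : E3 → ℝ} (i : Fin 3), ContDiffOn ℝ 1 f (closure B) →
      ContinuousOn (spd B i f) (closure B) := fun i hf =>
    (h.contDiffOn_spd (k := 0) (l := 1) hf le_rfl i).continuousOn
  -- Splitting ∇w on ∂B into normal and tangential parts, the tangential part is integrated by parts
  -- on the closed surface with this field. That produces the surface gradient and the term with 𝒟_l
  -- n_l in the traction.
  set W : Fin 3 → E3 → ℝ := fun j y => (∑ k, m k j y * n y k) * w y with hWdef
  have hW : ∀ j, ContDiffOn ℝ 2 (W j) (closure B) := fun j =>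
    (ContDiffOn.sum fun k _ => (hm k j).mul (hn2 k)).mul hw
  have hmn : ∀ j, ContDiffOn ℝ 1 (fun y => ∑ k, m k j y * n y k) (closure B) := fun j =>
    ContDiffOn.sum fun k _ => (hm1 k j).mul (hn1 k)
  -- the divergences of two vector fields
  set F : Fin 3 → E3 → ℝ := fun j y => (τ j y - ∑ k, spd B k (m k j) y) * w y
    + ∑ i, m j i y * spd B i w y with hF
  have hF1 : ∀ j, ContDiffOn ℝ 1 (F j) (closure B) := fun j =>
    (((hτ j).sub (ContDiffOn.sum fun k _ => hsm k k j)).mul hw1).add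
      (ContDiffOn.sum fun i _ => (hm1 j i).mul (hsw i))
  have hsurf := h.integral_surface_divergence hW
  have hssc : ∀ {f : E3 → ℝ} (j : Fin 3), ContDiffOn ℝ 1 f (closure B) →
      ContinuousOn (ssg B n j f) (closure B) := fun j hf =>
    continuousOn_finsetSum _ fun i _ => (continuousOn_const.sub
      ((hn1 i).continuousOn.mul (hn1 j).continuousOn)).mul (hc i hf)
  have hi_surf : Integrable (fun x => ∑ j, ssg B n j (W j) x
      - (∑ l, ssg B n l (fun y => n y l) x) * ∑ j, n x j * W j x) (area B) := by
    refine h.integrable_area (ContinuousOn.mono ?_ frontier_subset_closure)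
    refine (continuousOn_finsetSum _ fun j _ => hssc j ((hW j).of_le (by norm_num))).sub ?_
    exact (continuousOn_finsetSum _ fun j _ => hssc j (hn1 j)).mul
      (continuousOn_finsetSum _ fun j _ => (hn1 j).continuousOn.mul (hW j).continuousOn)
  have hi_F : ∀ j, Integrable (fun x => F j x * n x j) (area B) := fun j =>
    h.integrable_area (((hF1 j).continuousOn.mul (hn1 j).continuousOn).mono
      frontier_subset_closure)
  have e1 : ∫ x, ∑ j, F j x * n x j ∂(area B)
      = ∫ x in B, ∑ j, spd B j (F j) x := by
    rw [integral_finsetSum _ fun j _ => hi_F j,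
      integral_finsetSum _ fun j _ => h.integrableOn (hc j (hF1 j))]
    exact Finset.sum_congr rfl fun j _ => (h.integral_spd (hF1 j) j).symm
  have e2 : ∫ x, (∑ j, F j x * n x j - (∑ j, ssg B n j (W j) x
      - (∑ l, ssg B n l (fun y => n y l) x) * ∑ j, n x j * W j x)) ∂(area B)
      = ∫ x in B, ∑ j, spd B j (F j) x := by
    rw [integral_sub (integrable_finsetSum _ fun j _ => hi_F j) hi_surf, hsurf, sub_zero, e1]
  refine Eq.trans (setIntegral_congr_fun isClosed_frontier.measurableSet fun x hx => ?_)
    (e2.trans (setIntegral_congr_fun h.isOpen.measurableSet fun x hx => ?_))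
  · have hx' := frontier_subset_closure hx
    have hWs : ∀ j, ssg B n j (W j) x = (∑ k, m k j x * n x k) * ssg B n j w x
        + (∑ k, ssg B n j (fun y => m k j y * n y k) x) * w x := by
      intro j
      have : ∀ i, spd B i (W j) x = (∑ k, m k j x * n x k) * spd B i w x
        + (∑ k, spd B i (fun y => m k j y * n y k) x) * w x := fun i => by
        rw [hWdef, h.spd_mul (hmn j) hw1 i hx', h.spd_sum (fun k => (hm1 k j).mul (hn1 k)) i hx']
      simp only [ssg, this, Fin.sum_univ_three]
      ring
    have hsw' : ∀ j, ssg B n j w x = spd B j w x - n x j * ∑ i, n x i * spd B i w x := by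
      intro j
      simp only [ssg, sub_mul, Finset.sum_sub_distrib, ite_mul, one_mul, zero_mul,
        Finset.sum_ite_eq', Finset.mem_univ, if_true, Finset.mul_sum]
      congr 1
      exact Finset.sum_congr rfl fun i _ => by ring
    simp only [hWs, hsw']
    simp only [hF, hWdef]
    simp only [Fin.sum_univ_three]
    ring
  · have hx' := subset_closure hx
    have hFd : ∀ j, spd B j (F j) x = ((τ j x - ∑ k, spd B k (m k j) x) * spd B j w x
        + (spd B j (τ j) x - ∑ k, spd B j (spd B k (m k j)) x) * w x)
        + ∑ i, (m j i x * spd B j (spd B i w) x + spd B j (m j i) x * spd B i w x) := by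
      intro j
      have a1 : ContDiffOn ℝ 1 (fun y => τ j y - ∑ k, spd B k (m k j) y) (closure B) :=
        (hτ j).sub (ContDiffOn.sum fun k _ => hsm k k j)
      have a2 : ContDiffOn ℝ 1 (fun y => ∑ i, m j i y * spd B i w y) (closure B) :=
        ContDiffOn.sum fun i _ => (hm1 j i).mul (hsw i)
      have a3 : spd B j (F j) x = spd B j (fun y => (τ j y - ∑ k, spd B k (m k j) y) * w y) x
          + spd B j (fun y => ∑ i, m j i y * spd B i w y) x := by
        rw [spd, hF, fderivWithin_fun_add (h.uniqueDiffOn x hx')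
          ((a1.mul hw1).differentiableOn one_ne_zero x hx')
          (a2.differentiableOn one_ne_zero x hx')]
        rfl
      rw [a3, h.spd_mul a1 hw1 j hx', h.spd_sub (hτ j) (ContDiffOn.sum fun k _ => hsm k k j) j hx',
        h.spd_sum (fun k => hsm k k j) j hx', h.spd_sum (fun i => (hm1 j i).mul (hsw i)) j hx']
      congr 1
      exact Finset.sum_congr rfl fun i _ => h.spd_mul (hm1 j i) (hsw i) j hx'
    have hsc : ∀ i j, spd B i (spd B j w) x = spd B j (spd B i w) x := fun i j =>
      h.spd_comm hw i j hx'
    have s1 := hsc 1 0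
    have s2 := hsc 2 0
    have s3 := hsc 2 1
    simp only [hFd]
    simp only [Fin.sum_univ_three, s1, s2, s3]
    ring

end IsBody

/-! ### Continuity of fields -/

/-- Continuity in time on `[0, ∞)`. -/
class TC (f : ℝ → ℝ) : Prop where
  out : ContinuousOn f (Ici 0)

/-- Joint continuity on `K × [0, ∞)`. -/
class JC (K : Set E3) (f : Field) : Prop where
  out : IsContOn K f

section Instances

variable {K : Set E3} {f g : Field}

lemma JC.tc (hf : JC K f) {x : E3} (hx : x ∈ K) : TC (f x) := by
  constructor
  have h1 : ContinuousOn (fun t : ℝ => (x, t)) (Ici 0) := by fun_prop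
  exact hf.out.comp h1 fun t ht => ⟨hx, ht⟩

lemma JC.slice (hf : JC K f) {t : ℝ} (ht : 0 ≤ t) : ContinuousOn (fun x => f x t) K := by
  have h1 : ContinuousOn (fun x : E3 => (x, t)) K := by fun_prop
  exact hf.out.comp h1 fun x hx => ⟨hx, ht⟩

lemma JC.mono {K' : Set E3} (hf : JC K f) (h : K' ⊆ K) : JC K' f :=
  ⟨hf.out.mono (prod_mono h le_rfl)⟩

lemma JC.congr (hf : JC K f) (h : ∀ x ∈ K, ∀ t ≥ 0, g x t = f x t) : JC K g :=
  ⟨hf.out.congr fun p hp => h p.1 hp.1 p.2 hp.2⟩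

lemma JC.of_space {a : E3 → ℝ} (ha : ContinuousOn a K) : JC K (fun x _ => a x) :=
  ⟨ha.comp continuousOn_fst fun _ hp => hp.1⟩

lemma JC.of_time {a : ℝ → ℝ} (ha : TC a) : JC K (fun _ => a) :=
  ⟨ha.out.comp continuousOn_snd fun _ hp => hp.2⟩

instance JC.add [hf : JC K f] [hg : JC K g] : JC K (fun x t => f x t + g x t) :=
  ⟨hf.out.add hg.out⟩

instance JC.sub [hf : JC K f] [hg : JC K g] : JC K (fun x t => f x t - g x t) :=
  ⟨hf.out.sub hg.out⟩

lemma JC.mul (hf : JC K f) (hg : JC K g) : JC K (fun x t => f x t * g x t) :=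
  ⟨hf.out.mul hg.out⟩

instance JC.const_mul {c : ℝ} [hf : JC K f] : JC K (fun x t => c * f x t) :=
  ⟨continuousOn_const.mul hf.out⟩

instance JC.sum {ι : Type*} [Fintype ι] {f : ι → Field} [hf : ∀ i, JC K (f i)] :
    JC K (fun x t => ∑ i, f i x t) :=
  ⟨continuousOn_finsetSum _ fun i _ => (hf i).out⟩

instance TC.add {f g : ℝ → ℝ} [hf : TC f] [hg : TC g] : TC (fun t => f t + g t) :=
  ⟨hf.out.add hg.out⟩

instance TC.sub {f g : ℝ → ℝ} [hf : TC f] [hg : TC g] : TC (fun t => f t - g t) :=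
  ⟨hf.out.sub hg.out⟩

instance TC.const_mul {c : ℝ} {f : ℝ → ℝ} [hf : TC f] : TC (fun t => c * f t) :=
  ⟨continuousOn_const.mul hf.out⟩

instance TC.sum {ι : Type*} [Fintype ι] {f : ι → ℝ → ℝ} [hf : ∀ i, TC (f i)] :
    TC (fun t => ∑ i, f i t) :=
  ⟨continuousOn_finsetSum _ fun i _ => (hf i).out⟩

end Instances

/-! ### Convolution -/

lemma conv_congr {f f' g g' : ℝ → ℝ} (hf : EqOn f f' (Ici 0)) (hg : EqOn g g' (Ici 0)) {t : ℝ}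
    (ht : 0 ≤ t) : (f ⊛ g) t = (f' ⊛ g') t := by
  refine intervalIntegral.integral_congr fun s hs => ?_
  rw [uIcc_of_le ht] at hs
  rw [hf hs.1, hg (sub_nonneg.2 hs.2)]

lemma conv_congr_right {f g g' : ℝ → ℝ} (hg : ∀ s, 0 ≤ s → g s = g' s) {t : ℝ}
    (ht : 0 ≤ t) : (f ⊛ g) t = (f ⊛ g') t :=
  conv_congr (fun _ _ => rfl) (fun s hs => hg s hs) ht

lemma conv_comm (f g : ℝ → ℝ) : f ⊛ g = g ⊛ f := by
  funext t
  have := intervalIntegral.integral_comp_sub_left (a := 0) (b := t) (fun s => f s * g (t - s)) t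
  simp only [sub_sub_cancel, sub_self, sub_zero] at this
  rw [conv, conv, ← this]
  exact intervalIntegral.integral_congr fun s _ => mul_comm _ _

/-- Freezing both fields at their initial values for negative times makes the kernel continuous
everywhere, so a parametric integral with moving endpoint is continuous; for t ≥ 0 the extension is
never seen. As an instance it gives continuity of nested convolutions by inference. -/
instance JC.conv {K : Set E3} {f g : Field} [hf : JC K f] [hg : JC K g] :
    JC K (fun x => f x ⊛ g x) := by
  constructor
  have hf' : Continuous fun q : K × ℝ => f q.1 (max q.2 0) := by
    have h1 : Continuous fun q : K × ℝ => ((q.1 : E3), max q.2 0) := by fun_prop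
    exact hf.out.comp_continuous h1 fun q => ⟨q.1.2, mem_Ici.2 (le_max_right _ _)⟩
  have hg' : Continuous fun q : K × ℝ => g q.1 (max q.2 0) := by
    have h1 : Continuous fun q : K × ℝ => ((q.1 : E3), max q.2 0) := by fun_prop
    exact hg.out.comp_continuous h1 fun q => ⟨q.1.2, mem_Ici.2 (le_max_right _ _)⟩
  have h2 : Continuous (Function.uncurry fun (q : K × ℝ) (s : ℝ) =>
      f q.1 (max s 0) * g q.1 (max (q.2 - s) 0)) := by
    have h3 : Continuous fun r : (K × ℝ) × ℝ => ((r.1.1, r.2) : K × ℝ) := by fun_prop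
    have h4 : Continuous fun r : (K × ℝ) × ℝ => ((r.1.1, r.1.2 - r.2) : K × ℝ) := by fun_prop
    exact (hf'.comp h3).mul (hg'.comp h4)
  have h5 := intervalIntegral.continuous_parametric_intervalIntegral_of_continuous
    (μ := volume) (a₀ := 0) h2 (s := fun q : K × ℝ => q.2) continuous_snd
  rw [IsContOn, continuousOn_iff_continuous_domRestrict]
  have h6 : Continuous fun p : (K ×ˢ Ici (0 : ℝ) : Set (E3 × ℝ)) =>
      ((⟨p.1.1, p.2.1⟩, p.1.2) : K × ℝ) := by fun_prop
  refine (h5.comp h6).congr fun p => ?_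
  have hp : 0 ≤ p.1.2 := p.2.2
  refine intervalIntegral.integral_congr fun s hs => ?_
  rw [uIcc_of_le hp] at hs
  rw [max_eq_left hs.1, max_eq_left (sub_nonneg.2 hs.2)]

instance TC.conv {f g : ℝ → ℝ} [hf : TC f] [hg : TC g] : TC (f ⊛ g) := by
  have h1 : JC (univ : Set E3) (fun _ => f) := JC.of_time hf
  have h2 : JC (univ : Set E3) (fun _ => g) := JC.of_time hg
  exact (JC.conv (f := fun _ => f) (g := fun _ => g)).tc (mem_univ 0)

/-- Both sides are integrals over the square of F cut off to r ≤ s, so Fubini applies. -/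
lemma intervalIntegral_swap_triangle {F : ℝ → ℝ → ℝ} (hF : Continuous fun p : ℝ × ℝ => F p.1 p.2)
    {t : ℝ} (ht : 0 ≤ t) :
    ∫ s in (0 : ℝ)..t, ∫ r in (0 : ℝ)..s, F r s = ∫ r in (0 : ℝ)..t, ∫ s in r..t, F r s := by
  have e1 : ∀ s ∈ Ioc 0 t, ∫ r in (0 : ℝ)..s, F r s
      = ∫ r in Ioc 0 t, (Iic s).indicator (fun r => F r s) r := fun s hs => by
    rw [intervalIntegral.integral_of_le hs.1.le, setIntegral_indicator measurableSet_Iic]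
    congr 2
    ext r
    exact ⟨fun h => ⟨⟨h.1, h.2.trans hs.2⟩, h.2⟩, fun h => ⟨h.1.1, h.2⟩⟩
  have e2 : ∀ r ∈ Ioc 0 t, ∫ s in r..t, F r s
      = ∫ s in Ioc 0 t, (Ici r).indicator (fun s => F r s) s := fun r hr => by
    rw [intervalIntegral.integral_of_le hr.2, ← integral_Icc_eq_integral_Ioc,
      setIntegral_indicator measurableSet_Ici]
    congr 2
    ext s
    exact ⟨fun h => ⟨⟨hr.1.trans_le h.1, h.2⟩, h.1⟩, fun h => ⟨h.2, h.1.2⟩⟩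
  rw [intervalIntegral.integral_of_le ht, intervalIntegral.integral_of_le ht,
    setIntegral_congr_fun measurableSet_Ioc e1, setIntegral_congr_fun measurableSet_Ioc e2]
  have hm : MeasurableSet {p : ℝ × ℝ | p.2 ≤ p.1} := measurableSet_le measurable_snd measurable_fst
  have hint : Integrable (Function.uncurry fun s r => (Iic s).indicator (fun r => F r s) r)
      ((volume.restrict (Ioc 0 t)).prod (volume.restrict (Ioc 0 t))) := by
    have h1 : Continuous fun p : ℝ × ℝ => F p.2 p.1 := hF.comp continuous_swap
    have h2 : IntegrableOn (fun p : ℝ × ℝ => F p.2 p.1) (Ioc 0 t ×ˢ Ioc 0 t) :=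
      (h1.continuousOn.integrableOn_compact (isCompact_Icc.prod isCompact_Icc)).mono_set
        (prod_mono Ioc_subset_Icc_self Ioc_subset_Icc_self)
    rw [Measure.prod_restrict]
    exact h2.integrable.indicator hm
  rw [integral_integral_swap hint]
  refine setIntegral_congr_fun measurableSet_Ioc fun r _ => ?_
  refine setIntegral_congr_fun measurableSet_Ioc fun s _ => ?_
  by_cases h : r ≤ s <;> simp [indicator, h]

lemma conv_assoc_of_continuous {f g h : ℝ → ℝ} (hf : Continuous f) (hg : Continuous g)
    (hh : Continuous h) {t : ℝ} (ht : 0 ≤ t) : ((f ⊛ g) ⊛ h) t = (f ⊛ (g ⊛ h)) t := by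
  have e1 : ((f ⊛ g) ⊛ h) t
      = ∫ s in (0 : ℝ)..t, ∫ r in (0 : ℝ)..s, f r * g (s - r) * h (t - s) := by
    refine intervalIntegral.integral_congr fun s _ => ?_
    rw [intervalIntegral.integral_mul_const]
    rfl
  have e2 : (f ⊛ (g ⊛ h)) t
      = ∫ r in (0 : ℝ)..t, ∫ s in r..t, f r * g (s - r) * h (t - s) := by
    refine intervalIntegral.integral_congr fun r _ => ?_
    have e3 := intervalIntegral.integral_comp_sub_right (a := r) (b := t)
      (fun q => f r * (g q * h (t - r - q))) r
    beta_reduce at e3 ⊢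
    rw [sub_self] at e3
    rw [conv, ← intervalIntegral.integral_const_mul, ← e3]
    refine intervalIntegral.integral_congr fun s _ => ?_
    rw [show t - r - (s - r) = t - s by ring]
    ring
  rw [e1, e2, intervalIntegral_swap_triangle _ ht]
  fun_prop

/-- The condition `hμ` says that μ lives on K. It covers both volume on B with K its closure and
area with K the frontier. -/
lemma integrable_conv_kernel {μ : Measure E3} [IsFiniteMeasure μ] {K : Set E3} (hK : IsCompact K)
    (hμ : μ.restrict K = μ) {f g : Field} (hf : JC K f) (hg : JC K g) {t : ℝ} :
    Integrable (Function.uncurry fun x s => f x s * g x (t - s))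
      (μ.prod (volume.restrict (Ioc 0 t))) := by
  have h1 : ContinuousOn (fun p : E3 × ℝ => f p.1 p.2 * g p.1 (t - p.2)) (K ×ˢ Icc 0 t) := by
    refine (hf.out.mono (prod_mono le_rfl Icc_subset_Ici_self)).mul ?_
    have h2 : ContinuousOn (fun p : E3 × ℝ => (p.1, t - p.2)) (K ×ˢ Icc 0 t) := by fun_prop
    exact hg.out.comp h2 fun p hp => ⟨hp.1, sub_nonneg.2 hp.2.2⟩
  have h3 : IntegrableOn (fun p : E3 × ℝ => f p.1 p.2 * g p.1 (t - p.2)) (K ×ˢ Ioc 0 t)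
      (μ.prod volume) :=
    (h1.integrableOn_compact (hK.prod isCompact_Icc)).mono_set
      (prod_mono le_rfl Ioc_subset_Icc_self)
  rw [IntegrableOn, ← Measure.prod_restrict, hμ] at h3
  exact h3

/-- Convolution in time commutes with integration in space. -/
lemma integral_conv_eq {μ : Measure E3} [IsFiniteMeasure μ] {K : Set E3} (hK : IsCompact K)
    (hμ : μ.restrict K = μ) {f g : Field} (hf : JC K f) (hg : JC K g) {t : ℝ} (ht : 0 ≤ t) :
    ∫ x, (f x ⊛ g x) t ∂μ = ∫ s in (0 : ℝ)..t, ∫ x, f x s * g x (t - s) ∂μ := by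
  rw [intervalIntegral.integral_of_le ht]
  simp only [conv, intervalIntegral.integral_of_le ht]
  exact integral_integral_swap (integrable_conv_kernel hK hμ hf hg)

lemma conv_integral {μ : Measure E3} [IsFiniteMeasure μ] {K : Set E3} (hK : IsCompact K)
    (hμ : μ.restrict K = μ) {k : ℝ → ℝ} (hk : TC k) {f : Field} (hf : JC K f) {t : ℝ}
    (ht : 0 ≤ t) : (k ⊛ fun s => ∫ x, f x s ∂μ) t = ∫ x, (k ⊛ f x) t ∂μ := by
  rw [integral_conv_eq hK hμ (JC.of_time hk) hf ht]
  refine intervalIntegral.integral_congr fun s _ => ?_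
  rw [← integral_const_mul]

/-! ### The convolution algebra -/

/-- Continuous functions on `[0, ∞)`. -/
def TimeAlg : Type := C(NNReal, ℝ)

namespace TimeAlg

instance : AddCommGroup TimeAlg := inferInstanceAs (AddCommGroup C(NNReal, ℝ))
instance : Module ℝ TimeAlg := inferInstanceAs (Module ℝ C(NNReal, ℝ))

/-- The values of a function, extended to negative times by a constant. -/
def val (a : TimeAlg) (t : ℝ) : ℝ := (show C(NNReal, ℝ) from a) t.toNNReal

lemma continuous_val (a : TimeAlg) : Continuous a.val :=
  (ContinuousMap.continuous _).comp continuous_real_toNNReal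

instance tc_val (a : TimeAlg) : TC a.val := ⟨a.continuous_val.continuousOn⟩

@[ext] lemma ext {a b : TimeAlg} (h : ∀ t, 0 ≤ t → a.val t = b.val t) : a = b := by
  refine ContinuousMap.ext fun t => ?_
  have := h t t.2
  simpa [val] using this

open Classical in
/-- The restriction of a continuous function to `[0, ∞)`. -/
def of (f : ℝ → ℝ) : TimeAlg :=
  if hf : TC f then
    (⟨fun t => f t, hf.out.comp_continuous NNReal.continuous_coe fun t => t.2⟩ : C(NNReal, ℝ))
  -- A default value makes the map total, so continuity need not be carried as an argument.
  else 0

lemma val_of (f : ℝ → ℝ) [TC f] {t : ℝ} (ht : 0 ≤ t) : (of f).val t = f t := by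
  have h : of f = (⟨fun t => f t, (‹TC f›).out.comp_continuous NNReal.continuous_coe
      fun t => t.2⟩ : C(NNReal, ℝ)) := dif_pos ‹TC f›
  rw [h]
  change f t.toNNReal = f t
  rw [Real.coe_toNNReal t ht]

lemma val_add (a b : TimeAlg) (t : ℝ) : (a + b).val t = a.val t + b.val t := rfl
lemma val_smul (c : ℝ) (a : TimeAlg) (t : ℝ) : (c • a).val t = c * a.val t := rfl
lemma val_zero (t : ℝ) : (0 : TimeAlg).val t = 0 := rfl

/-- The separate type keeps this product apart from pointwise multiplication of continuous maps. -/
instance : Mul TimeAlg := ⟨fun a b => of (a.val ⊛ b.val)⟩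

lemma val_mul (a b : TimeAlg) {t : ℝ} (ht : 0 ≤ t) : (a * b).val t = (a.val ⊛ b.val) t :=
  val_of _ ht

protected lemma mul_comm (a b : TimeAlg) : a * b = b * a := by
  ext t ht
  rw [val_mul _ _ ht, val_mul _ _ ht, conv_comm]

protected lemma add_mul (a b c : TimeAlg) : (a + b) * c = a * c + b * c := by
  ext t ht
  rw [val_add, val_mul _ _ ht, val_mul _ _ ht, val_mul _ _ ht]
  have h1 := a.continuous_val
  have h2 := b.continuous_val
  have h3 := c.continuous_val
  rw [conv, conv, conv, ← intervalIntegral.integral_add]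
  · exact intervalIntegral.integral_congr fun s _ => add_mul _ _ _
  · exact Continuous.intervalIntegrable (by fun_prop) _ _
  · exact Continuous.intervalIntegrable (by fun_prop) _ _

protected lemma smul_mul (r : ℝ) (a b : TimeAlg) : (r • a) * b = r • (a * b) := by
  ext t ht
  rw [val_smul, val_mul _ _ ht, val_mul _ _ ht, conv, conv, ← intervalIntegral.integral_const_mul]
  exact intervalIntegral.integral_congr fun s _ => mul_assoc _ _ _

protected lemma mul_assoc (a b c : TimeAlg) : a * b * c = a * (b * c) := by
  ext t ht
  rw [val_mul _ _ ht, val_mul _ _ ht,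
    conv_congr (f' := a.val ⊛ b.val) (fun s hs => val_mul a b hs) (fun _ _ => rfl) ht,
    conv_congr_right (g' := b.val ⊛ c.val) (fun s hs => val_mul b c hs) ht,
    conv_assoc_of_continuous a.continuous_val b.continuous_val c.continuous_val ht]

/-- The unit of convolution would be a Dirac mass, which is no function. It is adjoined formally in
`ConvRing`, so that material constants are ring elements and `ring` applies. -/
instance : NonUnitalCommRing TimeAlg :=
  { (inferInstance : AddCommGroup TimeAlg), (inferInstance : Mul TimeAlg) with
    mul_assoc := TimeAlg.mul_assoc
    mul_comm := TimeAlg.mul_comm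
    zero_mul := fun a => by
      have := TimeAlg.smul_mul 0 0 a
      rwa [zero_smul, zero_smul] at this
    mul_zero := fun a => by
      have := TimeAlg.smul_mul 0 0 a
      rw [zero_smul, zero_smul] at this
      rw [TimeAlg.mul_comm, this]
    left_distrib := fun a b c => by
      rw [TimeAlg.mul_comm, TimeAlg.add_mul, TimeAlg.mul_comm b, TimeAlg.mul_comm c]
    right_distrib := TimeAlg.add_mul }

instance : IsScalarTower ℝ TimeAlg TimeAlg := ⟨TimeAlg.smul_mul⟩

instance : SMulCommClass ℝ TimeAlg TimeAlg := ⟨fun r a b => by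
  change r • (a * b) = a * (r • b)
  rw [mul_comm a (r • b), TimeAlg.smul_mul, mul_comm]⟩

end TimeAlg

/-- The commutative ring generated by the continuous functions of time under convolution. -/
abbrev ConvRing : Type := Unitization ℝ TimeAlg

/-- A continuous function of time as an element of the convolution ring. -/
def toR (f : ℝ → ℝ) : ConvRing := (TimeAlg.of f : ConvRing)

/-- Continuity need not be assumed: agreement for t ≥ 0 transfers it, and if it fails for one
function, both have the default value 0. -/
lemma toR_congr {f g : ℝ → ℝ} (h : ∀ t, 0 ≤ t → f t = g t) : toR f = toR g := by
  suffices TimeAlg.of f = TimeAlg.of g by rw [toR, toR, this]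
  by_cases hf : TC f
  · have hg : TC g := ⟨hf.out.congr fun t ht => (h t ht).symm⟩
    ext t ht
    rw [TimeAlg.val_of f ht, TimeAlg.val_of g ht, h t ht]
  · have hg : ¬ TC g := fun hg => hf ⟨hg.out.congr h⟩
    have h1 : TimeAlg.of f = 0 := dif_neg hf
    have h2 : TimeAlg.of g = 0 := dif_neg hg
    rw [h1, h2]

section toR

variable {f g : ℝ → ℝ} [TC f] [TC g]

lemma eq_of_toR_eq (h : toR f = toR g) {t : ℝ} (ht : 0 ≤ t) : f t = g t := by
  have h1 : TimeAlg.of f = TimeAlg.of g := Unitization.inr_injective h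
  rw [← TimeAlg.val_of f ht, h1, TimeAlg.val_of g ht]

lemma toR_conv : toR (f ⊛ g) = toR f * toR g := by
  rw [toR, toR, toR, ← Unitization.inr_mul]
  congr 1
  ext t ht
  rw [TimeAlg.val_of _ ht, TimeAlg.val_mul _ _ ht]
  exact conv_congr (fun s hs => (TimeAlg.val_of f hs).symm) (fun s hs => (TimeAlg.val_of g hs).symm) ht

lemma toR_add : toR (fun t => f t + g t) = toR f + toR g := by
  rw [toR, toR, toR, ← Unitization.inr_add]
  congr 1
  ext t ht
  rw [TimeAlg.val_add, TimeAlg.val_of f ht, TimeAlg.val_of g ht, TimeAlg.val_of _ ht]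

lemma toR_const_mul {c : ℝ} : toR (fun t => c * f t) = c • toR f := by
  rw [toR, toR, ← Unitization.inr_smul]
  congr 1
  ext t ht
  rw [TimeAlg.val_smul, TimeAlg.val_of f ht, TimeAlg.val_of _ ht]

lemma toR_sub : toR (fun t => f t - g t) = toR f - toR g := by
  rw [eq_sub_iff_add_eq, ← toR_add]
  exact toR_congr fun t _ => by ring

lemma toR_zero : toR (fun _ => 0) = 0 := by
  have : TC fun _ => (0 : ℝ) := ⟨continuousOn_const⟩
  rw [toR, ← Unitization.inr_zero ℝ]
  congr 1
  ext t ht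
  rw [TimeAlg.val_zero, TimeAlg.val_of _ ht]

end toR

lemma toR_sum {ι : Type*} [Fintype ι] {f : ι → ℝ → ℝ} [hf : ∀ i, TC (f i)] :
    toR (fun t => ∑ i, f i t) = ∑ i, toR (f i) := by
  classical
  have key : ∀ (s : Finset ι) (h : TC fun t => ∑ i ∈ s, f i t),
      toR (fun t => ∑ i ∈ s, f i t) = ∑ i ∈ s, toR (f i) := by
    intro s
    induction s using Finset.induction_on with
    | empty => intro h; simpa using toR_zero
    | insert a s ha ih =>
      intro h
      have h1 : TC fun t => ∑ i ∈ s, f i t := ⟨continuousOn_finsetSum _ fun i _ => (hf i).out⟩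
      rw [Finset.sum_insert ha, ← ih h1, ← toR_add]
      exact toR_congr fun t _ => Finset.sum_insert ha
  exact key Finset.univ inferInstance

/-! ### The algebraic form of reciprocity -/

/-- The index set of second-order tensors. -/
abbrev I2 : Type := Fin 3 × Fin 3

/-- The index set of third-order tensors. -/
abbrev I3 : Type := Fin 3 × Fin 3 × Fin 3

/-- Material constants and time kernels in a commutative ring. -/
structure AbstractMaterial (R : Type*) where
  (χ ζ ξ l ρ T₀ invT c : R)
  (a11 a17 a77 : I2 → I2 → R)
  (a22 : I3 → I3 → R)
  (a23 : I3 → Fin 3 → R)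
  (a33 k : Fin 3 → Fin 3 → R)
  (a14 a47 : I2 → R)

/-- The symmetry relations of the constants. -/
structure AbstractMaterial.IsSymm {R : Type*} [CommRing R] (m : AbstractMaterial R) : Prop where
  invT : m.invT * m.T₀ = 1
  a11 : ∀ p q, m.a11 p q = m.a11 q p
  a77 : ∀ p q, m.a77 p q = m.a77 q p
  a22 : ∀ p q, m.a22 p q = m.a22 q p
  a33 : ∀ p q, m.a33 p q = m.a33 q p
  k : ∀ p q, m.k p q = m.k q p

/-- The values of a state and of its data in a commutative ring; `D`, `Z` are the divergences of
the stress and of the heat flux. -/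
structure AbstractState (R : Type*) where
  (u F D b el σ q : Fin 3 → R)
  (e V τ Q L M : I2 → R)
  (κ μ : I3 → R)
  (θ φ η g Z H r : R)

/-- The time-convolved balance and constitutive equations. -/
structure AbstractState.Solves {R : Type*} [CommRing R] (s : AbstractState R)
    (m : AbstractMaterial R) : Prop where
  τ : ∀ p, m.ζ * s.τ p = m.ζ * (∑ q, m.a11 p q * s.e q + ∑ q, m.a17 p q * s.V q)
    + m.a14 p * s.θ - s.L p
  Q : ∀ p, - (m.ζ * s.Q p) = m.ζ * (∑ q, m.a17 q p * s.e q + ∑ q, m.a77 p q * s.V q)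
    + m.a47 p * s.θ - s.M p
  η : - (m.χ * (m.ρ * s.η)) = m.χ * (∑ p, m.a14 p * s.e p + ∑ p, m.a47 p * s.V p)
    + m.c * s.θ - s.r
  μ : ∀ p, s.μ p = ∑ q, m.a22 p q * s.κ q + ∑ i, m.a23 p i * s.el i
  σ : ∀ i, - s.σ i = ∑ p, m.a23 p i * s.κ p + ∑ j, m.a33 i j * s.el j
  q : ∀ i, - (m.invT * s.q i) = ∑ j, m.k i j * s.b j
  motion : ∀ i, m.ξ * s.D i = m.ρ * s.u i - s.F i
  energy : m.ρ * m.T₀ * s.η = s.H - m.l * s.Z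

/-- The density of the functional. -/
def AbstractState.form {R : Type*} [CommRing R] (m : AbstractMaterial R)
    (s s' : AbstractState R) : R :=
  m.χ * m.ζ * (∑ i, s.F i * s'.u i - m.ξ * s.g * s'.φ)
  + m.χ * m.ξ * (m.ζ * (∑ p, s.τ p * s'.e p + ∑ p, s.μ p * s'.κ p + ∑ i, s.D i * s'.u i
        - ∑ i, s.σ i * s'.el i - ∑ p, s.Q p * s'.V p + s.g * s'.φ)
      + m.invT * m.l * (∑ i, s.q i * s'.b i + s.Z * s'.θ))
  + m.ξ * (m.χ * ∑ p, (s.L p * s'.e p + s.M p * s'.V p) + s.r * s'.θ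
      - m.χ * (m.invT * s.H) * s'.θ)

lemma sum_bilin_swap {R ι κ : Type*} [CommRing R] [Fintype ι] [Fintype κ] (a : ι → κ → R)
    (x : κ → R) (y : ι → R) :
    ∑ p, (∑ q, a p q * x q) * y p = ∑ q, (∑ p, a p q * y p) * x q := by
  simp only [Finset.sum_mul]
  rw [Finset.sum_comm]
  exact Finset.sum_congr rfl fun _ _ => Finset.sum_congr rfl fun _ _ => by ring

lemma sum_bilin_symm {R ι : Type*} [CommRing R] [Fintype ι] {a : ι → ι → R}
    (ha : ∀ p q, a p q = a q p) (x y : ι → R) :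
    ∑ p, (∑ q, a p q * x q) * y p = ∑ p, (∑ q, a p q * y q) * x p := by
  rw [sum_bilin_swap]
  exact Finset.sum_congr rfl fun _ _ => by simp only [ha]

section Reciprocity

variable {R : Type*} [CommRing R] {m : AbstractMaterial R} {s s' : AbstractState R}

/-- Everything but the kinematic and thermal variables cancels. The relation ξ D = ρ u - F removes
F, the two terms with g are opposite, energy balance turns invT (l Z - H) into -ρ η, and the entropy
relation eliminates η together with r. The convolved laws for τ and Q remove L and M. -/
lemma AbstractState.form_eq (hm : m.IsSymm) (hs : s.Solves m) :
    AbstractState.form m s s' = m.χ * m.ζ * m.ρ * ∑ i, s.u i * s'.u i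
      + m.ξ * m.χ * m.ζ * (∑ p, (∑ q, m.a11 p q * s.e q) * s'.e p
        + (∑ p, (∑ q, m.a17 p q * s.V q) * s'.e p + ∑ p, (∑ q, m.a17 q p * s.e q) * s'.V p)
        + ∑ p, (∑ q, m.a77 p q * s.V q) * s'.V p
        + ∑ p, (∑ q, m.a22 p q * s.κ q) * s'.κ p
        + (∑ p, (∑ i, m.a23 p i * s.el i) * s'.κ p + ∑ i, (∑ p, m.a23 p i * s.κ p) * s'.el i)
        + ∑ i, (∑ j, m.a33 i j * s.el j) * s'.el i)
      + m.ξ * m.χ * (s.θ * (∑ p, m.a14 p * s'.e p + ∑ p, m.a47 p * s'.V p)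
        + s'.θ * (∑ p, m.a14 p * s.e p + ∑ p, m.a47 p * s.V p))
      + m.ξ * m.c * s.θ * s'.θ
      - m.χ * m.ξ * m.l * ∑ i, (∑ j, m.k i j * s.b j) * s'.b i := by
  have h1 : m.ζ * ∑ p, s.τ p * s'.e p = m.ζ * (∑ p, (∑ q, m.a11 p q * s.e q) * s'.e p
      + ∑ p, (∑ q, m.a17 p q * s.V q) * s'.e p) + s.θ * (∑ p, m.a14 p * s'.e p)
      - ∑ p, s.L p * s'.e p := by
    rw [← Finset.sum_add_distrib]
    simp only [Finset.mul_sum]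
    rw [← Finset.sum_add_distrib, ← Finset.sum_sub_distrib]
    refine Finset.sum_congr rfl fun p _ => ?_
    linear_combination s'.e p * hs.τ p
  have h2 : m.ζ * ∑ p, s.Q p * s'.V p = - (m.ζ * (∑ p, (∑ q, m.a17 q p * s.e q) * s'.V p
      + ∑ p, (∑ q, m.a77 p q * s.V q) * s'.V p) + s.θ * (∑ p, m.a47 p * s'.V p)
      - ∑ p, s.M p * s'.V p) := by
    rw [← Finset.sum_add_distrib]
    simp only [Finset.mul_sum]
    rw [← Finset.sum_add_distrib, ← Finset.sum_sub_distrib, ← Finset.sum_neg_distrib]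
    refine Finset.sum_congr rfl fun p _ => ?_
    linear_combination -s'.V p * hs.Q p
  have h3 : ∑ p, s.μ p * s'.κ p = ∑ p, (∑ q, m.a22 p q * s.κ q) * s'.κ p
      + ∑ p, (∑ i, m.a23 p i * s.el i) * s'.κ p := by
    rw [← Finset.sum_add_distrib]
    refine Finset.sum_congr rfl fun p _ => ?_
    linear_combination s'.κ p * hs.μ p
  have h4 : ∑ i, s.σ i * s'.el i = - (∑ i, (∑ p, m.a23 p i * s.κ p) * s'.el i
      + ∑ i, (∑ j, m.a33 i j * s.el j) * s'.el i) := by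
    rw [← Finset.sum_add_distrib, ← Finset.sum_neg_distrib]
    refine Finset.sum_congr rfl fun p _ => ?_
    linear_combination -s'.el p * hs.σ p
  have h5 : m.invT * ∑ i, s.q i * s'.b i = - ∑ i, (∑ j, m.k i j * s.b j) * s'.b i := by
    rw [← Finset.sum_neg_distrib, Finset.mul_sum]
    refine Finset.sum_congr rfl fun p _ => ?_
    linear_combination -s'.b p * hs.q p
  have h6 : m.ξ * ∑ i, s.D i * s'.u i = m.ρ * ∑ i, s.u i * s'.u i - ∑ i, s.F i * s'.u i := by
    simp only [Finset.mul_sum]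
    rw [← Finset.sum_sub_distrib]
    refine Finset.sum_congr rfl fun p _ => ?_
    linear_combination s'.u p * hs.motion p
  have h7 := hs.η
  have h8 : m.invT * m.l * s.Z = m.invT * s.H - m.ρ * s.η := by
    linear_combination m.invT * hs.energy - m.ρ * s.η * hm.invT
  rw [AbstractState.form, Finset.sum_add_distrib]
  linear_combination m.χ * m.ξ * h1 - m.χ * m.ξ * h2 + m.χ * m.ξ * m.ζ * h3
    - m.χ * m.ξ * m.ζ * h4 + m.χ * m.ξ * m.l * h5 + m.χ * m.ζ * h6 + m.ξ * s'.θ * h7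
    + m.χ * m.ξ * s'.θ * h8

/-- The diagonal blocks are symmetric by the tensor symmetries. Each coupling block, a17 or a23,
comes with its transpose, and the exchange of states swaps the two. -/
lemma AbstractState.form_symm (hm : m.IsSymm) (hs : s.Solves m) (hs' : s'.Solves m) :
    AbstractState.form m s s' = AbstractState.form m s' s := by
  rw [form_eq hm hs, form_eq hm hs', sum_bilin_symm hm.a11 s.e, sum_bilin_symm hm.a77 s.V,
    sum_bilin_symm hm.a22 s.κ, sum_bilin_symm hm.a33 s.el, sum_bilin_symm hm.k s.b,
    sum_bilin_swap m.a17 s.V, sum_bilin_swap m.a17 s'.V, sum_bilin_swap m.a23 s.el,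
    sum_bilin_swap m.a23 s'.el]
  simp only [mul_comm (s.u _) (s'.u _)]
  ring

end Reciprocity

/-! ### Regularity of fields -/

/-- Fields that are continuous together with their first partial derivatives. -/
structure C1Field (B : Set E3) (f : Field) : Prop where
  contDiffOn : ∀ t, 0 ≤ t → ContDiffOn ℝ 1 (fun x => f x t) (closure B)
  jc : JC (closure B) f
  jc_pd : ∀ i, JC (closure B) (pd B i f)

/-- Fields that are continuous together with their first and second partial derivatives. -/
structure C2Field (B : Set E3) (f : Field) : Prop where
  contDiffOn : ∀ t, 0 ≤ t → ContDiffOn ℝ 2 (fun x => f x t) (closure B)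
  jc : JC (closure B) f
  jc_pd : ∀ i, JC (closure B) (pd B i f)
  jc_pd_pd : ∀ i j, JC (closure B) (pd B i (pd B j f))

lemma C2Field.c1 {B : Set E3} {f : Field} (h : C2Field B f) : C1Field B f :=
  ⟨fun t ht => (h.contDiffOn t ht).of_le one_le_two, h.jc, h.jc_pd⟩

section OfClass

variable {B : Set E3} {M N : ℕ} {f : Field}

lemma IsOfClass.contDiffOn_time (h : IsOfClass B M N f) {x : E3} (hx : x ∈ closure B) :
    ContDiffOn ℝ N (f x) (Ici 0) := h.1 x hx

lemma IsOfClass.contDiffOn (h : IsOfClass B M N f) {t : ℝ} (ht : 0 ≤ t) :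
    ContDiffOn ℝ M (fun x => f x t) (closure B) := by
  have := (h.2 0 (Nat.zero_le _)).1 t ht
  simpa using this

lemma IsOfClass.jc (h : IsOfClass B M N f) : JC (closure B) f := by
  constructor
  have h1 := (h.2 0 (Nat.zero_le _)).2 0 (Nat.zero_le _) (Nat.zero_le _)
  have h2 : Continuous fun L : ContinuousMultilinearMap ℝ (fun _ : Fin 0 => E3) ℝ => L 0 := by
    fun_prop
  refine (h2.comp_continuousOn h1).congr fun p _ => ?_
  simp [iteratedFDerivWithin_zero_apply]

lemma IsOfClass.jc_pd {n : E3 → E3} (hB : IsBody B n) (h : IsOfClass B M N f) (hM : 1 ≤ M)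
    (i : Fin 3) : JC (closure B) (pd B i f) := by
  constructor
  have h1 := (h.2 0 (Nat.zero_le _)).2 1 hM (by omega)
  have h2 : Continuous fun L : ContinuousMultilinearMap ℝ (fun _ : Fin 1 => E3) ℝ =>
      L (fun _ => EuclideanSpace.single i 1) := by fun_prop
  refine (h2.comp_continuousOn h1).congr fun p hp => ?_
  simp only [Function.comp_apply, iteratedDerivWithin_zero]
  rw [iteratedFDerivWithin_one_apply (hB.uniqueDiffOn p.1 hp.1)]
  rfl

/-- Evaluating the second iterated derivative on (e_i, e_j) gives the mixed partial with i
outermost, so the joint continuity provided by the class passes to it. -/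
lemma IsOfClass.jc_pd_pd {n : E3 → E3} (hB : IsBody B n) (h : IsOfClass B M N f) (hM : 2 ≤ M)
    (i j : Fin 3) : JC (closure B) (pd B i (pd B j f)) := by
  constructor
  have h1 := (h.2 0 (Nat.zero_le _)).2 2 hM (by omega)
  have h2 : Continuous fun L : ContinuousMultilinearMap ℝ (fun _ : Fin 2 => E3) ℝ =>
      L (![EuclideanSpace.single i 1, EuclideanSpace.single j 1]) := by fun_prop
  refine (h2.comp_continuousOn h1).congr fun p hp => ?_
  simp only [Function.comp_apply, iteratedDerivWithin_zero]
  rw [iteratedFDerivWithin_two_apply _ hB.uniqueDiffOn hp.1]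
  have h3 : ContDiffOn ℝ 2 (fun x => f x p.2) (closure B) :=
    (h.contDiffOn hp.2).of_le (by exact_mod_cast hM)
  have h4 : DifferentiableWithinAt ℝ (fderivWithin ℝ (fun x => f x p.2) (closure B))
      (closure B) p.1 :=
    ((h3.fderivWithin hB.uniqueDiffOn (m := 1) le_rfl).differentiableOn one_ne_zero) p.1 hp.1
  have h5 := h4.hasFDerivWithinAt.clm_apply
    (hasFDerivWithinAt_const (EuclideanSpace.single j (1 : ℝ)) p.1 (closure B))
  simp only [pd]
  rw [h5.fderivWithin (hB.uniqueDiffOn p.1 hp.1)]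
  simp

lemma IsOfClass.c1Field {n : E3 → E3} (hB : IsBody B n) (h : IsOfClass B M N f) (hM : 1 ≤ M) :
    C1Field B f :=
  ⟨fun _ ht => (h.contDiffOn ht).of_le (by exact_mod_cast hM), h.jc, h.jc_pd hB hM⟩

lemma IsOfClass.c2Field {n : E3 → E3} (hB : IsBody B n) (h : IsOfClass B M N f) (hM : 2 ≤ M) :
    C2Field B f :=
  ⟨fun _ ht => (h.contDiffOn ht).of_le (by exact_mod_cast hM), h.jc,
    h.jc_pd hB (one_le_two.trans hM), h.jc_pd_pd hB hM⟩

end OfClass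

section C1Field

variable {B : Set E3} {n : E3 → E3} {f g : Field}

lemma C1Field.congr (h : C1Field B f) (hfg : ∀ x ∈ closure B, ∀ t ≥ 0, g x t = f x t) :
    C1Field B g := by
  refine ⟨fun t ht => (h.contDiffOn t ht).congr fun x hx => hfg x hx t ht, h.jc.congr hfg,
    fun i => (h.jc_pd i).congr fun x hx t ht => ?_⟩
  simp only [pd]
  rw [fderivWithin_congr (fun y hy => hfg y hy t ht) (hfg x hx t ht)]

lemma C1Field.const_mul (h : C1Field B f) (hB : IsBody B n) (c : ℝ) : C1Field B fun x t => c * f x t := by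
  have := h.jc
  refine ⟨fun t ht => contDiffOn_const.mul (h.contDiffOn t ht), inferInstance, fun i => ?_⟩
  have := h.jc_pd i
  refine JC.congr (f := fun x t => c * pd B i f x t) inferInstance fun x hx t ht => ?_
  simp only [pd]
  rw [fderivWithin_const_mul (hB.uniqueDiffOn x hx)
    ((h.contDiffOn t ht).differentiableOn one_ne_zero x hx)]
  rfl

lemma C1Field.sum {ι : Type*} [Fintype ι] {F : ι → Field} (hB : IsBody B n)
    (h : ∀ i, C1Field B (F i)) : C1Field B fun x t => ∑ i, F i x t := by
  have := fun i => (h i).jc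
  refine ⟨fun t ht => ContDiffOn.sum fun i _ => (h i).contDiffOn t ht, inferInstance, fun j => ?_⟩
  have := fun i => (h i).jc_pd j
  refine JC.congr (f := fun x t => ∑ i, pd B j (F i) x t) JC.sum fun x hx t ht => ?_
  simp only [pd]
  rw [fderivWithin_fun_sum (hB.uniqueDiffOn x hx) fun i _ => ((h i).contDiffOn t ht).differentiableOn one_ne_zero x hx]
  simp

lemma C1Field.add (hf : C1Field B f) (hg : C1Field B g) (hB : IsBody B n) :
    C1Field B fun x t => f x t + g x t := by
  have := hf.jc
  have := hg.jc
  refine ⟨fun t ht => (hf.contDiffOn t ht).add (hg.contDiffOn t ht), inferInstance, fun j => ?_⟩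
  have := hf.jc_pd j
  have := hg.jc_pd j
  refine JC.congr (f := fun x t => pd B j f x t + pd B j g x t) inferInstance fun x hx t ht => ?_
  simp only [pd]
  rw [fderivWithin_fun_add (hB.uniqueDiffOn x hx)
    ((hf.contDiffOn t ht).differentiableOn one_ne_zero x hx)
    ((hg.contDiffOn t ht).differentiableOn one_ne_zero x hx)]
  rfl

end C1Field

/-! ### Time derivatives under convolution -/

/-- Integration by parts in the convolution. The product rule is needed only for 0 < s, where the
one-sided derivative is an ordinary one. -/
lemma conv_derivWithin {f : ℝ → ℝ} (hf : ContDiffOn ℝ 1 f (Ici 0)) {t : ℝ} (ht : 0 ≤ t)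
    {k k' : ℝ → ℝ} (hk : ∀ s, HasDerivAt k (k' s) s) (hk' : Continuous k') :
    ((fun s => derivWithin f (Ici 0) s) ⊛ k) t = k 0 * f t - k t * f 0 + (f ⊛ k') t := by
  have hu : UniqueDiffOn ℝ (Ici (0 : ℝ)) := uniqueDiffOn_Ici 0
  have hd : ContinuousOn (fun s => derivWithin f (Ici 0) s) (Icc 0 t) :=
    (hf.continuousOn_derivWithin hu le_rfl).mono Icc_subset_Ici_self
  have hfc : ContinuousOn f (Icc 0 t) := hf.continuousOn.mono Icc_subset_Ici_self
  have hkc : Continuous k := continuous_iff_continuousAt.2 fun s => (hk s).continuousAt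
  have hi1 : IntervalIntegrable (fun s => derivWithin f (Ici 0) s * k (t - s)) volume 0 t :=
    ContinuousOn.intervalIntegrable_of_Icc ht (hd.mul (by fun_prop))
  have hi2 : IntervalIntegrable (fun s => f s * k' (t - s)) volume 0 t :=
    ContinuousOn.intervalIntegrable_of_Icc ht (hfc.mul (by fun_prop))
  have h1 := intervalIntegral.integral_eq_sub_of_hasDeriv_right_of_le ht
    (f := fun s => f s * k (t - s))
    (f' := fun s => derivWithin f (Ici 0) s * k (t - s) - f s * k' (t - s))
    (hfc.mul (by fun_prop)) (fun s hs => ?_) (hi1.sub hi2)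
  · rw [intervalIntegral.integral_sub hi1 hi2] at h1
    simp only [sub_self, sub_zero] at h1
    rw [conv, conv]
    linarith
  · have e1 : HasDerivAt f (derivWithin f (Ici 0) s) s :=
      ((hf.differentiableOn one_ne_zero) s hs.1.le).hasDerivWithinAt.hasDerivAt
        (Ici_mem_nhds hs.1)
    have e2 : HasDerivAt (fun s => k (t - s)) (-k' (t - s)) s := by
      simpa using (hk (t - s)).comp_const_sub t s
    refine ((e1.mul e2).congr_deriv ?_).hasDerivWithinAt
    ring

/-! ### Integrals of convolutions over the body and its boundary -/

/-- `Φ x` is the time integral over `[0, t]` of `φ x`, and this integral commutes with integration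
over space. -/
structure SwapAt (μ : Measure E3) (t : ℝ) (Φ : E3 → ℝ) (φ : E3 → ℝ → ℝ) : Prop where
  integrable : Integrable Φ μ
  integrable_slice : ∀ s, 0 ≤ s → s ≤ t → Integrable (fun x => φ x s) μ
  intervalIntegrable : IntervalIntegrable (fun s => ∫ x, φ x s ∂μ) volume 0 t
  integral_eq : ∫ x, Φ x ∂μ = ∫ s in (0 : ℝ)..t, ∫ x, φ x s ∂μ

section SwapAt

variable {μ : Measure E3} {t : ℝ}

/-- Together with closure under sums, this reduces an identity between integrated convolutions to
the corresponding identity between space integrals at each intermediate time. -/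
lemma SwapAt.conv [IsFiniteMeasure μ] {K : Set E3} (hK : IsCompact K)
    (hμ : μ.restrict K = μ) {f g : Field} (hf : JC K f) (hg : JC K g) (ht : 0 ≤ t) :
    SwapAt μ t (fun x => (f x ⊛ g x) t) (fun x s => f x s * g x (t - s)) where
  integrable := by
    have h1 : IntegrableOn (fun x => (f x ⊛ g x) t) K μ :=
      (JC.conv.slice ht).integrableOn_compact hK
    rwa [IntegrableOn, hμ] at h1
  integrable_slice s hs hst := by
    have h1 : IntegrableOn (fun x => f x s * g x (t - s)) K μ :=
      ((hf.slice hs).mul (hg.slice (sub_nonneg.2 hst))).integrableOn_compact hK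
    rwa [IntegrableOn, hμ] at h1
  intervalIntegrable := by
    rw [intervalIntegrable_iff_integrableOn_Ioc_of_le ht]
    exact (integrable_conv_kernel hK hμ hf hg).integral_prod_right
  integral_eq := integral_conv_eq hK hμ hf hg ht

lemma SwapAt.add {Φ Ψ : E3 → ℝ} {φ ψ : E3 → ℝ → ℝ} (h : SwapAt μ t Φ φ) (h' : SwapAt μ t Ψ ψ)
    (ht : 0 ≤ t) : SwapAt μ t (fun x => Φ x + Ψ x) (fun x s => φ x s + ψ x s) := by
  have e : ∀ s ∈ uIcc 0 t,
      ∫ x, (φ x s + ψ x s) ∂μ = (∫ x, φ x s ∂μ) + ∫ x, ψ x s ∂μ := fun s hs => by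
    rw [uIcc_of_le ht] at hs
    exact integral_add (h.integrable_slice s hs.1 hs.2) (h'.integrable_slice s hs.1 hs.2)
  refine ⟨h.integrable.add h'.integrable,
    fun s hs hst => (h.integrable_slice s hs hst).add (h'.integrable_slice s hs hst),
    (h.intervalIntegrable.add h'.intervalIntegrable).congr fun s hs =>
      (e s (uIoc_subset_uIcc hs)).symm, ?_⟩
  rw [integral_add h.integrable h'.integrable, h.integral_eq, h'.integral_eq,
    ← intervalIntegral.integral_add h.intervalIntegrable h'.intervalIntegrable]
  exact (intervalIntegral.integral_congr e).symm

lemma SwapAt.sum {ι : Type*} (s : Finset ι) {Φ : ι → E3 → ℝ} {φ : ι → E3 → ℝ → ℝ}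
    (h : ∀ i, SwapAt μ t (Φ i) (φ i)) (ht : 0 ≤ t) :
    SwapAt μ t (fun x => ∑ i ∈ s, Φ i x) (fun x r => ∑ i ∈ s, φ i x r) := by
  classical
  induction s using Finset.induction_on with
  | empty => exact ⟨by simp, by simp, by simp, by simp⟩
  | insert a s ha ih =>
    simp only [Finset.sum_insert ha]
    exact (h a).add ih ht

end SwapAt

/-- The surface traction determined by a stress `τ` and a double stress `m`. -/
def traction (B : Set E3) (n : E3 → E3) (τ : Fin 3 → Field) (m : Fin 3 → Fin 3 → Field) : Field :=
  fun x t => ∑ j, (τ j x t - ∑ k, pd B k (m k j) x t) * n x j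
    - ∑ j, ∑ k, surfGrad B n j (fun y s => m k j y s * n y k) x t
    + surfDivNormal B n x t * ∑ j, ∑ k, m k j x t * n x k * n x j

/-- The normal component of a double stress `m`. -/
def normalCouple (n : E3 → E3) (m : Fin 3 → Fin 3 → Field) : Field := fun x t =>
  ∑ j, ∑ k, m k j x t * n x k * n x j

namespace IsBody

variable {B : Set E3} {n : E3 → E3}

lemma restrict_closure (_ : IsBody B n) :
    (volume.restrict B).restrict (closure B) = volume.restrict B := by
  rw [Measure.restrict_restrict isClosed_closure.measurableSet, inter_eq_right.2 subset_closure]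

lemma restrict_frontier (_ : IsBody B n) : (area B).restrict (frontier B) = area B := by
  rw [area, Measure.restrict_restrict isClosed_frontier.measurableSet, inter_self]

lemma isCompact_frontier (h : IsBody B n) : IsCompact (frontier B) :=
  h.isCompact.of_isClosed_subset isClosed_frontier frontier_subset_closure

lemma jc_normal (h : IsBody B n) (K : Set E3) (i : Fin 3) : JC K fun x _ => n x i :=
  JC.of_space (h.contDiff_normal (k := 0) i).continuous.continuousOn

lemma jc_normalDeriv (h : IsBody B n) {w : Field} (hw : C1Field B w) :
    JC (frontier B) (normalDeriv B n w) := by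
  have := fun i => (h.jc_normal (frontier B) i).mul ((hw.jc_pd i).mono frontier_subset_closure)
  exact JC.sum

lemma jc_normalCouple (h : IsBody B n) {m : Fin 3 → Fin 3 → Field}
    (hm : ∀ k j, JC (frontier B) (m k j)) : JC (frontier B) (normalCouple n m) := by
  have := fun j k => ((hm k j).mul (h.jc_normal _ k)).mul (h.jc_normal _ j)
  have := fun j => JC.sum (hf := this j)
  exact JC.sum

lemma jc_surfGrad_mul_normal (h : IsBody B n) {f : Field} (hf : C1Field B f) (j k : Fin 3) :
    JC (frontier B) (surfGrad B n j fun y s => f y s * n y k) := by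
  have h1 : ∀ i, ContinuousOn (spd B i fun y => n y k) (frontier B) := fun i =>
    (h.contDiffOn_spd (k := 0) (l := 1) (h.contDiff_normal k).contDiffOn le_rfl
      i).continuousOn.mono frontier_subset_closure
  have h2 : ∀ i, JC (frontier B) fun x t => ((if i = j then 1 else 0) - n x i * n x j) *
      (f x t * spd B i (fun y => n y k) x + pd B i f x t * n x k) := fun i => by
    have a1 := (h.jc_normal (frontier B) i).mul (h.jc_normal _ j)
    have a2 : JC (frontier B) fun _ _ => (if i = j then 1 else 0 : ℝ) :=
      JC.of_space continuousOn_const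
    have a3 := (hf.jc.mono frontier_subset_closure).mul (JC.of_space (h1 i))
    have a4 := ((hf.jc_pd i).mono frontier_subset_closure).mul (h.jc_normal _ k)
    exact JC.mul JC.sub JC.add
  refine (JC.sum (hf := h2)).congr fun x hx t ht => ?_
  refine Finset.sum_congr rfl fun i _ => ?_
  rw [pd_apply, h.spd_mul (hf.contDiffOn t ht) (h.contDiff_normal (k := 1) k).contDiffOn i
    (frontier_subset_closure hx), pd_apply]

lemma jc_surfDivNormal (h : IsBody B n) : JC (frontier B) (surfDivNormal B n) := by
  refine JC.of_space (a := fun x => ∑ l, ssg B n l (fun y => n y l) x) ?_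
  refine continuousOn_finsetSum _ fun l _ => continuousOn_finsetSum _ fun i _ => ?_
  refine ContinuousOn.mul (continuousOn_const.sub ?_) ?_
  · exact ((h.contDiff_normal (k := 0) i).continuous.mul
      (h.contDiff_normal (k := 0) l).continuous).continuousOn
  · exact (h.contDiffOn_spd (k := 0) (l := 1) (h.contDiff_normal l).contDiffOn le_rfl
      i).continuousOn.mono frontier_subset_closure

lemma jc_traction (h : IsBody B n) {τ : Fin 3 → Field} {m : Fin 3 → Fin 3 → Field}
    (hτ : ∀ j, JC (closure B) (τ j)) (hm : ∀ k j, C1Field B (m k j)) :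
    JC (frontier B) (traction B n τ m) := by
  have a1 := fun j => (hτ j).mono frontier_subset_closure
  have a2 := fun j k => ((hm k j).jc_pd k).mono frontier_subset_closure
  have a3 := fun j => JC.mul (JC.sub (hf := a1 j) (hg := JC.sum (hf := a2 j)))
    (h.jc_normal (frontier B) j)
  have a4 := fun j => JC.sum (hf := fun k => h.jc_surfGrad_mul_normal (hm k j) j k)
  have a5 := h.jc_surfDivNormal.mul
    (h.jc_normalCouple fun k j => (hm k j).jc.mono frontier_subset_closure)
  exact JC.add (hf := JC.sub (hf := JC.sum (hf := a3)) (hg := JC.sum (hf := a4))) (hg := a5)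

/-- The convolved virtual work of tractions and couples on the boundary. -/
lemma integral_conv_green (h : IsBody B n) {τ : Fin 3 → Field} {m : Fin 3 → Fin 3 → Field}
    {w : Field} (hτ : ∀ j, C1Field B (τ j)) (hm : ∀ k j, C2Field B (m k j)) (hw : C2Field B w)
    {t : ℝ} (ht : 0 ≤ t) :
    ∫ x, ((traction B n τ m x ⊛ w x) t + (normalCouple n m x ⊛ normalDeriv B n w x) t) ∂(area B)
      = ∫ x in B, (∑ j, (τ j x ⊛ pd B j w x) t + ∑ j, ∑ k, (m k j x ⊛ pd B j (pd B k w) x) t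
        + ((fun r => ∑ j, pd B j (τ j) x r - ∑ j, ∑ k, pd B j (pd B k (m k j)) x r) ⊛ w x) t) := by
  have := h.isFiniteMeasure_area
  have := h.isFiniteMeasure_volume
  have hf := frontier_subset_closure (s := B)
  have e1 := (SwapAt.conv h.isCompact_frontier h.restrict_frontier
    (h.jc_traction (fun j => (hτ j).jc) fun k j => (hm k j).c1) (hw.jc.mono hf) ht).add
    (SwapAt.conv h.isCompact_frontier h.restrict_frontier
      (h.jc_normalCouple fun k j => (hm k j).jc.mono hf) (h.jc_normalDeriv hw.c1) ht) ht
  have d1 : JC (closure B) fun x r => ∑ j, pd B j (τ j) x r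
      - ∑ j, ∑ k, pd B j (pd B k (m k j)) x r :=
    JC.sub (hf := JC.sum (hf := fun j => (hτ j).jc_pd j))
      (hg := JC.sum (hf := fun j => JC.sum (hf := fun k => (hm k j).jc_pd_pd j k)))
  have e2 := ((SwapAt.sum Finset.univ (fun j => SwapAt.conv h.isCompact h.restrict_closure
      (hτ j).jc (hw.jc_pd j) ht) ht).add
    (SwapAt.sum Finset.univ (fun j => SwapAt.sum Finset.univ (fun k => SwapAt.conv h.isCompact
      h.restrict_closure (hm k j).jc (hw.jc_pd_pd j k) ht) ht) ht) ht).add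
    (SwapAt.conv h.isCompact h.restrict_closure d1 hw.jc ht) ht
  -- With the intermediate time s frozen, the static Green identity applies to the stresses at time
  -- s and to w at time t - s.
  rw [e1.integral_eq, e2.integral_eq]
  refine intervalIntegral.integral_congr fun s hs => ?_
  rw [uIcc_of_le ht] at hs
  exact h.integral_green (fun j => (hτ j).contDiffOn s hs.1) (fun k j => (hm k j).contDiffOn s hs.1)
    (hw.contDiffOn (t - s) (sub_nonneg.2 hs.2))

lemma integral_conv_flux (h : IsBody B n) {q : Fin 3 → Field} {w : Field}
    (hq : ∀ j, C1Field B (q j)) (hw : C1Field B w) {t : ℝ} (ht : 0 ≤ t) :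
    ∫ x, ((fun r => ∑ i, q i x r * n x i) ⊛ w x) t ∂(area B)
      = ∫ x in B, (∑ j, (q j x ⊛ pd B j w x) t + ((fun r => ∑ j, pd B j (q j) x r) ⊛ w x) t) := by
  have := h.isFiniteMeasure_area
  have := h.isFiniteMeasure_volume
  have hf := frontier_subset_closure (s := B)
  have e1 := SwapAt.conv h.isCompact_frontier h.restrict_frontier
    (JC.sum (hf := fun j => ((hq j).jc.mono hf).mul (h.jc_normal _ j))) (hw.jc.mono hf) ht
  have e2 := (SwapAt.sum Finset.univ (fun j => SwapAt.conv h.isCompact h.restrict_closure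
      (hq j).jc (hw.jc_pd j) ht) ht).add (SwapAt.conv h.isCompact h.restrict_closure
      (JC.sum (hf := fun j => (hq j).jc_pd j)) hw.jc ht) ht
  rw [e1.integral_eq, e2.integral_eq]
  refine intervalIntegral.integral_congr fun s hs => ?_
  rw [uIcc_of_le ht] at hs
  have hs' := sub_nonneg.2 hs.2
  have c1 := fun j => ((hq j).contDiffOn s hs.1)
  have c2 := hw.contDiffOn (t - s) hs'
  have i1 : ∀ j, IntegrableOn (fun x => q j x s * pd B j w x (t - s)) B := fun j =>
    h.integrableOn (((hq j).jc.slice hs.1).mul ((hw.jc_pd j).slice hs'))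
  have i2 : ∀ j, IntegrableOn (fun x => pd B j (q j) x s * w x (t - s)) B := fun j =>
    h.integrableOn ((((hq j).jc_pd j).slice hs.1).mul (hw.jc.slice hs'))
  have i3 : ∀ j, Integrable (fun x => q j x s * w x (t - s) * n x j) (area B) := fun j =>
    h.integrable_area ((((hq j).jc.slice hs.1).mul (hw.jc.slice hs')).mono hf |>.mul
      (h.contDiff_normal (k := 0) j).continuous.continuousOn)
  have key : ∀ j, ∫ x, q j x s * w x (t - s) * n x j ∂(area B)
      = (∫ x in B, q j x s * pd B j w x (t - s)) + ∫ x in B, pd B j (q j) x s * w x (t - s) :=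
    fun j => by
      have := h.integral_mul_spd (c1 j) c2 j
      simp only [pd_apply]
      rw [this]
      ring
  calc ∫ x, (∑ i, q i x s * n x i) * w x (t - s) ∂(area B)
      = ∫ x, ∑ i, q i x s * w x (t - s) * n x i ∂(area B) := by
        simp only [Finset.sum_mul, mul_right_comm]
    _ = ∑ i, ((∫ x in B, q i x s * pd B i w x (t - s))
          + ∫ x in B, pd B i (q i) x s * w x (t - s)) := by
        rw [integral_finsetSum _ fun i _ => i3 i]
        exact Finset.sum_congr rfl fun i _ => key i
    _ = _ := by
        simp only [Finset.sum_mul]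
        rw [integral_add (integrable_finsetSum _ fun i _ => i1 i)
          (integrable_finsetSum _ fun i _ => i2 i), integral_finsetSum _ fun i _ => i1 i,
          integral_finsetSum _ fun i _ => i2 i, Finset.sum_add_distrib]

end IsBody

/-! ### Time derivatives in the convolution ring -/

section Time

variable {f : ℝ → ℝ}

lemma tc_of_continuous (hf : Continuous f) : TC f := ⟨hf.continuousOn⟩

lemma tc_derivWithin (hf : ContDiffOn ℝ 1 f (Ici 0)) :
    TC (fun s => derivWithin f (Ici 0) s) :=
  ⟨hf.continuousOn_derivWithin (uniqueDiffOn_Ici 0) le_rfl⟩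

instance tc_l : TC l := tc_of_continuous continuous_const
instance tc_ξ : TC ξ := tc_of_continuous continuous_id
instance tc_ζ (m : Material) : TC (ζ m) := tc_of_continuous (by unfold ζ; fun_prop)
instance tc_χ (m : Material) : TC (χ m) := tc_of_continuous (by unfold χ; fun_prop)

instance tc_exp (a b : ℝ) : TC fun t => a * Real.exp (-t / b) := tc_of_continuous (by fun_prop)

lemma toR_l_mul_derivWithin (hf : ContDiffOn ℝ 1 f (Ici 0)) :
    toR l * toR (fun s => derivWithin f (Ici 0) s) = toR f - toR (fun _ => f 0) := by
  have := tc_derivWithin hf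
  have : TC f := ⟨hf.continuousOn⟩
  have : TC fun _ => f 0 := ⟨continuousOn_const⟩
  rw [mul_comm, ← toR_conv, ← toR_sub]
  refine toR_congr fun t ht => ?_
  rw [conv_derivWithin hf ht (k := l) (k' := fun _ => 0) (fun s => hasDerivAt_const s _) continuous_const]
  simp [conv, l]

/-- Two integrations by parts: since ξ(0) = 0 and ξ' = l, the first leaves l * f' - f'(0) t, and the
second is the case of l. -/
lemma toR_ξ_mul_derivWithin_derivWithin (hf : ContDiffOn ℝ 2 f (Ici 0)) :
    toR ξ * toR (fun s => derivWithin (fun r => derivWithin f (Ici 0) r) (Ici 0) s)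
      = toR f - toR (fun t => derivWithin f (Ici 0) 0 * t + f 0) := by
  have hf' : ContDiffOn ℝ 1 (fun r => derivWithin f (Ici 0) r) (Ici 0) :=
    hf.derivWithin (uniqueDiffOn_Ici 0) le_rfl
  have := tc_derivWithin hf'
  have := tc_derivWithin (hf.of_le one_le_two)
  have : TC f := ⟨hf.continuousOn⟩
  have : TC fun t => derivWithin f (Ici 0) 0 * t + f 0 := tc_of_continuous (by fun_prop)
  have : TC fun _ => f 0 := ⟨continuousOn_const⟩
  have : TC fun t => derivWithin f (Ici 0) 0 * t := tc_of_continuous (by fun_prop)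
  have h1 : toR ξ * toR (fun s => derivWithin (fun r => derivWithin f (Ici 0) r) (Ici 0) s)
      = toR l * toR (fun s => derivWithin f (Ici 0) s)
        - toR (fun t => derivWithin f (Ici 0) 0 * t) := by
    rw [mul_comm, mul_comm (toR l), ← toR_conv, ← toR_conv, ← toR_sub]
    refine toR_congr fun t ht => ?_
    rw [conv_derivWithin hf' ht (k := ξ) (k' := l) (fun s => hasDerivAt_id s) continuous_const]
    simp only [ξ]
    ring
  rw [h1, toR_l_mul_derivWithin (hf.of_le one_le_two), toR_add]
  ring

/-- The kernel k satisfies k(0) = 1/b and b k' = -k. Integrating by parts in b k * f' therefore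
gives f - f(0) e^{-t/b} - k * f, and the last term cancels against k * f. -/
lemma toR_relaxation {b : ℝ} (hb : b ≠ 0) (hf : ContDiffOn ℝ 1 f (Ici 0)) :
    toR (fun t => 1 / b * Real.exp (-t / b))
        * toR (fun s => f s + b * derivWithin f (Ici 0) s)
      = toR f - toR (fun t => f 0 * Real.exp (-t / b)) := by
  have := tc_derivWithin hf
  have : TC f := ⟨hf.continuousOn⟩
  set k : ℝ → ℝ := fun t => 1 / b * Real.exp (-t / b) with hk
  have hkc : Continuous k := by fun_prop
  have : TC k := tc_of_continuous hkc
  have hd : ∀ s, HasDerivAt k ((-1 / b) * k s) s := fun s => by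
    have h1 : HasDerivAt (fun t : ℝ => -t / b) (-1 / b) s := ((hasDerivAt_id s).neg).div_const b
    refine (h1.exp.const_mul (1 / b)).congr_deriv ?_
    simp only [hk]
    ring
  have h1 : toR (fun s => derivWithin f (Ici 0) s) * toR k
      = (1 / b) • toR f - (1 / b) • toR (fun t => f 0 * Real.exp (-t / b))
        - (1 / b) • (toR f * toR k) := by
    rw [← toR_conv, ← toR_conv, ← toR_const_mul, ← toR_const_mul, ← toR_const_mul, ← toR_sub,
      ← toR_sub]
    refine toR_congr fun t ht => ?_
    rw [conv_derivWithin hf ht hd (by fun_prop)]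
    have h2 : (f ⊛ fun s => (-1 / b) * k s) t = (-1 / b) * (f ⊛ k) t := by
      rw [conv, conv, ← intervalIntegral.integral_const_mul]
      exact intervalIntegral.integral_congr fun s _ => by ring
    rw [h2]
    simp only [hk, neg_zero, zero_div, Real.exp_zero]
    ring
  rw [toR_add, toR_const_mul (f := fun s => derivWithin f (Ici 0) s), mul_comm, add_mul, smul_mul_assoc, h1, smul_sub, smul_sub, smul_smul,
    smul_smul, smul_smul, mul_one_div_cancel hb, one_smul, one_smul, one_smul]
  ring

end Time

/-! ### States in the convolution ring -/

/-- A real constant as an element of the convolution ring. -/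
abbrev constR : ℝ → ConvRing := algebraMap ℝ ConvRing

/-- The constants and kernels in the convolution ring. -/
def Material.abstract (m : Material) : AbstractMaterial ConvRing where
  χ := toR (χ m)
  ζ := toR (ζ m)
  ξ := toR ξ
  l := toR l
  ρ := constR m.ρ
  T₀ := constR m.T₀
  invT := constR (1 / m.T₀)
  c := constR m.c
  a11 p q := constR (m.a11 p.1 p.2 q.1 q.2)
  a17 p q := constR (m.a17 p.1 p.2 q.1 q.2)
  a77 p q := constR (m.a77 p.1 p.2 q.1 q.2)
  a22 p q := constR (m.a22 p.1 p.2.1 p.2.2 q.1 q.2.1 q.2.2)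
  a23 p i := constR (m.a23 p.1 p.2.1 p.2.2 i)
  a33 i j := constR (m.a33 i j)
  k i j := constR (m.k i j)
  a14 p := constR (m.a14 p.1 p.2)
  a47 p := constR (m.a47 p.1 p.2)

lemma Material.IsAdmissible.abstract {m : Material} (hm : m.IsAdmissible) :
    m.abstract.IsSymm where
  invT := by
    simp only [Material.abstract]
    rw [← map_mul, one_div_mul_cancel hm.T₀_pos.ne', map_one]
  a11 p q := congrArg constR (hm.a11_symm _ _ _ _).2
  a77 p q := congrArg constR (hm.a77_symm _ _ _ _).2
  a22 p q := congrArg constR (hm.a22_symm _ _ _ _ _ _).2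
  a33 p q := congrArg constR (hm.a33_symm _ _)
  k p q := congrArg constR (hm.k_symm _ _)

/-- The divergence of the effective stress. -/
def State.divStress (p : State) (B : Set E3) (i : Fin 3) : Field := fun x t =>
  ∑ j, pd B j (p.τ j i) x t - ∑ j, ∑ k, pd B j (pd B k (p.μ k j i)) x t

/-- The divergence of the heat flux. -/
def State.divHeat (p : State) (B : Set E3) : Field := fun x t => ∑ j, pd B j (p.q j) x t

/-- The state and its data at the point `x` in the convolution ring. -/
def State.abstract (p : State) (B : Set E3) (m : Material) (Γ : Data) (x : E3) :
    AbstractState ConvRing where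
  u i := toR (p.u i x)
  F i := toR (calF m Γ i x)
  D i := toR (p.divStress B i x)
  b i := toR (p.b i x)
  el i := toR (p.el i x)
  σ i := toR (p.σ i x)
  q i := toR (p.q i x)
  e a := toR (p.e a.1 a.2 x)
  V a := toR (p.V a.1 a.2 x)
  τ a := toR (p.τ a.1 a.2 x)
  Q a := toR (p.Q a.1 a.2 x)
  L a := toR (calL m Γ a.1 a.2 x)
  M a := toR (calM m Γ a.1 a.2 x)
  κ a := toR (p.κ a.1 a.2.1 a.2.2 x)
  μ a := toR (p.μ a.1 a.2.1 a.2.2 x)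
  θ := toR (p.θ x)
  φ := toR (p.φ x)
  η := toR (p.η x)
  g := toR (Γ.g x)
  Z := toR (p.divHeat B x)
  H := toR (calH m Γ x)
  r := toR (calR m Γ x)

/-- Continuity in time at the point `x` of the fields in the constitutive equations. -/
structure State.IsTimeCont (p : State) (x : E3) : Prop where
  θ : TC (p.θ x)
  e : ∀ i j, TC (p.e i j x)
  κ : ∀ i j k, TC (p.κ i j k x)
  b : ∀ i, TC (p.b i x)
  el : ∀ i, TC (p.el i x)
  V : ∀ i j, TC (p.V i j x)
  σ : ∀ i, TC (p.σ i x)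
  Q : ∀ i j, TC (p.Q i j x)
  η : TC (p.η x)
  q : ∀ i, TC (p.q i x)

section Solution

variable {B : Set E3} {n : E3 → E3} {S Sg : Fin 5 → Set E3} {m : Material} {Γ : Data} {p : State}

/-- No regularity is required of σ in the array; it is inherited from κ and E through the
constitutive equation. -/
lemma State.IsSolution.σ_c1Field (hB : IsBody B n) (hp : p.IsSolution B n S Sg m Γ) (i : Fin 3) :
    C1Field B (p.σ i) := by
  have h1 := C1Field.sum hB fun j => C1Field.sum hB fun k => C1Field.sum hB fun l =>
    ((hp.admissible.κ_class j k l).c1Field hB one_le_two).const_mul hB (m.a23 j k l i)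
  have h2 := C1Field.sum hB fun j =>
    ((hp.admissible.el_class j).c1Field hB one_le_two).const_mul hB (m.a33 i j)
  refine ((h1.add h2 hB).const_mul hB (-1)).congr fun x hx t ht => ?_
  have := hp.field.σ_eq i x hx t ht
  linarith

lemma State.IsSolution.isTimeCont (hB : IsBody B n) (hp : p.IsSolution B n S Sg m Γ) {x : E3}
    (hx : x ∈ closure B) : p.IsTimeCont x where
  θ := hp.admissible.θ_class.jc.tc hx
  e i j := (hp.admissible.e_class i j).jc.tc hx
  κ i j k := (hp.admissible.κ_class i j k).jc.tc hx
  b i := (hp.admissible.b_class i).jc.tc hx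
  el i := (hp.admissible.el_class i).jc.tc hx
  V i j := (hp.admissible.V_class i j).jc.tc hx
  σ i := (hp.σ_c1Field hB i).jc.tc hx
  Q i j := (hp.admissible.Q_class i j).jc.tc hx
  η := hp.admissible.η_class.jc.tc hx
  q i := (hp.admissible.q_class i).jc.tc hx

end Solution

lemma toR_constR_mul {f : ℝ → ℝ} [TC f] (c : ℝ) : toR (fun t => c * f t) = constR c * toR f := by
  rw [toR_const_mul, Algebra.smul_def]

lemma toR_neg {f : ℝ → ℝ} [TC f] : toR (fun t => - f t) = - toR f := by
  have : toR (fun t => - f t) = toR (fun t => (-1) * f t) := toR_congr fun t _ => by ring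
  rw [this, toR_const_mul, neg_one_smul]

section Solution

variable {B : Set E3} {n : E3 → E3} {S Sg : Fin 5 → Set E3} {m : Material} {Γ : Data} {p : State}
  {x : E3}

namespace State.IsSolution

lemma contDiffOn_θ (hp : p.IsSolution B n S Sg m Γ) (hx : x ∈ closure B) :
    ContDiffOn ℝ 1 (p.θ x) (Ici 0) :=
  (hp.admissible.θ_class.contDiffOn_time hx).of_le (by norm_num)

lemma relaxation_ζ (hm : m.IsAdmissible) (hp : p.IsSolution B n S Sg m Γ) (hx : x ∈ closure B) :
    toR (ζ m) * toR (fun t => p.θ x t + m.β * dt p.θ x t)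
      = toR (p.θ x) - toR (fun t => Γ.θ₀ x * Real.exp (-t / m.β)) := by
  rw [← hp.initial.θ x hx]
  exact toR_relaxation hm.β_ne (hp.contDiffOn_θ hx)

lemma relaxation_χ (hm : m.IsAdmissible) (hp : p.IsSolution B n S Sg m Γ) (hx : x ∈ closure B) :
    toR (χ m) * toR (fun t => p.θ x t + m.β' * dt p.θ x t)
      = toR (p.θ x) - toR (fun t => Γ.θ₀ x * Real.exp (-t / m.β')) := by
  rw [← hp.initial.θ x hx]
  exact toR_relaxation hm.β'_ne (hp.contDiffOn_θ hx)

lemma tc_dt_θ (hp : p.IsSolution B n S Sg m Γ) (hx : x ∈ closure B) : TC (dt p.θ x) :=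
  tc_derivWithin (hp.contDiffOn_θ hx)

lemma toR_τ (hB : IsBody B n) (hp : p.IsSolution B n S Sg m Γ) (hx : x ∈ closure B)
    (i j : Fin 3) :
    toR (p.τ i j x) = ∑ k, ∑ l, constR (m.a11 i j k l) * toR (p.e k l x)
      + ∑ k, ∑ l, constR (m.a17 i j k l) * toR (p.V k l x)
      + constR (m.a14 i j) * toR (fun t => p.θ x t + m.β * dt p.θ x t) := by
  have hr := hp.isTimeCont hB hx
  have := hr.e
  have := hr.V
  have := hr.θ
  have := hp.tc_dt_θ hx
  rw [toR_congr (hp.field.τ_eq i j x hx)]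
  simp only [toR_add, toR_sum, toR_constR_mul]

lemma toR_Q (hB : IsBody B n) (hp : p.IsSolution B n S Sg m Γ) (hx : x ∈ closure B)
    (i j : Fin 3) :
    - toR (p.Q i j x) = ∑ k, ∑ l, constR (m.a17 k l i j) * toR (p.e k l x)
      + ∑ k, ∑ l, constR (m.a77 i j k l) * toR (p.V k l x)
      + constR (m.a47 i j) * toR (fun t => p.θ x t + m.β * dt p.θ x t) := by
  have hr := hp.isTimeCont hB hx
  have := hr.e
  have := hr.V
  have := hr.θ
  have := hr.Q
  have := hp.tc_dt_θ hx
  rw [← toR_neg, toR_congr (hp.field.Q_eq i j x hx)]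
  simp only [toR_add, toR_sum, toR_constR_mul]

lemma toR_η (hB : IsBody B n) (hp : p.IsSolution B n S Sg m Γ) (hx : x ∈ closure B) :
    - (constR m.ρ * toR (p.η x)) = ∑ i, ∑ j, constR (m.a14 i j) * toR (p.e i j x)
      + ∑ i, ∑ j, constR (m.a47 i j) * toR (p.V i j x)
      + constR m.c * toR (fun t => p.θ x t + m.β' * dt p.θ x t) := by
  have hr := hp.isTimeCont hB hx
  have := hr.e
  have := hr.V
  have := hr.θ
  have := hr.η
  have := hp.tc_dt_θ hx
  rw [← toR_constR_mul, ← toR_neg, toR_congr (hp.field.η_eq x hx)]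
  simp only [toR_add, toR_sum, toR_constR_mul]

lemma toR_μ (hB : IsBody B n) (hp : p.IsSolution B n S Sg m Γ) (hx : x ∈ closure B)
    (i j k : Fin 3) :
    toR (p.μ i j k x) = ∑ l, ∑ h, ∑ r, constR (m.a22 i j k l h r) * toR (p.κ l h r x)
      + ∑ l, constR (m.a23 i j k l) * toR (p.el l x) := by
  have hr := hp.isTimeCont hB hx
  have := hr.κ
  have := hr.el
  rw [toR_congr (hp.field.μ_eq i j k x hx)]
  simp only [toR_add, toR_sum, toR_constR_mul]

lemma toR_σ (hB : IsBody B n) (hp : p.IsSolution B n S Sg m Γ) (hx : x ∈ closure B)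
    (i : Fin 3) :
    - toR (p.σ i x) = ∑ j, ∑ k, ∑ l, constR (m.a23 j k l i) * toR (p.κ j k l x)
      + ∑ j, constR (m.a33 i j) * toR (p.el j x) := by
  have hr := hp.isTimeCont hB hx
  have := hr.κ
  have := hr.el
  have := hr.σ
  rw [← toR_neg, toR_congr (hp.field.σ_eq i x hx)]
  simp only [toR_add, toR_sum, toR_constR_mul]

lemma toR_q (hB : IsBody B n) (hp : p.IsSolution B n S Sg m Γ) (hx : x ∈ closure B)
    (i : Fin 3) :
    - (constR (1 / m.T₀) * toR (p.q i x)) = ∑ j, constR (m.k i j) * toR (p.b j x) := by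
  have hr := hp.isTimeCont hB hx
  have := hr.b
  have := hr.q
  rw [← toR_constR_mul, ← toR_neg, toR_congr (g := fun t => ∑ j, m.k i j * p.b j x t)
    fun t ht => ?_]
  · simp only [toR_sum, toR_constR_mul]
  · rw [← hp.field.q_eq i x hx t ht]
    ring

/-- Convolution with ξ integrates twice in time; the initial displacement and velocity that appear
are the ones built into 𝓕. -/
lemma toR_motion (hΓ : Γ.IsCont B S Sg) (hp : p.IsSolution B n S Sg m Γ) (hx : x ∈ B)
    (i : Fin 3) :
    toR ξ * toR (p.divStress B i x) = constR m.ρ * toR (p.u i x) - toR (calF m Γ i x) := by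
  have hx' := subset_closure hx
  have hu : ContDiffOn ℝ 2 (p.u i x) (Ici 0) := (hp.admissible.u_class i).contDiffOn_time hx'
  have hu' : ContDiffOn ℝ 1 (dt (p.u i) x) (Ici 0) := hu.derivWithin (uniqueDiffOn_Ici 0) le_rfl
  have : TC (dt (dt (p.u i)) x) := tc_derivWithin hu'
  have : TC (Γ.f i x) := JC.tc ⟨hΓ.f i⟩ hx'
  have : TC fun t => Γ.v₀ i x * t + Γ.u₀ i x := tc_of_continuous (by fun_prop)
  have h1 : toR (p.divStress B i x)
      = constR m.ρ * toR (dt (dt (p.u i)) x) - constR m.ρ * toR (Γ.f i x) := by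
    rw [← toR_constR_mul, ← toR_constR_mul, ← toR_sub]
    exact toR_congr fun t ht => eq_sub_of_add_eq (hp.field.motion i x hx t ht)
  have h2 : toR (calF m Γ i x) = constR m.ρ * (toR ξ * toR (Γ.f i x))
      + constR m.ρ * toR (fun t => Γ.v₀ i x * t + Γ.u₀ i x) := by
    rw [← toR_conv, ← toR_constR_mul, ← toR_constR_mul, ← toR_add]
    refine toR_congr fun t _ => ?_
    rw [calF]
    ring
  have h3 := toR_ξ_mul_derivWithin_derivWithin hu
  rw [show derivWithin (p.u i x) (Ici 0) 0 = Γ.v₀ i x from hp.initial.v i x hx',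
    hp.initial.u i x hx'] at h3
  change toR ξ * toR (dt (dt (p.u i)) x) = _ at h3
  rw [h1, h2]
  linear_combination constR m.ρ * h3

lemma toR_energy (hΓ : Γ.IsCont B S Sg) (hp : p.IsSolution B n S Sg m Γ) (hx : x ∈ B) :
    constR m.ρ * constR m.T₀ * toR (p.η x)
      = toR (calH m Γ x) - toR l * toR (p.divHeat B x) := by
  have hx' := subset_closure hx
  have hη : ContDiffOn ℝ 1 (p.η x) (Ici 0) := hp.admissible.η_class.contDiffOn_time hx'
  have : TC (dt p.η x) := tc_derivWithin hη
  have : TC (Γ.h x) := JC.tc ⟨hΓ.h⟩ hx'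
  have : TC fun _ => Γ.η₀ x := tc_of_continuous continuous_const
  have h1 : toR (p.divHeat B x)
      = constR m.ρ * toR (Γ.h x) - constR (m.ρ * m.T₀) * toR (dt p.η x) := by
    rw [← toR_constR_mul, ← toR_constR_mul, ← toR_sub]
    refine toR_congr fun t ht => ?_
    have := hp.field.energy x hx t ht
    rw [State.divHeat]
    linarith
  have h2 : toR (calH m Γ x) = constR (m.ρ * m.T₀) * toR (fun _ => Γ.η₀ x)
      + toR l * (constR m.ρ * toR (Γ.h x)) := by
    rw [← toR_constR_mul, ← toR_constR_mul, ← toR_conv, ← toR_add]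
    exact toR_congr fun t _ => rfl
  have h3 := toR_l_mul_derivWithin hη
  rw [hp.initial.η x hx'] at h3
  change toR l * toR (dt p.η x) = _ at h3
  rw [h1, h2, ← map_mul]
  linear_combination constR (m.ρ * m.T₀) * (-h3)

/-- The remainders θ⁰ e^{-t/β} and θ⁰ e^{-t/β'} of the two relaxation identities, multiplied by a14,
a47 and c, are 𝓛, 𝓜 and 𝓡. -/
lemma abstract_solves (hm : m.IsAdmissible) (hB : IsBody B n) (hΓ : Γ.IsCont B S Sg)
    (hp : p.IsSolution B n S Sg m Γ) (hx : x ∈ B) :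
    (p.abstract B m Γ x).Solves m.abstract := by
  have hx' := subset_closure hx
  have e1 : ∀ a b : ℝ, toR (fun t => a * Γ.θ₀ x * Real.exp (-t / b))
      = constR a * toR (fun t => Γ.θ₀ x * Real.exp (-t / b)) := fun a b => by
    rw [← toR_constR_mul]
    exact toR_congr fun t _ => mul_assoc _ _ _
  have hL : ∀ i j, toR (calL m Γ i j x)
      = constR (m.a14 i j) * toR (fun t => Γ.θ₀ x * Real.exp (-t / m.β)) := fun i j => e1 _ _
  have hM : ∀ i j, toR (calM m Γ i j x)
      = constR (m.a47 i j) * toR (fun t => Γ.θ₀ x * Real.exp (-t / m.β)) := fun i j => e1 _ _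
  have hR : toR (calR m Γ x)
      = constR m.c * toR (fun t => Γ.θ₀ x * Real.exp (-t / m.β')) := e1 _ _
  have hζ := hp.relaxation_ζ hm hx'
  have hχ := hp.relaxation_χ hm hx'
  constructor
  · rintro ⟨i, j⟩
    simp only [Material.abstract, State.abstract, Fintype.sum_prod_type]
    rw [hL]
    linear_combination toR (ζ m) * hp.toR_τ hB hx' i j + constR (m.a14 i j) * hζ
  · rintro ⟨i, j⟩
    simp only [Material.abstract, State.abstract, Fintype.sum_prod_type]
    rw [hM]
    linear_combination toR (ζ m) * hp.toR_Q hB hx' i j + constR (m.a47 i j) * hζ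
  · simp only [Material.abstract, State.abstract, Fintype.sum_prod_type]
    rw [hR]
    linear_combination toR (χ m) * hp.toR_η hB hx' + constR m.c * hχ
  · rintro ⟨i, j, k⟩
    simp only [Material.abstract, State.abstract, Fintype.sum_prod_type]
    exact hp.toR_μ hB hx' i j k
  · intro i
    simp only [Material.abstract, State.abstract, Fintype.sum_prod_type]
    exact hp.toR_σ hB hx' i
  · intro i
    exact hp.toR_q hB hx' i
  · intro i
    exact hp.toR_motion hΓ hx i
  · exact hp.toR_energy hΓ hx

end State.IsSolution

end Solution

instance JC.of_time' {K : Set E3} {a : ℝ → ℝ} [ha : TC a] : JC K (fun _ => a) := JC.of_time ha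

/-! ### The functional as a volume integral of a density. -/

/-- The divergence of the effective electric displacement. -/
def State.divElectric (p : State) (B : Set E3) : Field := fun x t =>
  ∑ j, pd B j (p.σ j) x t - ∑ j, ∑ k, pd B j (pd B k (p.Q k j)) x t

/-- The density of the convolved supply terms. -/
def supplyDensity (m : Material) (Γ : Data) (p' : State) : Field := fun x s =>
  ∑ i, (calF m Γ i x ⊛ p'.u i x) s - (ξ ⊛ Γ.g x ⊛ p'.φ x) s

/-- The boundary density of the convolved mechanical and electric power. -/
def boundaryPower (B : Set E3) (n : E3 → E3) (p p' : State) : Field := fun x r =>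
  ∑ i, ((p.P B n i x ⊛ p'.u i x) r + (p.R n i x ⊛ normalDeriv B n (p'.u i) x) r)
    + (p.Λ B n x ⊛ p'.φ x) r + (p.H n x ⊛ normalDeriv B n p'.φ x) r

/-- The volume density of the convolved mechanical and electric power. -/
def powerDensity (B : Set E3) (p p' : State) : Field := fun x r =>
  ∑ i, (∑ j, (p.τ j i x ⊛ pd B j (p'.u i) x) r
      + ∑ j, ∑ k, (p.μ k j i x ⊛ pd B j (pd B k (p'.u i)) x) r
      + (p.divStress B i x ⊛ p'.u i x) r)
    + (∑ j, (p.σ j x ⊛ pd B j p'.φ x) r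
      + ∑ j, ∑ k, (p.Q k j x ⊛ pd B j (pd B k p'.φ) x) r
      + (p.divElectric B x ⊛ p'.φ x) r)

/-- The volume density of the convolved heat supply through the boundary. -/
def heatDensity (B : Set E3) (p p' : State) : Field := fun x r =>
  ∑ j, (p.q j x ⊛ pd B j p'.θ x) r + (p.divHeat B x ⊛ p'.θ x) r

/-- The density of the terms that contain the initial data. -/
def initialDensity (m : Material) (Γ : Data) (p' : State) : Field := fun x s =>
  (χ m ⊛ fun r => ∑ i, ∑ j,
      ((calL m Γ i j x ⊛ p'.e i j x) r + (calM m Γ i j x ⊛ p'.V i j x) r)) s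
    + (calR m Γ x ⊛ p'.θ x) s - (χ m ⊛ (fun r => 1 / m.T₀ * calH m Γ x r) ⊛ p'.θ x) s

/-- The volume density of the functional. -/
def functionalDensity (B : Set E3) (m : Material) (Γ : Data) (p p' : State) : Field := fun x t =>
  (χ m ⊛ ζ m ⊛ supplyDensity m Γ p' x) t
    + (χ m ⊛ ξ ⊛ fun s => (ζ m ⊛ powerDensity B p p' x) s
        + 1 / m.T₀ * (l ⊛ heatDensity B p p' x) s) t
    + (ξ ⊛ initialDensity m Γ p' x) t

/-- Continuity of the fields of a state and of the derivatives in the field equations. -/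
structure State.IsRegular (p : State) (B : Set E3) : Prop where
  u : ∀ i, C2Field B (p.u i)
  θ : C1Field B p.θ
  φ : C2Field B p.φ
  e : ∀ i j, JC (closure B) (p.e i j)
  V : ∀ i j, JC (closure B) (p.V i j)
  τ : ∀ i j, C1Field B (p.τ i j)
  μ : ∀ i j k, C2Field B (p.μ i j k)
  σ : ∀ i, C1Field B (p.σ i)
  Q : ∀ i j, C2Field B (p.Q i j)
  q : ∀ i, C1Field B (p.q i)

section Functional

variable {B : Set E3} {n : E3 → E3} {S Sg : Fin 5 → Set E3} {m : Material} {Γ : Data}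
  {p p' : State}

lemma State.IsSolution.isRegular (hB : IsBody B n) (hp : p.IsSolution B n S Sg m Γ) :
    p.IsRegular B where
  u i := (hp.admissible.u_class i).c2Field hB (by norm_num)
  θ := hp.admissible.θ_class.c1Field hB (by norm_num)
  φ := hp.admissible.φ_class.c2Field hB (by norm_num)
  e i j := (hp.admissible.e_class i j).jc
  V i j := (hp.admissible.V_class i j).jc
  τ i j := (hp.admissible.τ_class i j).c1Field hB le_rfl
  μ i j k := (hp.admissible.μ_class i j k).c2Field hB le_rfl
  σ := hp.σ_c1Field hB
  Q i j := (hp.admissible.Q_class i j).c2Field hB le_rfl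
  q i := (hp.admissible.q_class i).c1Field hB le_rfl

lemma State.IsRegular.jc_divStress (h : p.IsRegular B) (i : Fin 3) :
    JC (closure B) (p.divStress B i) :=
  JC.sub (hf := JC.sum (hf := fun j => (h.τ j i).jc_pd j))
    (hg := JC.sum (hf := fun j => JC.sum (hf := fun k => (h.μ k j i).jc_pd_pd j k)))

lemma State.IsRegular.jc_divElectric (h : p.IsRegular B) : JC (closure B) (p.divElectric B) :=
  JC.sub (hf := JC.sum (hf := fun j => (h.σ j).jc_pd j))
    (hg := JC.sum (hf := fun j => JC.sum (hf := fun k => (h.Q k j).jc_pd_pd j k)))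

lemma State.IsRegular.jc_divHeat (h : p.IsRegular B) : JC (closure B) (p.divHeat B) :=
  JC.sum (hf := fun j => (h.q j).jc_pd j)

lemma jc_powerDensity (h : p.IsRegular B) (h' : p'.IsRegular B) :
    JC (closure B) (powerDensity B p p') := by
  have := fun i j => (h.τ i j).jc
  have := fun i j k => (h.μ i j k).jc
  have := fun i => (h.σ i).jc
  have := fun i j => (h.Q i j).jc
  have := h.jc_divStress
  have := h.jc_divElectric
  have := fun i => (h'.u i).jc
  have := fun i => (h'.u i).jc_pd
  have := fun i => (h'.u i).jc_pd_pd
  have := h'.φ.jc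
  have := h'.φ.jc_pd
  have := h'.φ.jc_pd_pd
  unfold powerDensity
  infer_instance

lemma jc_heatDensity (h : p.IsRegular B) (h' : p'.IsRegular B) :
    JC (closure B) (heatDensity B p p') := by
  have := fun i => (h.q i).jc
  have := h.jc_divHeat
  have := h'.θ.jc
  have := h'.θ.jc_pd
  unfold heatDensity
  infer_instance

lemma jc_boundaryPower (hB : IsBody B n) (h : p.IsRegular B) (h' : p'.IsRegular B) :
    JC (frontier B) (boundaryPower B n p p') := by
  have hf := frontier_subset_closure (s := B)
  have := fun i => hB.jc_traction (τ := fun j => p.τ j i) (m := fun k j => p.μ k j i)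
    (fun j => (h.τ j i).jc) (fun k j => (h.μ k j i).c1)
  have : ∀ i, JC (frontier B) (p.P B n i) := this
  have := fun i => hB.jc_normalCouple (m := fun k j => p.μ k j i)
    (fun k j => (h.μ k j i).jc.mono hf)
  have : ∀ i, JC (frontier B) (p.R n i) := this
  have : JC (frontier B) (p.Λ B n) := hB.jc_traction (fun j => (h.σ j).jc) fun k j => (h.Q k j).c1
  have : JC (frontier B) (p.H n) := hB.jc_normalCouple fun k j => (h.Q k j).jc.mono hf
  have := fun i => (h'.u i).jc.mono hf
  have := fun i => hB.jc_normalDeriv (h'.u i).c1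
  have := h'.φ.jc.mono hf
  have := hB.jc_normalDeriv h'.φ.c1
  unfold boundaryPower
  infer_instance

/-- One Green identity serves for all terms: P_i and R_i come from the columns τ_{ji}, μ_{kji}
paired with u_i', while Λ and H come from σ, Q paired with φ'. -/
lemma integral_boundaryPower (hB : IsBody B n) (h : p.IsRegular B) (h' : p'.IsRegular B)
    {t : ℝ} (ht : 0 ≤ t) :
    ∫ x, boundaryPower B n p p' x t ∂(area B) = ∫ x in B, powerDensity B p p' x t := by
  have hf := frontier_subset_closure (s := B)
  have d1 : ∀ i, JC (frontier B) (p.P B n i) := fun i =>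
    hB.jc_traction (τ := fun j => p.τ j i) (m := fun k j => p.μ k j i)
      (fun j => (h.τ j i).jc) (fun k j => (h.μ k j i).c1)
  have d2 : ∀ i, JC (frontier B) (p.R n i) := fun i =>
    hB.jc_normalCouple (m := fun k j => p.μ k j i) (fun k j => (h.μ k j i).jc.mono hf)
  have d3 : JC (frontier B) (p.Λ B n) :=
    hB.jc_traction (fun j => (h.σ j).jc) fun k j => (h.Q k j).c1
  have d4 : JC (frontier B) (p.H n) := hB.jc_normalCouple fun k j => (h.Q k j).jc.mono hf
  have := fun i => (h'.u i).jc.mono hf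
  have := fun i => hB.jc_normalDeriv (h'.u i).c1
  have := h'.φ.jc.mono hf
  have := hB.jc_normalDeriv h'.φ.c1
  have i1 : ∀ i, Integrable (fun x => (p.P B n i x ⊛ p'.u i x) t
      + (p.R n i x ⊛ normalDeriv B n (p'.u i) x) t) (area B) := fun i =>
    hB.integrable_area (JC.slice (f := fun x t => (p.P B n i x ⊛ p'.u i x) t
      + (p.R n i x ⊛ normalDeriv B n (p'.u i) x) t) inferInstance ht)
  have i2 : Integrable (fun x => (p.Λ B n x ⊛ p'.φ x) t
      + (p.H n x ⊛ normalDeriv B n p'.φ x) t) (area B) :=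
    hB.integrable_area (JC.slice (f := fun x t => (p.Λ B n x ⊛ p'.φ x) t
      + (p.H n x ⊛ normalDeriv B n p'.φ x) t) inferInstance ht)
  have := fun i j => (h.τ i j).jc
  have := fun i j k => (h.μ i j k).jc
  have := fun i => (h.σ i).jc
  have := fun i j => (h.Q i j).jc
  have := h.jc_divStress
  have := h.jc_divElectric
  have := fun i => (h'.u i).jc
  have := fun i => (h'.u i).jc_pd
  have := fun i => (h'.u i).jc_pd_pd
  have := h'.φ.jc
  have := h'.φ.jc_pd
  have := h'.φ.jc_pd_pd
  have i3 : ∀ i, IntegrableOn (fun x => ∑ j, (p.τ j i x ⊛ pd B j (p'.u i) x) t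
      + ∑ j, ∑ k, (p.μ k j i x ⊛ pd B j (pd B k (p'.u i)) x) t
      + (p.divStress B i x ⊛ p'.u i x) t) B := fun i =>
    hB.integrableOn (JC.slice (f := fun x t => ∑ j, (p.τ j i x ⊛ pd B j (p'.u i) x) t
      + ∑ j, ∑ k, (p.μ k j i x ⊛ pd B j (pd B k (p'.u i)) x) t
      + (p.divStress B i x ⊛ p'.u i x) t) inferInstance ht)
  have i4 : IntegrableOn (fun x => ∑ j, (p.σ j x ⊛ pd B j p'.φ x) t
      + ∑ j, ∑ k, (p.Q k j x ⊛ pd B j (pd B k p'.φ) x) t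
      + (p.divElectric B x ⊛ p'.φ x) t) B :=
    hB.integrableOn (JC.slice (f := fun x t => ∑ j, (p.σ j x ⊛ pd B j p'.φ x) t
      + ∑ j, ∑ k, (p.Q k j x ⊛ pd B j (pd B k p'.φ) x) t
      + (p.divElectric B x ⊛ p'.φ x) t) inferInstance ht)
  have e1 := fun i => hB.integral_conv_green (fun j => h.τ j i) (fun k j => h.μ k j i) (h'.u i) ht
  have e2 := hB.integral_conv_green h.σ (fun k j => h.Q k j) h'.φ ht
  simp only [boundaryPower, powerDensity, add_assoc (∑ i, ((p.P B n i _ ⊛ p'.u i _) t + _))]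
  rw [integral_add (integrable_finsetSum _ fun i _ => i1 i) i2, integral_finsetSum _ fun i _ => i1 i,
    integral_add (integrable_finsetSum _ fun i _ => i3 i) i4, integral_finsetSum _ fun i _ => i3 i]
  exact congrArg₂ (· + ·) (Finset.sum_congr rfl fun i _ => e1 i) e2

end Functional

section Functional

variable {B : Set E3} {n : E3 → E3} {S Sg : Fin 5 → Set E3} {m : Material} {Γ : Data}
  {p p' : State}

lemma jc_calF (hΓ : Γ.IsCont B S Sg) (i : Fin 3) : JC (closure B) (calF m Γ i) := by
  have : JC (closure B) (Γ.f i) := ⟨hΓ.f i⟩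
  have h1 : JC (closure B) fun x t => m.ρ * Γ.v₀ i x * t :=
    (JC.of_space (continuousOn_const.mul (hΓ.v₀ i))).mul (JC.of_time ⟨continuousOn_id⟩)
  have h2 : JC (closure B) fun x _ => m.ρ * Γ.u₀ i x :=
    JC.of_space (continuousOn_const.mul (hΓ.u₀ i))
  unfold calF
  infer_instance

lemma jc_calH (hΓ : Γ.IsCont B S Sg) : JC (closure B) (calH m Γ) := by
  have : JC (closure B) Γ.h := ⟨hΓ.h⟩
  have h2 : JC (closure B) fun x _ => m.ρ * m.T₀ * Γ.η₀ x :=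
    JC.of_space (continuousOn_const.mul hΓ.η₀)
  unfold calH
  infer_instance

lemma jc_const_mul_exp (hΓ : Γ.IsCont B S Sg) (a b : ℝ) :
    JC (closure B) fun x t => a * Γ.θ₀ x * Real.exp (-t / b) :=
  (JC.of_space (continuousOn_const.mul hΓ.θ₀)).mul (JC.of_time (tc_of_continuous (by fun_prop)))

lemma jc_supplyDensity (hΓ : Γ.IsCont B S Sg) (h' : p'.IsRegular B) :
    JC (closure B) (supplyDensity m Γ p') := by
  have := jc_calF (m := m) hΓ
  have : JC (closure B) Γ.g := ⟨hΓ.g⟩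
  have := fun i => (h'.u i).jc
  have := h'.φ.jc
  unfold supplyDensity
  infer_instance

lemma jc_initialDensity (hΓ : Γ.IsCont B S Sg) (h' : p'.IsRegular B) :
    JC (closure B) (initialDensity m Γ p') := by
  have : ∀ i j, JC (closure B) (calL m Γ i j) := fun i j => jc_const_mul_exp hΓ _ _
  have : ∀ i j, JC (closure B) (calM m Γ i j) := fun i j => jc_const_mul_exp hΓ _ _
  have : JC (closure B) (calR m Γ) := jc_const_mul_exp hΓ _ _
  have := jc_calH (m := m) hΓ
  have := h'.e
  have := h'.V
  have := h'.θ.jc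
  unfold initialDensity
  infer_instance

/-- The integral of a kernel convolved twice with the volume integrals of a field. -/
lemma conv_conv_integral (hB : IsBody B n) {k k' : ℝ → ℝ} [TC k] [TC k'] {f : Field}
    (hf : JC (closure B) f) {t : ℝ} (ht : 0 ≤ t) :
    (k ⊛ k' ⊛ fun s => ∫ x in B, f x s) t = ∫ x in B, (k ⊛ k' ⊛ f x) t := by
  have := hB.isFiniteMeasure_volume
  rw [← conv_integral hB.isCompact hB.restrict_closure inferInstance
    (f := fun x => k' ⊛ f x) inferInstance ht]
  exact conv_congr_right
    (fun s hs => conv_integral hB.isCompact hB.restrict_closure inferInstance hf hs) ht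

/-- Time kernels commute with space integrals. Boundary integrals can thus be exchanged for volume
integrals underneath the kernels, after which the kernels move inside the integral over B. -/
lemma calI_eq_integral (hB : IsBody B n) (hΓ : Γ.IsCont B S Sg) (h : p.IsRegular B)
    (h' : p'.IsRegular B) {t : ℝ} (ht : 0 ≤ t) :
    calI B n m Γ p p' t = ∫ x in B, functionalDensity B m Γ p p' x t := by
  have := hB.isFiniteMeasure_volume
  have := hB.isFiniteMeasure_area
  have hf := frontier_subset_closure (s := B)
  have d1 := jc_supplyDensity (m := m) hΓ h'
  have d2 := jc_powerDensity h h'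
  have d3 := jc_heatDensity h h'
  have d4 := jc_initialDensity (m := m) hΓ h'
  have d5 := jc_boundaryPower hB h h'
  have d6 : JC (frontier B) (p.heatFlux n) :=
    JC.sum (hf := fun i => ((h.q i).jc.mono hf).mul (hB.jc_normal _ i))
  have d7 := h'.θ.jc.mono hf
  have e1 : ∀ s, 0 ≤ s → ∫ x, ((ζ m ⊛ boundaryPower B n p p' x) s
      + 1 / m.T₀ * (l ⊛ p.heatFlux n x ⊛ p'.θ x) s) ∂(area B)
      = ∫ x in B, ((ζ m ⊛ powerDensity B p p' x) s
        + 1 / m.T₀ * (l ⊛ heatDensity B p p' x) s) := by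
    intro s hs
    have i1 : Integrable (fun x => (ζ m ⊛ boundaryPower B n p p' x) s) (area B) :=
      hB.integrable_area (JC.slice (f := fun x => ζ m ⊛ boundaryPower B n p p' x) inferInstance hs)
    have i2 : Integrable (fun x => (l ⊛ p.heatFlux n x ⊛ p'.θ x) s) (area B) :=
      hB.integrable_area (JC.slice (f := fun x => l ⊛ p.heatFlux n x ⊛ p'.θ x) inferInstance hs)
    have i3 : IntegrableOn (fun x => (ζ m ⊛ powerDensity B p p' x) s) B :=
      hB.integrableOn (JC.slice (f := fun x => ζ m ⊛ powerDensity B p p' x) inferInstance hs)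
    have i4 : IntegrableOn (fun x => (l ⊛ heatDensity B p p' x) s) B :=
      hB.integrableOn (JC.slice (f := fun x => l ⊛ heatDensity B p p' x) inferInstance hs)
    rw [integral_add i1 (i2.const_mul _), integral_add i3 (i4.const_mul _), integral_const_mul,
      integral_const_mul, ← conv_integral hB.isCompact_frontier hB.restrict_frontier inferInstance
        d5 hs, ← conv_integral hB.isCompact_frontier hB.restrict_frontier inferInstance
        (f := fun x => p.heatFlux n x ⊛ p'.θ x) inferInstance hs,
      ← conv_integral hB.isCompact hB.restrict_closure inferInstance d2 hs,
      ← conv_integral hB.isCompact hB.restrict_closure inferInstance d3 hs]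
    congr 1
    · exact conv_congr_right (fun r hr => integral_boundaryPower hB h h' hr) hs
    · congr 1
      exact conv_congr_right (fun r hr => hB.integral_conv_flux h.q h'.θ hr) hs
  have e2 : calI B n m Γ p p' t
      = (χ m ⊛ ζ m ⊛ fun s => ∫ x in B, supplyDensity m Γ p' x s) t
        + (χ m ⊛ ξ ⊛ fun s => ∫ x, ((ζ m ⊛ boundaryPower B n p p' x) s
          + 1 / m.T₀ * (l ⊛ p.heatFlux n x ⊛ p'.θ x) s) ∂(area B)) t
        + (ξ ⊛ fun s => ∫ x in B, initialDensity m Γ p' x s) t := rfl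
  have e3 : (χ m ⊛ ξ ⊛ fun s => ∫ x, ((ζ m ⊛ boundaryPower B n p p' x) s
          + 1 / m.T₀ * (l ⊛ p.heatFlux n x ⊛ p'.θ x) s) ∂(area B)) t
      = (χ m ⊛ ξ ⊛ fun s => ∫ x in B, ((ζ m ⊛ powerDensity B p p' x) s
        + 1 / m.T₀ * (l ⊛ heatDensity B p p' x) s)) t :=
    conv_congr_right (fun s hs => conv_congr_right e1 hs) ht
  have j1 : IntegrableOn (fun x => (χ m ⊛ ζ m ⊛ supplyDensity m Γ p' x) t) B :=
    hB.integrableOn (JC.slice (f := fun x => χ m ⊛ ζ m ⊛ supplyDensity m Γ p' x) inferInstance ht)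
  have j2 : IntegrableOn (fun x => (χ m ⊛ ξ ⊛ fun s => (ζ m ⊛ powerDensity B p p' x) s
        + 1 / m.T₀ * (l ⊛ heatDensity B p p' x) s) t) B :=
    hB.integrableOn (JC.slice (f := fun x => χ m ⊛ ξ ⊛ fun s => (ζ m ⊛ powerDensity B p p' x) s
        + 1 / m.T₀ * (l ⊛ heatDensity B p p' x) s) inferInstance ht)
  have j3 : IntegrableOn (fun x => (ξ ⊛ initialDensity m Γ p' x) t) B :=
    hB.integrableOn (JC.slice (f := fun x => ξ ⊛ initialDensity m Γ p' x) inferInstance ht)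
  have d8 : JC (closure B) fun x s => (ζ m ⊛ powerDensity B p p' x) s
      + 1 / m.T₀ * (l ⊛ heatDensity B p p' x) s := inferInstance
  simp only [functionalDensity]
  rw [e2, e3, conv_conv_integral hB d1 ht, conv_conv_integral hB d8 ht, conv_integral hB.isCompact hB.restrict_closure inferInstance d4 ht,
    ← integral_add j1 j2]
  exact (integral_add (j1.add j2) j3).symm

/-! ### The density in the convolution ring -/

lemma tc_functionalDensity (hΓ : Γ.IsCont B S Sg) (h : p.IsRegular B)
    (h' : p'.IsRegular B) {x : E3} (hx : x ∈ B) : TC (functionalDensity B m Γ p p' x) := by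
  have hx' := subset_closure hx
  have d1 := (jc_supplyDensity (m := m) hΓ h').tc hx'
  have d2 := (jc_powerDensity h h').tc hx'
  have d3 := (jc_heatDensity h h').tc hx'
  have d4 := (jc_initialDensity (m := m) hΓ h').tc hx'
  unfold functionalDensity
  infer_instance

/-- The geometric equations replace gradients by e', κ', E', V', the minus signs coming from E =
-∇φ, and the electric balance replaces the divergence by g. -/
lemma toR_powerDensity (hB : IsBody B n) {Γ' : Data} (hp : p.IsSolution B n S Sg m Γ)
    (hp' : p'.IsSolution B n S Sg m Γ') {x : E3} (hx : x ∈ B) :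
    toR (powerDensity B p p' x)
      = ∑ i, ∑ j, toR (p.τ i j x) * toR (p'.e i j x)
        + ∑ k, ∑ j, ∑ i, toR (p.μ k j i x) * toR (p'.κ k j i x)
        + ∑ i, toR (p.divStress B i x) * toR (p'.u i x)
        - ∑ i, toR (p.σ i x) * toR (p'.el i x)
        - ∑ k, ∑ j, toR (p.Q k j x) * toR (p'.V k j x) + toR (Γ.g x) * toR (p'.φ x) := by
  have hx' := subset_closure hx
  have h := hp.isRegular hB
  have h' := hp'.isRegular hB
  have := fun i j => (h.τ i j).jc.tc hx'
  have := fun i j k => (h.μ i j k).jc.tc hx'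
  have := fun i => (h.σ i).jc.tc hx'
  have := fun i j => (h.Q i j).jc.tc hx'
  have := fun i => (h.jc_divStress i).tc hx'
  have := h.jc_divElectric.tc hx'
  have := fun i => (h'.u i).jc.tc hx'
  have := fun i j => ((h'.u i).jc_pd j).tc hx'
  have := fun i j k => ((h'.u i).jc_pd_pd j k).tc hx'
  have := h'.φ.jc.tc hx'
  have := fun i => (h'.φ.jc_pd i).tc hx'
  have := fun i j => (h'.φ.jc_pd_pd i j).tc hx'
  have he : ∀ i j, toR (p'.e i j x)
      = constR (1 / 2) * (toR (pd B j (p'.u i) x) + toR (pd B i (p'.u j) x)) := fun i j => by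
    rw [← toR_add, ← toR_constR_mul]
    exact toR_congr (hp'.field.e_eq i j x hx)
  have hτ : ∀ i j, toR (p.τ i j x) = toR (p.τ j i x) := fun i j =>
    toR_congr (hp.admissible.τ_symm i j x hx')
  have hκ : ∀ k j i, toR (pd B j (pd B k (p'.u i)) x) = toR (p'.κ k j i x) := fun k j i =>
    (toR_congr (hp'.field.κ_eq k j i x hx)).symm
  have hel : ∀ i, toR (pd B i p'.φ x) = - toR (p'.el i x) := fun i => by
    rw [toR_congr (hp'.field.el_eq i x hx), toR_neg, neg_neg]
  have hV : ∀ k j, toR (pd B j (pd B k p'.φ) x) = - toR (p'.V k j x) := fun k j => by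
    rw [toR_congr (hp'.field.V_eq k j x hx), toR_neg, neg_neg]
  have hg : toR (p.divElectric B x) = toR (Γ.g x) := toR_congr (hp.field.electric x hx)
  -- A symmetric stress sees only the symmetric part of the displacement gradient.
  have s1 : ∑ i, ∑ j, toR (p.τ j i x) * toR (pd B j (p'.u i) x)
      = ∑ i, ∑ j, toR (p.τ i j x) * toR (p'.e i j x) := by
    have s2 : ∑ i, ∑ j, toR (p.τ i j x) * toR (p'.e i j x)
        = constR (1 / 2) * (∑ i, ∑ j, toR (p.τ j i x) * toR (pd B j (p'.u i) x))
          + constR (1 / 2) * ∑ i, ∑ j, toR (p.τ i j x) * toR (pd B i (p'.u j) x) := by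
      simp only [Finset.mul_sum, ← Finset.sum_add_distrib]
      refine Finset.sum_congr rfl fun i _ => Finset.sum_congr rfl fun j _ => ?_
      rw [he, hτ j i]
      ring
    have s3 : constR (1 / 2) + constR (1 / 2) = 1 := by
      rw [← map_add, add_halves, map_one]
    rw [s2, Finset.sum_comm (f := fun i j => toR (p.τ i j x) * toR (pd B i (p'.u j) x)), ← add_mul,
      s3, one_mul]
  have s4 : ∑ i, ∑ j, ∑ k, toR (p.μ k j i x) * toR (p'.κ k j i x)
      = ∑ k, ∑ j, ∑ i, toR (p.μ k j i x) * toR (p'.κ k j i x) := by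
    rw [Finset.sum_comm]
    simp_rw [Finset.sum_comm (s := Finset.univ) (t := Finset.univ)
      (f := fun i k => toR (p.μ k _ i x) * toR (p'.κ k _ i x))]
    rw [Finset.sum_comm]
  have s5 : ∑ j, ∑ k, toR (p.Q k j x) * toR (p'.V k j x)
      = ∑ k, ∑ j, toR (p.Q k j x) * toR (p'.V k j x) := Finset.sum_comm
  unfold powerDensity
  simp only [toR_add, toR_sum, toR_conv, hκ, hel, hV, hg, Finset.sum_add_distrib, mul_neg,
    Finset.sum_neg_distrib]
  rw [s1, s4, s5]
  ring

lemma toR_functionalDensity (hB : IsBody B n) {Γ' : Data} (hΓ : Γ.IsCont B S Sg)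
    (hp : p.IsSolution B n S Sg m Γ) (hp' : p'.IsSolution B n S Sg m Γ') {x : E3} (hx : x ∈ B) :
    toR (functionalDensity B m Γ p p' x)
      = AbstractState.form m.abstract (p.abstract B m Γ x) (p'.abstract B m Γ' x) := by
  have hx' := subset_closure hx
  have h := hp.isRegular hB
  have h' := hp'.isRegular hB
  have d1 := (jc_supplyDensity (m := m) hΓ h').tc hx'
  have d2 := (jc_powerDensity h h').tc hx'
  have d3 := (jc_heatDensity h h').tc hx'
  have d4 := (jc_initialDensity (m := m) hΓ h').tc hx'
  have := fun i => (jc_calF (m := m) hΓ i).tc hx'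
  have : TC (Γ.g x) := JC.tc ⟨hΓ.g⟩ hx'
  have : ∀ i j, TC (calL m Γ i j x) := fun i j => (jc_const_mul_exp hΓ _ _).tc hx'
  have : ∀ i j, TC (calM m Γ i j x) := fun i j => (jc_const_mul_exp hΓ _ _).tc hx'
  have : TC (calR m Γ x) := (jc_const_mul_exp hΓ _ _).tc hx'
  have := (jc_calH (m := m) hΓ).tc hx'
  have := fun i j => (h'.e i j).tc hx'
  have := fun i j => (h'.V i j).tc hx'
  have := fun i => (h.q i).jc.tc hx'
  have := h.jc_divHeat.tc hx'
  have := fun i => (h'.u i).jc.tc hx'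
  have := h'.φ.jc.tc hx'
  have := h'.θ.jc.tc hx'
  have := fun i => (h'.θ.jc_pd i).tc hx'
  have hb : ∀ j, toR (pd B j p'.θ x) = toR (p'.b j x) := fun j =>
    (toR_congr (hp'.field.b_eq j x hx)).symm
  have e1 : toR (supplyDensity m Γ p' x) = ∑ i, toR (calF m Γ i x) * toR (p'.u i x)
      - toR ξ * (toR (Γ.g x) * toR (p'.φ x)) := by
    unfold supplyDensity
    simp only [toR_sub, toR_sum, toR_conv]
  have e2 : toR (heatDensity B p p' x) = ∑ j, toR (p.q j x) * toR (p'.b j x)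
      + toR (p.divHeat B x) * toR (p'.θ x) := by
    unfold heatDensity
    simp only [toR_add, toR_sum, toR_conv, hb]
  have e3 : toR (initialDensity m Γ p' x) = toR (χ m) * ∑ i, ∑ j,
      (toR (calL m Γ i j x) * toR (p'.e i j x) + toR (calM m Γ i j x) * toR (p'.V i j x))
      + toR (calR m Γ x) * toR (p'.θ x)
      - toR (χ m) * (constR (1 / m.T₀) * toR (calH m Γ x) * toR (p'.θ x)) := by
    unfold initialDensity
    simp only [toR_add, toR_sub, toR_sum, toR_conv, toR_constR_mul]
  have e4 : toR (functionalDensity B m Γ p p' x)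
      = toR (χ m) * (toR (ζ m) * toR (supplyDensity m Γ p' x))
        + toR (χ m) * (toR ξ * (toR (ζ m) * toR (powerDensity B p p' x)
          + constR (1 / m.T₀) * (toR l * toR (heatDensity B p p' x))))
        + toR ξ * toR (initialDensity m Γ p' x) := by
    unfold functionalDensity
    simp only [toR_add, toR_conv, toR_constR_mul]
  rw [e4, e1, e2, e3, toR_powerDensity hB hp hp' hx]
  simp only [AbstractState.form, Material.abstract, State.abstract, Fintype.sum_prod_type]
  ring

/-- The two densities already agree at every point of B; injectivity of `toR` on continuous
functions of t ≥ 0 brings the algebraic symmetry back to values at time t. -/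
lemma calI_symm (hB : IsBody B n) (hm : m.IsAdmissible) {Γ' : Data} (hΓ : Γ.IsCont B S Sg)
    (hΓ' : Γ'.IsCont B S Sg) (hp : p.IsSolution B n S Sg m Γ)
    (hp' : p'.IsSolution B n S Sg m Γ') {t : ℝ} (ht : 0 ≤ t) :
    calI B n m Γ p p' t = calI B n m Γ' p' p t := by
  have h := hp.isRegular hB
  have h' := hp'.isRegular hB
  rw [calI_eq_integral hB hΓ h h' ht, calI_eq_integral hB hΓ' h' h ht]
  refine setIntegral_congr_fun hB.isOpen.measurableSet fun x hx => ?_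
  have := tc_functionalDensity (m := m) hΓ h h' hx
  have := tc_functionalDensity (m := m) hΓ' h' h hx
  refine eq_of_toR_eq ?_ ht
  rw [toR_functionalDensity hB hΓ hp hp' hx, toR_functionalDensity hB hΓ' hp' hp hx]
  exact AbstractState.form_symm hm.abstract (hp.abstract_solves hm hB hΓ hx)
    (hp'.abstract_solves hm hB hΓ' hx)

end Functional

end Thermopiezo

end

theorem mainTheorem3
    (B : Set Thermopiezo.E3) (hB_open : IsOpen B) (hB_bdd : Bornology.IsBounded B)
    (hB_smooth : Thermopiezo.HasSmoothBoundary B)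
    (n : Thermopiezo.E3 → Thermopiezo.E3) (hn : Thermopiezo.IsOutwardUnitNormal B n)
    (S Sg : Fin 5 → Set Thermopiezo.E3) (hS : Thermopiezo.IsBoundaryPartition B S Sg)
    (m : Thermopiezo.Material) (hm : m.IsAdmissible)
    (Γ : Fin 2 → Thermopiezo.Data) (hΓ : ∀ α, (Γ α).IsCont B S Sg)
    (p : Fin 2 → Thermopiezo.State) (hp : ∀ α, (p α).IsSolution B n S Sg m (Γ α)) :
    ∀ α β : Fin 2, ∀ t : ℝ, 0 ≤ t →
      Thermopiezo.calI B n m (Γ α) (p α) (p β) t =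
        Thermopiezo.calI B n m (Γ β) (p β) (p α) t := by
  intro α β t ht
  exact Thermopiezo.calI_symm ⟨hB_open, hB_bdd, hB_smooth, hn⟩ hm (hΓ α) (hΓ β) (hp α) (hp β) ht
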